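/- **Setting.** Let $n\ge 1$ and let $\overline M$ be a smooth ($C^\infty$) manifold of dimension $n+1$ with boundary $\partial M$ and interior $M$. A defining function on an open set $U\subset\overline M$ is a smooth $\rho:U\to[0,\infty)$ with $\rho^{-1}(0)=U\cap\partial M$ and $d\rho\neq 0$ along $U\cap\partial M$. Let $\mathcal E(w)=\mathrm{vol}^{-w/(n+2)}$ be the bundle of densities of projective weight $w$, where $\mathrm{vol}$ is the bundle of volume densities. Let $\nabla$ be a smooth torsion-free affine connection on $M$ which is special (it preserves a nowhere vanishing section of $\mathrm{vol}$) and projectively compact of order $2$: every point of $\partial M$ has a neighbourhood $U$ in $\overline M$ with a defining function $\rho$ such that the connection $(\xi,\eta)\mapsto\nabla_\xi\eta+\tfrac1{2\rho}\big(d\rho(\xi)\eta+d\rho(\eta)\xi\big)$ on $U\cap M$ extends smoothly to $U$. Let $\mathrm{Ric}_{ab}$ be the Ricci tensor of $\nabla$, and let $\tau$ be a nowhere vanishing section of $\mathcal E(2)$ over $M$ which is parallel for $\nabla$. Let $\mathcal T^*=J^1\mathcal E(1)$ be the standard cotractor bundle of a projective structure on $\overline M$, and $\mathcal T$ its dual,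 with canonical line subbundle $\mathcal E(-1)\subset\mathcal T$. A connection $\tilde\nabla$ in the projective class, preserving a volume density and with Schouten tensor $\tilde{\mathsf P}_{ab}=\frac1n\widetilde{\mathrm{Ric}}_{ab}$, identifies $\mathcal T^*$ with $\mathcal E(1)\oplus\mathcal E_a(1)$, and the tractor connection is $\nabla_a(\sigma,\mu_b)=(\tilde\nabla_a\sigma-\mu_a,\ \tilde\nabla_a\mu_b+\tilde{\mathsf P}_{ab}\sigma)$. It induces a connection on $S^2\mathcal T^*\cong\mathcal E(2)\oplus\mathcal E_a(2)\oplus\mathcal E_{(ab)}(2)$. Let $\partial^*:\Lambda^kT^*\overline M\otimes S^2\mathcal T^*\to\Lambda^{k-1}T^*\overline M\otimes S^2\mathcal T^*$ be the Kostant codifferential, induced by the action $\varphi\cdot(\sigma,\mu)=(0,\sigma\varphi)$ of one-forms on $\mathcal T^*$. For a section $\tau$ of $\mathcal E(2)$, $L(\tau)$ denotes the section of $S^2\mathcal T^*$ with component $\tau$ in $\mathcal E(2)$ and with $\nabla L(\tau)\in\ker\partial^*$. The section $\tau$ is a solution of the first BGG equation if $\nabla L(\tau)\in\mathrm{im}\,\partial^*$,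 and a normal solution if $\nabla L(\tau)=0$. **Theorem.** The projective class of $\nabla$ extends to a projective structure on $\overline M$, and $\tau$ extends by zero to a smooth section of $\mathcal E(2)$ over $\overline M$ which is a defining density for $\partial M$ (its zero locus is $\partial M$, and near each boundary point it is a defining function times a nowhere vanishing density). The section $L(\tau)$ exists on $\overline M$, and: (i) $\tau$ is a solution of the first BGG equation on $\overline M$ if and only if $\nabla_{(a}\mathrm{Ric}_{bc)}=0$ on $M$. (ii) $\tau$ is a normal solution on $\overline M$ if and only if $\nabla_a\mathrm{Ric}_{bc}=0$ on $M$. Suppose that $\tau$ is a normal solution and that $\mathrm{Ric}_{ab}$ is non-degenerate on $M$. Then $\mathrm{Ric}_{ab}$ is a pseudo-Riemannian Einstein metric on $M$ with Levi-Civita connection $\nabla$. Moreover, for every connected component $C$ of $\overline M$ there are $p,q$ with $p+q=n+2$ such that over $C$ the section $L(\tau)$ is a parallel, non-degenerate bundle metric of signature $(p,q)$ on $\mathcal T$, that is, a reduction of projective holonomy to $O(p,q)$. Call two points of $C$ equivalent if some linear isomorphism between the fibres of $\mathcal T$ matches the values of $L(\tau)$ and the canonical rays in $\mathcal E(-1)$;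 the curved orbits of the reduction are the equivalence classes. They are $C\cap M$, which is open, and (if it is non-empty) $C\cap\partial M$, which is closed. If $C\cap\partial M\ne\emptyset$, then $p,q\ge1$, so $L(\tau)$ is indefinite, and $C\cap\partial M$ inherits a conformal structure of signature $(p-1,q-1)$: along it $\mathcal E(-1)^\perp/\mathcal E(-1)\cong T\partial M\otimes\mathcal E(-1)$, and the form induced there by $L(\tau)$ is non-degenerate and defines the conformal structure. -/

import Mathlib

open Set Bundle
open scoped Manifold ContDiff Matrix

noncomputable section

namespace ProjCompact

/-! ### Smooth charts and coordinate calculus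

`n + 1` is the dimension, the model space is the half space `{y : 0 ≤ y 0}`. Objects are described
by their components in all charts of the maximal smooth atlas. -/

/-- The coordinate space `ℝ^(n+1)`. -/
abbrev Coord (n : ℕ) : Type := EuclideanSpace ℝ (Fin (n + 1))

section Charts

variable (n : ℕ) (M : Type*) [TopologicalSpace M] [ChartedSpace (EuclideanHalfSpace (n + 1)) M]

/-- Smooth charts of a manifold with boundary. -/
abbrev SmoothChart : Type _ :=
  {e : OpenPartialHomeomorph M (EuclideanHalfSpace (n + 1)) //
    e ∈ IsManifold.maximalAtlas (𝓡∂ (n + 1)) ∞ M}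

/-- The interior of the manifold with boundary. -/
abbrev inner : Set M := (𝓡∂ (n + 1)).interior M

/-- The boundary of the manifold with boundary. -/
abbrev bdry : Set M := (𝓡∂ (n + 1)).boundary M

end Charts

variable {n : ℕ} {M : Type*} [TopologicalSpace M] [ChartedSpace (EuclideanHalfSpace (n + 1)) M]

namespace SmoothChart

/-- The coordinate map of a chart, with values in `ℝ^(n+1)`. -/
def toCoord (e : SmoothChart n M) (x : M) : Coord n := (e.1.extend (𝓡∂ (n + 1))) x

/-- The inverse of the coordinate map. -/
def point (e : SmoothChart n M) (y : Coord n) : M := (e.1.extend (𝓡∂ (n + 1))).symm y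

/-- The part of the coordinate domain of the chart `e` that parametrizes `U ∩ e.source`. -/
def dom (e : SmoothChart n M) (U : Set M) : Set (Coord n) :=
  (e.1.extend (𝓡∂ (n + 1))).target ∩ e.point ⁻¹' U

end SmoothChart

/-- The partial derivative `∂f/∂y^a` on the half space (one-sided at the boundary). -/
def pd {F : Type*} [NormedAddCommGroup F] [NormedSpace ℝ F] (f : Coord n → F)
    (a : Fin (n + 1)) (y : Coord n) : F :=
  fderivWithin ℝ f (range (𝓡∂ (n + 1))) y (EuclideanSpace.single a 1)

/-- The coordinate change `φ` from the chart `e` to the chart `e'`. -/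
def coordChange (e e' : SmoothChart n M) (y : Coord n) : Coord n := e'.toCoord (e.point y)

/-- The Jacobian `J^k_a = ∂φ^k/∂y^a` of a coordinate change. -/
def jac (e e' : SmoothChart n M) (y : Coord n) : Matrix (Fin (n + 1)) (Fin (n + 1)) ℝ :=
  Matrix.of fun k a => pd (fun z => coordChange e e' z k) a y

/-- The second derivatives `∂²φ^k/∂y^a∂y^b` of a coordinate change. -/
def hess (e e' : SmoothChart n M) (y : Coord n) (a b k : Fin (n + 1)) : ℝ :=
  pd (fun z => jac e e' z k b) a y

/-- The Kronecker symbol. -/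
def kron (a b : Fin (n + 1)) : ℝ := if a = b then 1 else 0

/-! ### Torsion-free affine connections -/

/-- Operators with the type of a covariant derivative on the tangent bundle; `cov η x ξ` is
`(∇_ξ η)(x)`. -/
abbrev CovOp (n : ℕ) (M : Type*) [TopologicalSpace M]
    [ChartedSpace (EuclideanHalfSpace (n + 1)) M] : Type _ :=
  (Π x : M, TangentSpace (𝓡∂ (n + 1)) x) →
    (Π x : M, TangentSpace (𝓡∂ (n + 1)) x →L[ℝ] TangentSpace (𝓡∂ (n + 1)) x)

/-- The vector field `X` is differentiable at `x`. -/
def VFieldDiffAt [IsManifold (𝓡∂ (n + 1)) ∞ M]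
    (X : Π x : M, TangentSpace (𝓡∂ (n + 1)) x) (x : M) : Prop :=
  MDifferentiableAt (𝓡∂ (n + 1)) ((𝓡∂ (n + 1)).prod 𝓘(ℝ, Coord n))
    (fun z => (⟨z, X z⟩ : TangentBundle (𝓡∂ (n + 1)) M)) x

/-- `cov` has no torsion on `U`. -/
def IsTorsionFreeOn [IsManifold (𝓡∂ (n + 1)) ∞ M] (cov : CovOp n M) (U : Set M) : Prop :=
  ∀ (X Y : Π x : M, TangentSpace (𝓡∂ (n + 1)) x), ∀ x ∈ U,
    VFieldDiffAt X x → VFieldDiffAt Y x →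
      cov Y x (X x) - cov X x (Y x) = VectorField.mlieBracket (𝓡∂ (n + 1)) X Y x

/-- A smooth torsion-free affine connection on the open set `U`: a covariant derivative on `TM`
over `U` such that `∇_ξ η` is smooth whenever `ξ`, `η` are smooth on an open subset of `U`. -/
structure IsAffineConnectionOn [IsManifold (𝓡∂ (n + 1)) ∞ M] (cov : CovOp n M) (U : Set M) :
    Prop where
  isCov : IsCovariantDerivativeOn (Coord n) cov U
  smooth : ∀ V ⊆ U, IsOpen V → ContMDiffCovariantDerivativeOn (Coord n) ∞ cov V
  torsionFree : IsTorsionFreeOn cov U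

/-- The coordinate vector field `∂/∂y^a` of a chart. -/
def coordField (e : SmoothChart n M) (a : Fin (n + 1)) : Π x : M, TangentSpace (𝓡∂ (n + 1)) x :=
  VectorField.mpullback (𝓡∂ (n + 1)) 𝓘(ℝ, Coord n) e.toCoord
    (fun _ => (EuclideanSpace.single a (1 : ℝ) : Coord n))

/-- The Christoffel symbols `Γ^c_{ab}` of an affine connection in a chart: the `c`-th component of
`∇_{∂_a} ∂_b`. -/
def christoffel (cov : CovOp n M) (e : SmoothChart n M) (y : Coord n) (a b c : Fin (n + 1)) : ℝ :=
  (show Coord n from mfderiv (𝓡∂ (n + 1)) 𝓘(ℝ, Coord n) e.toCoord (e.point y)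
    (cov (coordField e b) (e.point y) (coordField e a (e.point y)))) c

/-- The Ricci tensor `Ric_{bd} = R_{ab}{}^a{}_d`, where
`(∇_a ∇_b - ∇_b ∇_a) v^c = R_{ab}{}^c{}_d v^d`, of the connection with Christoffel symbols `G`. -/
def ricci (G : Coord n → Fin (n + 1) → Fin (n + 1) → Fin (n + 1) → ℝ) (y : Coord n) :
    Matrix (Fin (n + 1)) (Fin (n + 1)) ℝ :=
  Matrix.of fun b d =>
    ∑ a, (pd (fun z => G z b d a) a y - pd (fun z => G z a d a) b y
      + ∑ f, (G y a f a * G y b d f - G y b f a * G y a d f))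

/-- Families of components `g_{bc}` of a `(0,2)`-tensor field, one for each chart. -/
abbrev TensorComponents (n : ℕ) (M : Type*) [TopologicalSpace M]
    [ChartedSpace (EuclideanHalfSpace (n + 1)) M] : Type _ :=
  SmoothChart n M → Coord n → Matrix (Fin (n + 1)) (Fin (n + 1)) ℝ

/-- The Ricci tensor of an affine connection, in all charts. -/
def Ric (cov : CovOp n M) : TensorComponents n M := fun e => ricci (christoffel cov e)

/-- The covariant derivative `∇_a g_{bc}` of a `(0,2)`-tensor field. -/
def covTensor (cov : CovOp n M) (g : TensorComponents n M) (e : SmoothChart n M) (y : Coord n)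
    (a b c : Fin (n + 1)) : ℝ :=
  pd (fun z => g e z b c) a y
    - ∑ d, christoffel cov e y a b d * g e y d c - ∑ d, christoffel cov e y a c d * g e y b d

/-- `∇ g = 0` on `U`. -/
def IsParallelTensor (cov : CovOp n M) (g : TensorComponents n M) (U : Set M) : Prop :=
  ∀ e : SmoothChart n M, ∀ y ∈ e.dom U, ∀ a b c, covTensor cov g e y a b c = 0

/-- `∇_{(a} g_{bc)} = 0` on `U`. -/
def IsSymParallelTensor (cov : CovOp n M) (g : TensorComponents n M) (U : Set M) : Prop :=
  ∀ e : SmoothChart n M, ∀ y ∈ e.dom U, ∀ a b c,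
    covTensor cov g e y a b c + covTensor cov g e y a c b + covTensor cov g e y b a c
      + covTensor cov g e y b c a + covTensor cov g e y c a b + covTensor cov g e y c b a = 0

/-- `g` is non-degenerate at all points of `U`. -/
def IsNondegenerateOn (g : TensorComponents n M) (U : Set M) : Prop :=
  ∀ e : SmoothChart n M, ∀ y ∈ e.dom U, (g e y).det ≠ 0

/-- `g` is a pseudo-Riemannian metric on `U`. -/
structure IsPseudoRiemannianOn (g : TensorComponents n M) (U : Set M) : Prop where
  smooth : ∀ e : SmoothChart n M, ∀ b c, ContDiffOn ℝ ∞ (fun y => g e y b c) (e.dom U)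
  transform : ∀ e e' : SmoothChart n M, ∀ y ∈ e.dom (U ∩ e'.1.source),
    g e y = (jac e e' y)ᵀ * g e' (coordChange e e' y) * jac e e' y
  symm : ∀ e : SmoothChart n M, ∀ y ∈ e.dom U, (g e y).IsSymm
  nondegenerate : IsNondegenerateOn g U

/-- `cov` is the Levi-Civita connection of the metric `g` on `U`. -/
def IsLeviCivitaOn [IsManifold (𝓡∂ (n + 1)) ∞ M] (cov : CovOp n M)
    (g : TensorComponents n M) (U : Set M) : Prop :=
  IsTorsionFreeOn cov U ∧ IsParallelTensor cov g U

/-- `g` is an Einstein metric on `U` with Levi-Civita connection `cov`. -/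
def IsEinsteinOn [IsManifold (𝓡∂ (n + 1)) ∞ M] (cov : CovOp n M)
    (g : TensorComponents n M) (U : Set M) : Prop :=
  IsPseudoRiemannianOn g U ∧ IsLeviCivitaOn cov g U ∧
    ∃ c : ℝ, ∀ e : SmoothChart n M, ∀ y ∈ e.dom U, Ric cov e y = c • g e y

/-! ### Densities -/

/-- Smooth sections over `U` of the line bundle `vol(M)^r`, the `r`-th power of the bundle of
volume densities: in the chart `e`, the section is `coef e • |dy|^r`. -/
structure Density (n : ℕ) (M : Type*) [TopologicalSpace M]
    [ChartedSpace (EuclideanHalfSpace (n + 1)) M] (r : ℝ) (U : Set M) where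
  coef : SmoothChart n M → Coord n → ℝ
  smooth : ∀ e, ContDiffOn ℝ ∞ (coef e) (e.dom U)
  transform : ∀ e e' : SmoothChart n M, ∀ y ∈ e.dom (U ∩ e'.1.source),
    coef e y = |(jac e e' y).det| ^ r * coef e' (coordChange e e' y)

/-- Sections of the bundle `ℰ(w) = vol(M)^{-w/(n+2)}` of densities of projective weight `w`. -/
abbrev ProjDensity (n : ℕ) (M : Type*) [TopologicalSpace M]
    [ChartedSpace (EuclideanHalfSpace (n + 1)) M] (w : ℝ) (U : Set M) : Type _ :=
  Density n M (-w / ((n : ℝ) + 2)) U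

/-- The density is parallel for the connection on `vol(M)^r` induced by `cov`. -/
def Density.IsParallel {r : ℝ} {U : Set M} (σ : Density n M r U) (cov : CovOp n M) : Prop :=
  ∀ e : SmoothChart n M, ∀ y ∈ e.dom U, ∀ a,
    pd (σ.coef e) a y - r * (∑ b, christoffel cov e y a b b) * σ.coef e y = 0

/-- The density vanishes nowhere on its domain. -/
def Density.NowhereZero {r : ℝ} {U : Set M} (σ : Density n M r U) : Prop :=
  ∀ e : SmoothChart n M, ∀ y ∈ e.dom U, σ.coef e y ≠ 0

/-- The density `σ` on all of `M` extends the density `σ₀`. -/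
def Density.Extends {r : ℝ} {U : Set M} (σ : Density n M r univ) (σ₀ : Density n M r U) : Prop :=
  ∀ e : SmoothChart n M, ∀ y ∈ e.dom U, σ.coef e y = σ₀.coef e y

/-- The affine connection `cov` on the interior preserves a volume density. -/
def IsSpecial (cov : CovOp n M) : Prop :=
  ∃ ν : Density n M 1 (inner n M), ν.NowhereZero ∧ ν.IsParallel cov

/-- `ρ`, considered on the open set `U`, is a local defining function for the boundary. -/
structure IsDefiningFunctionOn (ρ : M → ℝ) (U : Set M) : Prop where
  smooth : ContMDiffOn (𝓡∂ (n + 1)) 𝓘(ℝ, ℝ) ∞ ρ U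
  nonneg : ∀ x ∈ U, 0 ≤ ρ x
  zero_iff : ∀ x ∈ U, ρ x = 0 ↔ x ∈ bdry n M
  deriv_ne : ∀ x ∈ U, x ∈ bdry n M → mfderiv (𝓡∂ (n + 1)) 𝓘(ℝ, ℝ) ρ x ≠ 0

/-- `σ` is a defining density for the boundary: its zero locus is the boundary, and near every
boundary point it is the product of a local defining function and a nowhere vanishing density. -/
def Density.IsDefining {r : ℝ} (σ : Density n M r univ) : Prop :=
  (∀ e : SmoothChart n M, ∀ y ∈ e.dom univ, σ.coef e y = 0 ↔ e.point y ∈ bdry n M) ∧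
  ∀ x ∈ bdry n M, ∃ U : Set M, IsOpen U ∧ x ∈ U ∧
    ∃ ρ : M → ℝ, IsDefiningFunctionOn (n := n) ρ U ∧
      ∃ σ' : Density n M r U, σ'.NowhereZero ∧
        ∀ e : SmoothChart n M, ∀ y ∈ e.dom U, σ.coef e y = ρ (e.point y) * σ'.coef e y

/-! ### Projective compactness and projective structures -/

/-- The affine connection `∇ = cov` on the interior is projectively compact of order `α`: near each
boundary point, `∇ + dρ/(αρ)`, that is
`∇_ξ η + (dρ(ξ) η + dρ(η) ξ) / (αρ)`, extends smoothly to the boundary. -/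
def IsProjectivelyCompact [IsManifold (𝓡∂ (n + 1)) ∞ M] (cov : CovOp n M) (α : ℝ) : Prop :=
  ∀ x ∈ bdry n M, ∃ U : Set M, IsOpen U ∧ x ∈ U ∧
    ∃ ρ : M → ℝ, IsDefiningFunctionOn (n := n) ρ U ∧
      ∃ cov' : CovOp n M, IsAffineConnectionOn cov' U ∧
        ∀ z ∈ U ∩ inner n M, ∀ (η : Π x : M, TangentSpace (𝓡∂ (n + 1)) x), VFieldDiffAt η z →
          ∀ ξ : TangentSpace (𝓡∂ (n + 1)) z,
            cov' η z ξ = cov η z ξ + (α * ρ z)⁻¹ •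
              ((show ℝ from mfderiv (𝓡∂ (n + 1)) 𝓘(ℝ, ℝ) ρ z ξ) • η z
                + (show ℝ from mfderiv (𝓡∂ (n + 1)) 𝓘(ℝ, ℝ) ρ z (η z)) • ξ)

/-- A projective structure (a class of torsion-free connections which differ by
`Υ_a δ_b^c + Υ_b δ_a^c`). On the domain of each chart the class has exactly one member which
preserves the volume density `|dy|` of the chart, that is, whose Christoffel symbols are
trace-free; these are the components `thomas e` (classically, the Thomas symbols). On overlaps the
representatives have to be projectively equivalent. -/
structure ProjectiveStructure (n : ℕ) (M : Type*) [TopologicalSpace M]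
    [ChartedSpace (EuclideanHalfSpace (n + 1)) M] where
  thomas : SmoothChart n M → Coord n → Fin (n + 1) → Fin (n + 1) → Fin (n + 1) → ℝ
  smooth : ∀ e a b c, ContDiffOn ℝ ∞ (fun y => thomas e y a b c) (e.dom univ)
  symm : ∀ e, ∀ y ∈ e.dom univ, ∀ a b c, thomas e y a b c = thomas e y b a c
  traceFree : ∀ e, ∀ y ∈ e.dom univ, ∀ a, ∑ b, thomas e y a b b = 0
  transform : ∀ e e' : SmoothChart n M, ∀ y ∈ e.dom e'.1.source,
    ∃ Υ : Fin (n + 1) → ℝ, ∀ a b k,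
      ∑ c, jac e e' y k c * (thomas e y a b c + Υ a * kron b c + Υ b * kron a c) =
        hess e e' y a b k + ∑ l, ∑ m,
          thomas e' (coordChange e e' y) l m k * jac e e' y l a * jac e e' y m b

/-- The restriction to the interior of the projective structure is the projective class of
`cov`. -/
def ProjectiveStructure.IsClassOf (𝔭 : ProjectiveStructure n M) (cov : CovOp n M) : Prop :=
  ∀ e : SmoothChart n M, ∀ y ∈ e.dom (inner n M), ∃ Υ : Fin (n + 1) → ℝ, ∀ a b c,
    christoffel cov e y a b c = 𝔭.thomas e y a b c + Υ a * kron b c + Υ b * kron a c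

/-! ### Tractors

The standard cotractor bundle `𝒯*` is the bundle `J¹ℰ(1)` of 1-jets. Trivializing `ℰ(1)` by the
chart, a cotractor has the components `(σ, μ_a)`, where for the jet of a density these are its
value and its partial derivatives. Since the representative of a projective class in a chart is
chosen so that it preserves `|dy|`, this is also the decomposition `𝒯* = ℰ(1) ⊕ ℰ_a(1)` determined
by that representative. -/

/-- The index set of the components `(σ, μ_a)`. -/
abbrev TIdx (n : ℕ) : Type := Unit ⊕ Fin (n + 1)

/-- Square matrices over the tractor index set. -/
abbrev TMat (n : ℕ) : Type := Matrix (TIdx n) (TIdx n) ℝ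

/-- The change of components of cotractors from `e'` to `e`, obtained by differentiating
`σ_e = κ · (σ_{e'} ∘ φ)`, with `κ = |det J|^{-1/(n+2)}`:
`(σ, μ_a) = κ (σ', J_a^b μ'_b + (∂_a log κ) σ')`. -/
def cotractorChange (e e' : SmoothChart n M) (y : Coord n) : TMat n :=
  |(jac e e' y).det| ^ (-1 / ((n : ℝ) + 2)) •
    Matrix.fromBlocks 1 0
      (Matrix.of fun a _ =>
        (-1 / ((n : ℝ) + 2)) * pd (fun z => Real.log |(jac e e' z).det|) a y)
      (jac e e' y)ᵀ

/-- Smooth sections of `S²𝒯*`, given by their symmetric component matrices. The entries are the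
three slots: `τ = mat (inl ()) (inl ())`, `ν_a = mat (inr a) (inl ())`,
`ρ_{ab} = mat (inr a) (inr b)`. They are also the matrices of symmetric bilinear forms on the
standard tractor bundle `𝒯`, in which the canonical line subbundle `ℰ(-1)` is spanned by the
first basis vector. -/
structure S2Cotractor (n : ℕ) (M : Type*) [TopologicalSpace M]
    [ChartedSpace (EuclideanHalfSpace (n + 1)) M] where
  mat : SmoothChart n M → Coord n → TMat n
  smooth : ∀ e i j, ContDiffOn ℝ ∞ (fun y => mat e y i j) (e.dom univ)
  symm : ∀ e, ∀ y ∈ e.dom univ, (mat e y).IsSymm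
  transform : ∀ e e' : SmoothChart n M, ∀ y ∈ e.dom e'.1.source,
    mat e y = cotractorChange e e' y * mat e' (coordChange e e' y) * (cotractorChange e e' y)ᵀ

/-- The projective Schouten tensor `P_{ab} = Ric_{ab} / n` of the representative, in the projective
class, which preserves the volume density of the chart. -/
def schouten (𝔭 : ProjectiveStructure n M) (e : SmoothChart n M) (y : Coord n) :
    Matrix (Fin (n + 1)) (Fin (n + 1)) ℝ :=
  (1 / (n : ℝ)) • ricci (𝔭.thomas e) y

/-- The connection matrices of the tractor connection on `𝒯*`:
`∇_a (σ, μ_b) = (∂_a σ - μ_a, ∂_a μ_b - Γ^c_{ab} μ_c + P_{ab} σ)`. -/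
def tractorConn (𝔭 : ProjectiveStructure n M) (e : SmoothChart n M) (y : Coord n)
    (a : Fin (n + 1)) : TMat n :=
  Matrix.fromBlocks 0 (Matrix.of fun _ b => -kron a b)
    (Matrix.of fun b _ => schouten 𝔭 e y a b) (Matrix.of fun b c => -𝔭.thomas e y a b c)

/-- The covariant derivative `∇_a h` for the connection on `S²𝒯*` induced by the tractor
connection. -/
def tractorDeriv (𝔭 : ProjectiveStructure n M) (h : S2Cotractor n M) (e : SmoothChart n M)
    (y : Coord n) (a : Fin (n + 1)) : TMat n :=
  Matrix.of (fun i j => pd (fun z => h.mat e z i j) a y)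
    + tractorConn 𝔭 e y a * h.mat e y + h.mat e y * (tractorConn 𝔭 e y a)ᵀ

/-- `h` is parallel for the tractor connection. -/
def S2Cotractor.IsParallel (h : S2Cotractor n M) (𝔭 : ProjectiveStructure n M) : Prop :=
  ∀ e : SmoothChart n M, ∀ y ∈ e.dom univ, ∀ a, tractorDeriv 𝔭 h e y a = 0

/-! ### The Kostant codifferential and the first BGG operator on `ℰ(2)` -/

/-- The action of the basis covector `dy^a` on `S²𝒯*` that is induced by its action
`(σ, μ_b) ↦ (0, σ δ^a_b)` on `𝒯*`. -/
def covectorAct (a : Fin (n + 1)) (h : TMat n) : TMat n :=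
  Matrix.single (Sum.inr a) (Sum.inl ()) 1 * h + h * (Matrix.single (Sum.inr a) (Sum.inl ()) 1)ᵀ

/-- The codifferential `∂* : T*M ⊗ S²𝒯* → S²𝒯*`. -/
def codiffOne (θ : Fin (n + 1) → TMat n) : TMat n := ∑ a, covectorAct a (θ a)

/-- The codifferential `∂* : Λ²T*M ⊗ S²𝒯* → T*M ⊗ S²𝒯*`. -/
def codiffTwo (Θ : Fin (n + 1) → Fin (n + 1) → TMat n) : Fin (n + 1) → TMat n :=
  fun b => ∑ a, covectorAct a (Θ a b)

/-- `θ` lies in the image of `∂* : Λ²T*M ⊗ S²𝒯* → T*M ⊗ S²𝒯*`. -/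
def InImageCodiff (θ : Fin (n + 1) → TMat n) : Prop :=
  ∃ Θ : Fin (n + 1) → Fin (n + 1) → TMat n,
    (∀ a b, (Θ a b).IsSymm) ∧ (∀ a b, Θ a b = -Θ b a) ∧ codiffTwo Θ = θ

/-- `h = L(τ)`: the section `h` of `S²𝒯*` has `τ` in the top slot, and `∇ h` is a section of
`ker ∂*`. -/
def IsSplitting (𝔭 : ProjectiveStructure n M) (τ : ProjDensity n M 2 univ)
    (h : S2Cotractor n M) : Prop :=
  ∀ e : SmoothChart n M, ∀ y ∈ e.dom univ,
    h.mat e y (Sum.inl ()) (Sum.inl ()) = τ.coef e y ∧ codiffOne (tractorDeriv 𝔭 h e y) = 0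

/-- `τ` is a solution of the first BGG operator: `∇ L(τ)` is a section of `im ∂*`. -/
def IsBGGSolution (𝔭 : ProjectiveStructure n M) (τ : ProjDensity n M 2 univ) : Prop :=
  ∃ h : S2Cotractor n M, IsSplitting 𝔭 τ h ∧
    ∀ e : SmoothChart n M, ∀ y ∈ e.dom univ, InImageCodiff (tractorDeriv 𝔭 h e y)

/-- `τ` is a normal solution: `L(τ)` is parallel. -/
def IsNormalSolution (𝔭 : ProjectiveStructure n M) (τ : ProjDensity n M 2 univ) : Prop :=
  ∃ h : S2Cotractor n M, IsSplitting 𝔭 τ h ∧ h.IsParallel 𝔭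

/-! ### Orthogonal holonomy reductions and curved orbits -/

/-- The symmetric matrix `A` is non-degenerate of signature `(p, q)`. -/
def HasSignature {ι : Type*} [Fintype ι] [DecidableEq ι] (A : Matrix ι ι ℝ) (p q : ℕ) : Prop :=
  A.IsSymm ∧ A.det ≠ 0 ∧ sigPos A.toQuadraticForm' = p ∧ sigNeg A.toQuadraticForm' = q

/-- `h` is a reduction of projective holonomy to the orthogonal group `O(p, q)` over `C`: a
parallel bundle metric of signature `(p, q)` on the standard tractor bundle. -/
def IsOrthogonalReductionOn (𝔭 : ProjectiveStructure n M) (h : S2Cotractor n M) (C : Set M)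
    (p q : ℕ) : Prop :=
  ∀ e : SmoothChart n M, ∀ y ∈ e.dom C,
    (∀ a, tractorDeriv 𝔭 h e y a = 0) ∧ HasSignature (h.mat e y) p q

/-- The bilinear forms `A` and `B` on `ℝ^(n+2)` lie in one orbit of the parabolic subgroup, the
stabilizer of the ray spanned by the first basis vector. -/
def SameParabolicOrbit (A B : TMat n) : Prop :=
  ∃ g : TMat n, IsUnit g.det ∧
    (∃ c : ℝ, 0 < c ∧ g *ᵥ Pi.single (Sum.inl ()) 1 = c • Pi.single (Sum.inl ()) 1) ∧
    A = gᵀ * B * g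

/-- The curved orbit of the point `x`: all points at which `h` has the same parabolic type as
at `x`. -/
def curvedOrbit (h : S2Cotractor n M) (x : M) : Set M :=
  {z | ∃ e e' : SmoothChart n M, x ∈ e.1.source ∧ z ∈ e'.1.source ∧
    SameParabolicOrbit (h.mat e (e.toCoord x)) (h.mat e' (e'.toCoord z))}

/-! ### Conformal structures on the boundary -/

/-- A conformal structure of signature `(p, q)` on `C ∩ ∂M`: each chart of `M`, restricted to
`∂M = {y 0 = 0}`, is a chart of `∂M`; in it, one has a smooth metric `γ e` of signature `(p, q)`,
and the metrics for different charts agree up to positive factors. -/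
structure IsBoundaryConformalStructure (γ : SmoothChart n M → Coord n → Matrix (Fin n) (Fin n) ℝ)
    (C : Set M) (p q : ℕ) : Prop where
  smooth : ∀ e : SmoothChart n M, ∀ i j,
    ContDiffOn ℝ ∞ (fun y => γ e y i j) (e.dom (C ∩ bdry n M))
  signature : ∀ e : SmoothChart n M, ∀ y ∈ e.dom (C ∩ bdry n M), HasSignature (γ e y) p q
  conformal : ∀ e e' : SmoothChart n M, ∀ y ∈ e.dom (C ∩ bdry n M ∩ e'.1.source),
    ∃ c : ℝ, 0 < c ∧ γ e y =
      c • (((jac e e' y).submatrix Fin.succ Fin.succ)ᵀ * γ e' (coordChange e e' y)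
        * (jac e e' y).submatrix Fin.succ Fin.succ)

/-- The restriction to `T∂M` of the bottom slot of `h`. -/
def boundaryForm (h : S2Cotractor n M) (e : SmoothChart n M) (y : Coord n) :
    Matrix (Fin n) (Fin n) ℝ :=
  (h.mat e y).submatrix (fun i => Sum.inr i.succ) (fun i => Sum.inr i.succ)

/-- The bundle metric `h` induces a conformal structure of signature `(p, q)` on `C ∩ ∂M`: along
the boundary, the orthocomplement of `ℰ(-1)` in `𝒯` contains `ℰ(-1)` and projects onto `T∂M ⊗ ℰ(-1)`,
and the form induced on the quotient is a conformal structure. -/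
def InducesBoundaryConformalStructure (h : S2Cotractor n M) (C : Set M) (p q : ℕ) : Prop :=
  (∀ e : SmoothChart n M, ∀ y ∈ e.dom (C ∩ bdry n M), ∀ v : TIdx n → ℝ,
    Pi.single (Sum.inl ()) 1 ⬝ᵥ (h.mat e y *ᵥ v) = 0 ↔ v (Sum.inr 0) = 0) ∧
  IsBoundaryConformalStructure (boundaryForm h) C p q

end ProjCompact

end

namespace ProjCompact
open Filter
open scoped Topology

/-! ### Calculus on the half space -/

section HalfSpace

variable {n : ℕ} {F : Type*} [NormedAddCommGroup F] [NormedSpace ℝ F]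

/-! Write `Γ = Π + Υ ⊗ id + id ⊗ Υ` for the Christoffel symbols of `∇` in a chart, with `Π`
trace-free. Projectively equivalent symbols have the same `Π` (`thomasPart_congr`). Near a boundary
point `∇ + dρ/(2ρ)` is projectively equivalent to `∇` and smooth up to the boundary, so `Π` extends,
and the extensions obtained near different points agree because the interior is dense. The same
remark, `eqOn_of_eqOn_pos`, carries every identity verified where `∇` lives over to the boundary.

Let `Γ'` be the symbols of the smooth local extension. Parallelism says `d log τ = -2/(n+2) tr Γ`,
and `tr Γ' = tr Γ + (n+2) dρ/(2ρ)`. Hence `d log (τ/ρ) = -2/(n+2) tr Γ'` is smooth up to the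
boundary. A function on a half ball whose differential extends smoothly is Lipschitz and extends
smoothly itself (`exists_extension_of_pd`), so `τ` is `ρ` times a non-vanishing smooth factor. Order
two and weight two match so that `ρ` occurs to the first power.

The condition `∂*(∇L(τ)) = 0` can be solved slot by slot and gives the universal formula `splitMat`,
which involves only `Π` and `τ` and is therefore smooth up to the boundary. In the interior `dτ =
-2τΥ`, and the law for the Ricci tensor under projective changes turns this formula into `τ · S
diag(1, Ric/n) Sᵀ` with a unipotent matrix `S` (`IsParallelScale.splitMat_eq`): in the scale of `∇`
itself, `L(τ)` is `(τ, 0, τ Ric/n)`. It follows that `∇L(τ)` has only a bottom slot, equal to `(τ/n)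
∇Ric` (`tractorDeriv_bottom_inner`). It vanishes exactly when `Ric` is parallel, and it lies in `im
∂*` exactly when its total symmetrization vanishes (`inImageCodiff_iff`); both conditions pass to
the boundary by continuity.

If `L(τ)` is parallel, its determinant in a chart is constant along connected pieces since the
tractor connection is trace-free (`pd_det_eq_zero`), so non-degeneracy of `Ric` in the interior
gives non-degeneracy of `L(τ)` everywhere. The signature is locally constant, hence constant on
components.

The parabolic type of a form is found by splitting off the canonical vector. If its square is
non-zero, completing the square (`exists_isometry_schurMat`) shows that its sign and the signature
determine the type; this sign is constant in the interior of a component because `τ = ρσ` with `ρ >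
0` there. On the boundary the square is zero and tangential derivatives of `τ` vanish, so the
canonical vector pairs only with the normal direction. A hyperbolic plane splits off
(`exists_isometry_tangentMat`), and what remains is the bottom slot on `T∂M`, of signature `(p-1,
q-1)`. -/

/-- The half space, as a subset of the coordinate space. -/
abbrev halfSpace (n : ℕ) : Set (Coord n) := range (𝓡∂ (n + 1))

lemma mem_halfSpace {y : Coord n} : y ∈ halfSpace n ↔ 0 ≤ y 0 := by
  rw [halfSpace, range_modelWithCornersEuclideanHalfSpace]; rfl

lemma interior_halfSpace_eq : interior (halfSpace n) = {y : Coord n | 0 < y 0} :=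
  interior_range_modelWithCornersEuclideanHalfSpace (n + 1)

lemma uniqueDiffOn_halfSpace : UniqueDiffOn ℝ (halfSpace n) := (𝓡∂ (n + 1)).uniqueDiffOn

lemma convex_halfSpace : Convex ℝ (halfSpace n) := (𝓡∂ (n + 1)).convex_range

lemma isOpen_pos : IsOpen {y : Coord n | 0 < y 0} := by
  rw [← interior_halfSpace_eq]; exact isOpen_interior

lemma closure_pos : closure {y : Coord n | 0 < y 0} = halfSpace n := by
  rw [← interior_halfSpace_eq, convex_halfSpace.closure_interior_eq_closure_of_nonempty_interior
    (𝓡∂ (n + 1)).nonempty_interior, (𝓡∂ (n + 1)).isClosed_range.closure_eq]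

/-- Relatively open subsets of the half space. -/
structure IsRelOpen (S : Set (Coord n)) : Prop where
  subset : S ⊆ halfSpace n
  mem_nhdsWithin : ∀ y ∈ S, S ∈ 𝓝[halfSpace n] y

namespace IsRelOpen

variable {S T : Set (Coord n)} (hS : IsRelOpen S)

include hS

lemma inter (hT : IsRelOpen T) : IsRelOpen (S ∩ T) :=
  ⟨inter_subset_left.trans hS.subset,
    fun y hy => Filter.inter_mem (hS.mem_nhdsWithin y hy.1) (hT.mem_nhdsWithin y hy.2)⟩

lemma inter_isOpen (hT : IsOpen T) : IsRelOpen (S ∩ T) :=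
  ⟨inter_subset_left.trans hS.subset,
    fun y hy => Filter.inter_mem (hS.mem_nhdsWithin y hy.1)
      (mem_nhdsWithin_of_mem_nhds (hT.mem_nhds hy.2))⟩

lemma nhdsWithin_eq {y : Coord n} (hy : y ∈ S) : 𝓝[S] y = 𝓝[halfSpace n] y :=
  le_antisymm (nhdsWithin_mono _ hS.subset)
    (nhdsWithin_le_of_mem (hS.mem_nhdsWithin y hy))

lemma uniqueDiffOn : UniqueDiffOn ℝ S := fun y hy =>
  (uniqueDiffOn_halfSpace y (hS.subset hy)).mono_nhds (hS.nhdsWithin_eq hy).ge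

/-- At its points, a relatively open set has the same neighbourhood filter as the half space.
Derivatives within either set coincide, which makes `ContDiffOn` results on `S` available for `pd`.
-/
lemma pd_eq (f : Coord n → F) (a : Fin (n + 1)) {y : Coord n} (hy : y ∈ S) :
    pd f a y = fderivWithin ℝ f S y (EuclideanSpace.single a 1) := by
  rw [pd, fderivWithin_congr_set']
  exact y
  have := nhdsWithin_eq_iff_eventuallyEq.1 (hS.nhdsWithin_eq hy)
  exact (this.symm).filter_mono nhdsWithin_le_nhds

lemma contDiffOn_pd {f : Coord n → F} (hf : ContDiffOn ℝ ∞ f S) (a : Fin (n + 1)) :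
    ContDiffOn ℝ ∞ (pd f a) S := by
  have h := (hf.fderivWithin hS.uniqueDiffOn (m := ∞) (by simp)).clm_apply
    (contDiffOn_const (c := EuclideanSpace.single a (1 : ℝ)))
  exact h.congr fun y hy => hS.pd_eq f a hy

lemma differentiableWithinAt {f : Coord n → F} (hf : ContDiffOn ℝ ∞ f S) {y : Coord n}
    (hy : y ∈ S) : DifferentiableWithinAt ℝ f (halfSpace n) y :=
  ((hf.differentiableOn (by simp)) y hy).mono_of_mem_nhdsWithin (hS.mem_nhdsWithin y hy)

lemma contDiffWithinAt {f : Coord n → F} (hf : ContDiffOn ℝ ∞ f S) {y : Coord n}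
    (hy : y ∈ S) : ContDiffWithinAt ℝ ∞ f (halfSpace n) y :=
  (hf y hy).mono_of_mem_nhdsWithin (hS.mem_nhdsWithin y hy)

lemma pd_congr {f g : Coord n → F} (hfg : EqOn f g S) (a : Fin (n + 1)) : EqOn (pd f a) (pd g a) S := by
  intro y hy
  rw [hS.pd_eq f a hy, hS.pd_eq g a hy, fderivWithin_congr hfg (hfg hy)]

lemma subset_closure_pos : S ⊆ closure (S ∩ {y | 0 < y 0}) := by
  intro y hy
  have h1 : y ∈ closure {y : Coord n | 0 < y 0} := by
    rw [closure_pos]; exact hS.subset hy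
  rw [mem_closure_iff_nhdsWithin_neBot] at h1 ⊢
  have : 𝓝[S ∩ {y | 0 < y 0}] y = 𝓝[{y : Coord n | 0 < y 0}] y := by
    refine le_antisymm (nhdsWithin_mono _ inter_subset_right) ?_
    rw [nhdsWithin_inter]
    refine le_inf ?_ le_rfl
    rw [hS.nhdsWithin_eq hy]
    exact nhdsWithin_mono _ fun z hz => mem_halfSpace.2 (le_of_lt hz)
  rwa [this]

/-- The transfer principle of the whole proof: the connection exists only in the interior, so
identities are checked there and reach the boundary by density and continuity. -/
lemma eqOn_of_eqOn_pos {X : Type*} [TopologicalSpace X] [T2Space X] {f g : Coord n → X}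
    (hf : ContinuousOn f S) (hg : ContinuousOn g S) (h : EqOn f g (S ∩ {y | 0 < y 0})) :
    EqOn f g S := by
  intro y hy
  have : (𝓝[S ∩ {y | 0 < y 0}] y).NeBot :=
    mem_closure_iff_nhdsWithin_neBot.1 (hS.subset_closure_pos hy)
  have h1 : Tendsto f (𝓝[S ∩ {y | 0 < y 0}] y) (𝓝 (f y)) := (hf y hy).mono inter_subset_left
  have h2 : Tendsto g (𝓝[S ∩ {y | 0 < y 0}] y) (𝓝 (g y)) := (hg y hy).mono inter_subset_left
  exact tendsto_nhds_unique_of_eventuallyEq h1 h2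
    (eventually_mem_nhdsWithin.mono fun z hz => h hz)

end IsRelOpen

lemma isRelOpen_halfSpace : IsRelOpen (halfSpace n) := ⟨subset_rfl, fun _ _ => self_mem_nhdsWithin⟩

section pd

variable {f g : Coord n → ℝ} {y : Coord n} (a b : Fin (n + 1))

lemma pd_add {f g : Coord n → F} (hf : DifferentiableWithinAt ℝ f (halfSpace n) y)
    (hg : DifferentiableWithinAt ℝ g (halfSpace n) y) (hy : y ∈ halfSpace n) :
    pd (fun z => f z + g z) a y = pd f a y + pd g a y := by
  rw [pd, fderivWithin_fun_add (uniqueDiffOn_halfSpace y hy) hf hg]; rfl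

lemma pd_mul (hf : DifferentiableWithinAt ℝ f (halfSpace n) y)
    (hg : DifferentiableWithinAt ℝ g (halfSpace n) y) (hy : y ∈ halfSpace n) :
    pd (fun z => f z * g z) a y = pd f a y * g y + f y * pd g a y := by
  rw [pd, fderivWithin_fun_mul (uniqueDiffOn_halfSpace y hy) hf hg]
  change f y * pd g a y + g y * pd f a y = _
  ring

lemma pd_const_mul (c : ℝ) (hf : DifferentiableWithinAt ℝ f (halfSpace n) y)
    (hy : y ∈ halfSpace n) : pd (fun z => c * f z) a y = c * pd f a y := by
  rw [pd, fderivWithin_const_mul (uniqueDiffOn_halfSpace y hy) hf]; rfl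

lemma pd_const (c : F) : pd (fun _ : Coord n => c) a y = 0 := by
  rw [pd, fderivWithin_fun_const]; rfl

lemma pd_sum {ι : Type*} (s : Finset ι) {f : ι → Coord n → F}
    (hf : ∀ i ∈ s, DifferentiableWithinAt ℝ (f i) (halfSpace n) y) (hy : y ∈ halfSpace n) :
    pd (fun z => ∑ i ∈ s, f i z) a y = ∑ i ∈ s, pd (f i) a y := by
  rw [pd, fderivWithin_fun_sum (uniqueDiffOn_halfSpace y hy) hf,
    _root_.sum_apply]; rfl

lemma fderivWithin_eq_sum_pd (f : Coord n → F) (v : Coord n) :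
    fderivWithin ℝ f (halfSpace n) y v = ∑ a, v a • pd f a y := by
  conv_lhs => rw [show v = ∑ a, v a • EuclideanSpace.single a (1 : ℝ) by
    ext i; simp [Finset.sum_apply, Pi.single_apply]]
  rw [map_sum]; simp only [map_smul]; rfl

lemma pd_coord (b : Fin (n + 1)) (hy : y ∈ halfSpace n) :
    pd (fun z : Coord n => z b) a y = kron a b := by
  have h : HasFDerivWithinAt (fun z : Coord n => z b)
      (EuclideanSpace.proj b : Coord n →L[ℝ] ℝ) (halfSpace n) y :=
    (EuclideanSpace.proj b : Coord n →L[ℝ] ℝ).hasFDerivWithinAt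
  rw [pd, h.fderivWithin (uniqueDiffOn_halfSpace y hy)]
  simp [kron, eq_comm]

lemma pd_comp {φ : Coord n → Coord n} {f : Coord n → F}
    (hf : DifferentiableWithinAt ℝ f (halfSpace n) (φ y))
    (hφ : DifferentiableWithinAt ℝ φ (halfSpace n) y)
    (hmaps : ∀ᶠ z in 𝓝[halfSpace n] y, φ z ∈ halfSpace n) (hy : y ∈ halfSpace n) :
    pd (fun z => f (φ z)) a y = ∑ b, pd (fun z => φ z b) a y • pd f b (φ y) := by
  have h1 : HasFDerivWithinAt (fun z => f (φ z)) ((fderivWithin ℝ f (halfSpace n) (φ y)).comp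
      (fderivWithin ℝ φ (halfSpace n) y)) (halfSpace n) y :=
    hf.hasFDerivWithinAt.comp_of_tendsto y hφ.hasFDerivWithinAt
      (tendsto_nhdsWithin_iff.2 ⟨hφ.continuousWithinAt, hmaps⟩)
  rw [pd, h1.fderivWithin (uniqueDiffOn_halfSpace y hy), ContinuousLinearMap.comp_apply,
    fderivWithin_eq_sum_pd]
  refine Finset.sum_congr rfl fun b _ => ?_
  congr 1
  have h2 : HasFDerivWithinAt (fun z => φ z b) ((EuclideanSpace.proj b : Coord n →L[ℝ] ℝ).comp
      (fderivWithin ℝ φ (halfSpace n) y)) (halfSpace n) y :=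
    (EuclideanSpace.proj b : Coord n →L[ℝ] ℝ).hasFDerivAt.comp_hasFDerivWithinAt y
      hφ.hasFDerivWithinAt
  rw [pd, h2.fderivWithin (uniqueDiffOn_halfSpace y hy)]; rfl

lemma pd_comp_real {g : ℝ → ℝ} {f : Coord n → ℝ} {g' : ℝ} (hg : HasDerivAt g g' (f y))
    (hf : DifferentiableWithinAt ℝ f (halfSpace n) y) (hy : y ∈ halfSpace n) :
    pd (fun z => g (f z)) a y = g' * pd f a y := by
  have := hg.comp_hasFDerivWithinAt y hf.hasFDerivWithinAt
  rw [pd, show (fun z => g (f z)) = g ∘ f from rfl,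
    this.fderivWithin (uniqueDiffOn_halfSpace y hy)]
  rfl

lemma IsRelOpen.pd_pd_comm {S : Set (Coord n)} (hS : IsRelOpen S) {f : Coord n → F}
    (hf : ContDiffOn ℝ ∞ f S) (hy : y ∈ S) : pd (pd f a) b y = pd (pd f b) a y := by
  have hd : ∀ c d : Fin (n + 1), pd (pd f c) d y =
      fderivWithin ℝ (fderivWithin ℝ f (halfSpace n)) (halfSpace n) y
        (EuclideanSpace.single d 1) (EuclideanSpace.single c 1) := by
    intro c d
    have h0 : DifferentiableWithinAt ℝ (fderivWithin ℝ f (halfSpace n)) (halfSpace n) y := by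
      have h1 : DifferentiableWithinAt ℝ (fderivWithin ℝ f S) (halfSpace n) y :=
        hS.differentiableWithinAt (hf.fderivWithin hS.uniqueDiffOn (m := ∞) (by simp)) hy
      refine h1.congr_of_eventuallyEq ?_ ?_
      · filter_upwards [hS.mem_nhdsWithin y hy] with z hz
        refine (fderivWithin_congr_set' z ?_)
        exact (nhdsWithin_eq_iff_eventuallyEq.1 (hS.nhdsWithin_eq hz)).symm.filter_mono
          nhdsWithin_le_nhds
      · refine (fderivWithin_congr_set' y ?_)
        exact (nhdsWithin_eq_iff_eventuallyEq.1 (hS.nhdsWithin_eq hy)).symm.filter_mono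
          nhdsWithin_le_nhds
    have h2 := h0.hasFDerivWithinAt.clm_apply
      (hasFDerivWithinAt_const (EuclideanSpace.single c (1 : ℝ)) y (halfSpace n))
    rw [pd, show pd f c = fun z => fderivWithin ℝ f (halfSpace n) z (EuclideanSpace.single c 1)
      from rfl, h2.fderivWithin (uniqueDiffOn_halfSpace y (hS.subset hy))]
    simp
  rw [hd, hd]
  -- Symmetry of second derivatives at a boundary point holds because the half space is the closure
  -- of its interior.
  have hsymm : IsSymmSndFDerivWithinAt ℝ f (halfSpace n) y :=
    (hS.contDiffWithinAt hf hy).isSymmSndFDerivWithinAt (by simpa using WithTop.coe_le_coe.2 (le_top (a := (2 : ℕ∞)))) uniqueDiffOn_halfSpace (by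
      rw [interior_halfSpace_eq, closure_pos]; exact hS.subset hy) (hS.subset hy)
  exact hsymm _ _

end pd

end HalfSpace

end ProjCompact

namespace ProjCompact
open Filter
open scoped Topology

/-! ### Charts of a manifold with boundary -/

section ChartFacts

variable {n : ℕ} {M : Type*} [TopologicalSpace M] [ChartedSpace (EuclideanHalfSpace (n + 1)) M]

namespace SmoothChart

variable {e e' : SmoothChart n M} {U : Set M} {y : Coord n} {x : M}

lemma point_mem_source (hy : y ∈ e.dom U) : e.point y ∈ e.1.source := by
  have := (e.1.extend (𝓡∂ (n + 1))).map_target hy.1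
  rwa [OpenPartialHomeomorph.extend_source] at this

lemma toCoord_point (hy : y ∈ e.dom U) : e.toCoord (e.point y) = y :=
  (e.1.extend (𝓡∂ (n + 1))).right_inv hy.1

lemma point_toCoord (hx : x ∈ e.1.source) : e.point (e.toCoord x) = x :=
  e.1.extend_left_inv hx

lemma toCoord_mem_dom (hx : x ∈ e.1.source) (hU : x ∈ U) : e.toCoord x ∈ e.dom U := by
  refine ⟨(e.1.extend (𝓡∂ (n + 1))).map_source ?_, ?_⟩
  · rwa [OpenPartialHomeomorph.extend_source]
  · rwa [mem_preimage, point_toCoord hx]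

lemma dom_mono {U V : Set M} (h : U ⊆ V) : e.dom U ⊆ e.dom V := fun _ hy => ⟨hy.1, h hy.2⟩

lemma dom_subset_univ : e.dom U ⊆ e.dom univ := dom_mono (subset_univ U)

lemma isRelOpen_dom (hU : IsOpen U) : IsRelOpen (e.dom U) := by
  refine ⟨fun y hy => e.1.extend_target_subset_range hy.1, fun y hy => ?_⟩
  have hx := point_mem_source hy
  have h := toCoord_point hy
  refine Filter.inter_mem ?_ ?_
  · have := e.1.extend_target_mem_nhdsWithin (I := 𝓡∂ (n + 1)) hx
    rwa [show (e.1.extend (𝓡∂ (n + 1))) (e.point y) = y from h] at this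
  · have := e.1.extend_preimage_mem_nhdsWithin (I := 𝓡∂ (n + 1)) (s := univ) hx
      (by rw [nhdsWithin_univ]; exact hU.mem_nhds hy.2)
    rw [show (e.1.extend (𝓡∂ (n + 1))) (e.point y) = y from h, preimage_univ, univ_inter] at this
    exact this

lemma isRelOpen_dom_univ : IsRelOpen (e.dom univ) := isRelOpen_dom isOpen_univ

lemma isRelOpen_dom_source : IsRelOpen (e.dom e'.1.source) := isRelOpen_dom e'.1.open_source

lemma point_coordChange (hy : y ∈ e.dom e'.1.source) :
    e'.point (coordChange e e' y) = e.point y := point_toCoord hy.2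

lemma coordChange_mem_dom (hy : y ∈ e.dom e'.1.source) (hU : e.point y ∈ U) :
    coordChange e e' y ∈ e'.dom U := toCoord_mem_dom hy.2 hU

lemma coordChange_mem (hy : y ∈ e.dom e'.1.source) :
    coordChange e e' y ∈ e'.dom e.1.source := coordChange_mem_dom hy (point_mem_source hy)

lemma coordChange_coordChange (hy : y ∈ e.dom e'.1.source) :
    coordChange e' e (coordChange e e' y) = y := by
  rw [coordChange, point_coordChange hy, toCoord_point hy]

lemma dom_source_eq : e.dom e'.1.source = ((𝓡∂ (n + 1)).extendCoordChange e.1 e'.1).source := by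
  rw [PartialEquiv.trans_source, PartialEquiv.symm_source, OpenPartialHomeomorph.extend_source]
  rfl

lemma contDiffOn_coordChange :
    ContDiffOn ℝ ∞ (coordChange e e') (e.dom e'.1.source) := by
  rw [dom_source_eq]
  exact (𝓡∂ (n + 1)).contDiffOn_extendCoordChange e.2 e'.2

lemma contDiffOn_coordChange_apply (k : Fin (n + 1)) :
    ContDiffOn ℝ ∞ (fun z => coordChange e e' z k) (e.dom e'.1.source) :=
  (contDiff_euclidean.1 contDiff_id k).comp_contDiffOn contDiffOn_coordChange

lemma contDiffOn_jac (k a : Fin (n + 1)) :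
    ContDiffOn ℝ ∞ (fun z => jac e e' z k a) (e.dom e'.1.source) :=
  isRelOpen_dom_source.contDiffOn_pd (contDiffOn_coordChange_apply k) a

lemma contDiffOn_hess (a b k : Fin (n + 1)) :
    ContDiffOn ℝ ∞ (fun z => hess e e' z a b k) (e.dom e'.1.source) :=
  isRelOpen_dom_source.contDiffOn_pd (contDiffOn_jac k b) a

lemma hess_symm (hy : y ∈ e.dom e'.1.source) (a b k : Fin (n + 1)) :
    hess e e' y a b k = hess e e' y b a k :=
  isRelOpen_dom_source.pd_pd_comm b a (contDiffOn_coordChange_apply k) hy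

/-- The chain rule for a function expressed in another chart. -/
lemma pd_comp_coordChange {F : Type*} [NormedAddCommGroup F] [NormedSpace ℝ F] {f : Coord n → F}
    (hy : y ∈ e.dom e'.1.source)
    (hf : DifferentiableWithinAt ℝ f (halfSpace n) (coordChange e e' y)) (a : Fin (n + 1)) :
    pd (fun z => f (coordChange e e' z)) a y =
      ∑ b, jac e e' y b a • pd f b (coordChange e e' y) := by
  refine pd_comp a hf (isRelOpen_dom_source.differentiableWithinAt contDiffOn_coordChange hy) ?_
    (isRelOpen_dom_source.subset hy)
  filter_upwards [isRelOpen_dom_source.mem_nhdsWithin y hy] with z hz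
  exact isRelOpen_dom_source.subset (coordChange_mem hz)

lemma jac_mul_jac (hy : y ∈ e.dom e'.1.source) :
    jac e' e (coordChange e e' y) * jac e e' y = 1 := by
  ext k a
  have h1 := pd_comp_coordChange (f := fun z => coordChange e' e z k) hy
    (isRelOpen_dom_source.differentiableWithinAt (contDiffOn_coordChange_apply k)
      (coordChange_mem hy)) a
  have h2 : pd (fun z => coordChange e' e (coordChange e e' z) k) a y =
      pd (fun z : Coord n => z k) a y :=
    (isRelOpen_dom_source (e := e) (e' := e')).pd_congr
      (fun z hz => by simp only [coordChange_coordChange hz]) a hy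
  rw [h2, pd_coord a k (isRelOpen_dom_source.subset hy)] at h1
  rw [Matrix.mul_apply, Matrix.one_apply]
  simp only [kron, smul_eq_mul, eq_comm (a := a)] at h1
  rw [h1]
  exact Finset.sum_congr rfl fun b _ => mul_comm _ _

lemma det_jac_ne_zero (hy : y ∈ e.dom e'.1.source) : (jac e e' y).det ≠ 0 := by
  have h := congrArg Matrix.det (jac_mul_jac hy)
  rw [Matrix.det_mul, Matrix.det_one] at h
  exact right_ne_zero_of_mul_eq_one h

lemma contDiffOn_det_jac :
    ContDiffOn ℝ ∞ (fun z => (jac e e' z).det) (e.dom e'.1.source) := by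
  simp only [Matrix.det_apply]
  exact ContDiffOn.sum fun σ _ => ContDiffOn.const_smul _
    (contDiffOn_prod fun i _ => contDiffOn_jac _ _)

/-- Invariance of the boundary, in its smooth form. A transition map has surjective derivative at an
interior point, hence covers a neighbourhood of the image point, while its values stay in the half
space; so the image point is interior. -/
lemma coordChange_pos (hy : y ∈ e.dom e'.1.source) (h0 : 0 < y 0) :
    0 < coordChange e e' y 0 := by
  have hnhds : halfSpace n ∈ 𝓝 y :=
    mem_interior_iff_mem_nhds.1 (by rw [interior_halfSpace_eq]; exact h0)
  have hmem : e.dom e'.1.source ∈ 𝓝 y := by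
    have := isRelOpen_dom_source.mem_nhdsWithin y hy
    rwa [nhdsWithin_eq_nhds.2 hnhds] at this
  have hd := isRelOpen_dom_source.differentiableWithinAt
    (contDiffOn_coordChange (e := e) (e' := e')) hy
  have hs : Function.Surjective (fderiv ℝ (coordChange e e') y) := by
    have := (𝓡∂ (n + 1)).isInvertible_fderivWithin_extendCoordChange (n := ∞) (by simp) e.2 e'.2
      (x := y) (by rw [← dom_source_eq]; exact hy)
    rw [← dom_source_eq, fderivWithin_of_mem_nhds hmem] at this
    exact this.surjective
  have := (hd.differentiableAt hnhds).mem_interior_convex_of_surjective_fderiv hmem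
    convex_halfSpace (𝓡∂ (n + 1)).isClosed_range (𝓡∂ (n + 1)).nonempty_interior
    (fun z hz => isRelOpen_dom_source.subset (coordChange_mem hz)) hs
  rwa [interior_halfSpace_eq] at this

/-- The preferred chart at a point. -/
noncomputable def chartAtPoint [IsManifold (𝓡∂ (n + 1)) ∞ M] (x : M) : SmoothChart n M :=
  ⟨chartAt _ x, IsManifold.chart_mem_maximalAtlas x⟩

variable [IsManifold (𝓡∂ (n + 1)) ∞ M]

lemma mem_chartAtPoint_source (x : M) : x ∈ (chartAtPoint (n := n) x).1.source :=
  mem_chart_source _ x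

/-- The interior is defined by the preferred chart at each point. Applying `coordChange_pos` to the
transition map and to its inverse makes every smooth chart equally good. -/
lemma point_mem_inner_iff (hy : y ∈ e.dom U) : e.point y ∈ inner n M ↔ 0 < y 0 := by
  set c := chartAtPoint (n := n) (e.point y)
  have h1 : e.point y ∈ inner n M ↔ 0 < coordChange e c y 0 := by
    change extChartAt _ _ _ ∈ interior (halfSpace n) ↔ _
    rw [interior_halfSpace_eq]; rfl
  have hyc : y ∈ e.dom c.1.source := ⟨hy.1, mem_chartAtPoint_source _⟩
  rw [h1]
  refine ⟨fun h => ?_, coordChange_pos hyc⟩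
  have := coordChange_pos (coordChange_mem hyc) h
  rwa [coordChange_coordChange hyc] at this

lemma point_mem_bdry_iff (hy : y ∈ e.dom U) : e.point y ∈ bdry n M ↔ y 0 = 0 := by
  rw [bdry, ← ModelWithCorners.compl_interior, mem_compl_iff, point_mem_inner_iff hy]
  have : 0 ≤ y 0 := mem_halfSpace.1 (e.1.extend_target_subset_range hy.1)
  constructor
  · intro h; linarith
  · intro h; linarith

lemma dom_inter_inner : e.dom (U ∩ inner n M) = e.dom U ∩ {y | 0 < y 0} := by
  ext y
  constructor
  · intro h
    have h' : y ∈ e.dom U := dom_mono inter_subset_left h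
    exact ⟨h', (point_mem_inner_iff h').1 h.2.2⟩
  · intro h
    exact ⟨h.1.1, h.1.2, (point_mem_inner_iff h.1).2 h.2⟩

lemma dom_inner : e.dom (inner n M) = e.dom univ ∩ {y | 0 < y 0} := by
  rw [← dom_inter_inner, univ_inter]

lemma isOpen_inner : IsOpen (inner n M) :=
  (𝓡∂ (n + 1)).isOpen_interior (n := ∞) (by simp)

/-- Two continuous functions on a coordinate domain which agree in the interior are equal. -/
lemma eqOn_dom {X : Type*} [TopologicalSpace X] [T2Space X] {f g : Coord n → X} (hU : IsOpen U)
    (hf : ContinuousOn f (e.dom U)) (hg : ContinuousOn g (e.dom U))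
    (h : EqOn f g (e.dom (U ∩ inner n M))) : EqOn f g (e.dom U) :=
  (isRelOpen_dom hU).eqOn_of_eqOn_pos hf hg (by rwa [← dom_inter_inner])

end SmoothChart

end ChartFacts

end ProjCompact

namespace ProjCompact
open Filter
open scoped Topology

/-! ### Coordinate vector fields and Christoffel symbols -/

section Connections

variable {n : ℕ} {M : Type*} [TopologicalSpace M] [ChartedSpace (EuclideanHalfSpace (n + 1)) M]

open SmoothChart

variable {e e' : SmoothChart n M} {U : Set M} {y : Coord n} {x : M}

lemma contMDiffAt_toCoord (hx : x ∈ e.1.source) :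
    ContMDiffAt (𝓡∂ (n + 1)) 𝓘(ℝ, Coord n) ∞ e.toCoord x :=
  e.1.contMDiffAt_extend e.2 hx

lemma contMDiffOn_point : ContMDiffOn 𝓘(ℝ, Coord n) (𝓡∂ (n + 1)) ∞ e.point (e.dom univ) := by
  have := contMDiffOn_extend_symm (I := 𝓡∂ (n + 1)) e.2
  rw [← OpenPartialHomeomorph.extend_target'] at this
  exact this.mono fun y hy => hy.1

lemma mdifferentiableAt_toCoord (hx : x ∈ e.1.source) :
    MDifferentiableAt (𝓡∂ (n + 1)) 𝓘(ℝ, Coord n) e.toCoord x :=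
  (contMDiffAt_toCoord hx).mdifferentiableAt (by simp)

lemma mdifferentiableWithinAt_point (hy : y ∈ e.dom univ) :
    MDifferentiableWithinAt 𝓘(ℝ, Coord n) (𝓡∂ (n + 1)) e.point (halfSpace n) y :=
  ((contMDiffOn_point y hy).mdifferentiableWithinAt (by simp)).mono_of_mem_nhdsWithin
    (isRelOpen_dom_univ.mem_nhdsWithin y hy)

lemma uniqueMDiffWithinAt_halfSpace (hy : y ∈ halfSpace n) :
    UniqueMDiffWithinAt 𝓘(ℝ, Coord n) (halfSpace n) y :=
  (uniqueDiffOn_halfSpace y hy).uniqueMDiffWithinAt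

/-- The chain rule for a function on the manifold expressed in a chart. -/
lemma mfderiv_comp_mfderivWithin_point {F : Type*} [NormedAddCommGroup F] [NormedSpace ℝ F]
    {f : M → F} (hy : y ∈ e.dom univ)
    (hf : MDifferentiableAt (𝓡∂ (n + 1)) 𝓘(ℝ, F) f (e.point y)) (v : Coord n) :
    (show F from mfderiv (𝓡∂ (n + 1)) 𝓘(ℝ, F) f (e.point y)
      (mfderivWithin 𝓘(ℝ, Coord n) (𝓡∂ (n + 1)) e.point (halfSpace n) y v)) =
      fderivWithin ℝ (fun z => f (e.point z)) (halfSpace n) y v := by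
  have h := mfderiv_comp_mfderivWithin (I := 𝓘(ℝ, Coord n)) (I' := 𝓡∂ (n + 1))
    (I'' := 𝓘(ℝ, F)) (x := y) hf (mdifferentiableWithinAt_point hy)
    (uniqueMDiffWithinAt_halfSpace (isRelOpen_dom_univ.subset hy))
  rw [mfderivWithin_eq_fderivWithin] at h
  exact (congrArg (fun L => L v) h).symm

lemma mfderiv_toCoord_mfderivWithin_point (hy : y ∈ e.dom univ) (v : Coord n) :
    (show Coord n from mfderiv (𝓡∂ (n + 1)) 𝓘(ℝ, Coord n) e.toCoord (e.point y)
      (mfderivWithin 𝓘(ℝ, Coord n) (𝓡∂ (n + 1)) e.point (halfSpace n) y v)) = v := by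
  rw [mfderiv_comp_mfderivWithin_point hy (mdifferentiableAt_toCoord (point_mem_source hy))]
  have h : fderivWithin ℝ (fun z => e.toCoord (e.point z)) (halfSpace n) y =
      fderivWithin ℝ id (halfSpace n) y := by
    refine Filter.EventuallyEq.fderivWithin_eq ?_ (toCoord_point hy)
    filter_upwards [isRelOpen_dom_univ.mem_nhdsWithin y hy] with z hz using toCoord_point hz
  rw [h, fderivWithin_id (uniqueDiffOn_halfSpace y (isRelOpen_dom_univ.subset hy))]
  rfl

/-- The derivative of the inverse chart within the half space is a right inverse. Surjectivity
suffices because the tangent space and the model have the same finite dimension. -/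
lemma mfderiv_toCoord_isInvertible (hx : x ∈ e.1.source) :
    (mfderiv (𝓡∂ (n + 1)) 𝓘(ℝ, Coord n) e.toCoord x).IsInvertible := by
  have hy : e.toCoord x ∈ e.dom univ := toCoord_mem_dom hx (mem_univ x)
  have hp := point_toCoord hx
  have h1 : (mfderiv (𝓡∂ (n + 1)) 𝓘(ℝ, Coord n) e.toCoord (e.point (e.toCoord x))).comp
      (mfderivWithin 𝓘(ℝ, Coord n) (𝓡∂ (n + 1)) e.point (halfSpace n) (e.toCoord x)) =
      ContinuousLinearMap.id ℝ (Coord n) :=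
    ContinuousLinearMap.ext fun v => mfderiv_toCoord_mfderivWithin_point hy v
  rw [hp] at h1
  have hinj : Function.Surjective (mfderiv (𝓡∂ (n + 1)) 𝓘(ℝ, Coord n) e.toCoord x) :=
    fun v => ⟨_, congrArg (fun L : Coord n →L[ℝ] Coord n => L v) h1⟩
  let f : Coord n →L[ℝ] Coord n := mfderiv (𝓡∂ (n + 1)) 𝓘(ℝ, Coord n) e.toCoord x
  have hs : Function.Surjective f.toLinearMap := hinj
  have hi := LinearMap.injective_iff_surjective.2 hs
  exact ⟨(LinearEquiv.ofBijective f.toLinearMap ⟨hi, hs⟩).toContinuousLinearEquiv, rfl⟩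

lemma mfderiv_toCoord_coordField (hx : x ∈ e.1.source) (a : Fin (n + 1)) :
    (show Coord n from mfderiv (𝓡∂ (n + 1)) 𝓘(ℝ, Coord n) e.toCoord x (coordField e a x)) =
      EuclideanSpace.single a 1 := by
  obtain ⟨L, hL⟩ := mfderiv_toCoord_isInvertible hx
  have h2 : coordField e a x = L.symm (EuclideanSpace.single a (1 : ℝ) : Coord n) := by
    change (mfderiv (𝓡∂ (n + 1)) 𝓘(ℝ, Coord n) e.toCoord x).inverse _ = _
    rw [← hL, ContinuousLinearMap.inverse_equiv]; rfl
  rw [h2, ← hL]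
  exact L.apply_symm_apply _

lemma mfderiv_toCoord_injective (hx : x ∈ e.1.source) :
    Function.Injective (mfderiv (𝓡∂ (n + 1)) 𝓘(ℝ, Coord n) e.toCoord x) := by
  obtain ⟨L, hL⟩ := mfderiv_toCoord_isInvertible hx
  rw [← hL]
  exact L.injective

lemma coordField_point (hy : y ∈ e.dom univ) (a : Fin (n + 1)) :
    coordField e a (e.point y) = mfderivWithin 𝓘(ℝ, Coord n) (𝓡∂ (n + 1)) e.point (halfSpace n) y
      (EuclideanSpace.single a (1 : ℝ) : Coord n) := by
  apply mfderiv_toCoord_injective (point_mem_source hy)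
  exact (mfderiv_toCoord_coordField (point_mem_source hy) a).trans
    (mfderiv_toCoord_mfderivWithin_point hy _).symm

/-- The derivative of a function along a coordinate field is a partial derivative. -/
lemma mfderiv_coordField {F : Type*} [NormedAddCommGroup F] [NormedSpace ℝ F]
    {f : M → F} (hy : y ∈ e.dom univ)
    (hf : MDifferentiableAt (𝓡∂ (n + 1)) 𝓘(ℝ, F) f (e.point y)) (a : Fin (n + 1)) :
    (show F from mfderiv (𝓡∂ (n + 1)) 𝓘(ℝ, F) f (e.point y) (coordField e a (e.point y))) =
      pd (fun z => f (e.point z)) a y := by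
  rw [coordField_point hy]
  exact mfderiv_comp_mfderivWithin_point hy hf _

/-- The components of a tangent vector in a chart. -/
noncomputable def tangentCoord (e : SmoothChart n M) (x : M) (v : TangentSpace (𝓡∂ (n + 1)) x) : Coord n :=
  mfderiv (𝓡∂ (n + 1)) 𝓘(ℝ, Coord n) e.toCoord x v

lemma tangentCoord_coordField (hx : x ∈ e.1.source) (a : Fin (n + 1)) :
    tangentCoord e x (coordField e a x) = EuclideanSpace.single a 1 :=
  mfderiv_toCoord_coordField hx a

lemma tangentCoord_add (v w : TangentSpace (𝓡∂ (n + 1)) x) :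
    tangentCoord e x (v + w) = tangentCoord e x v + tangentCoord e x w := map_add _ _ _

lemma tangentCoord_smul (c : ℝ) (v : TangentSpace (𝓡∂ (n + 1)) x) :
    tangentCoord e x (c • v) = c • tangentCoord e x v := map_smul _ _ _

lemma tangentCoord_sum {ι : Type*} (s : Finset ι) (v : ι → TangentSpace (𝓡∂ (n + 1)) x) :
    tangentCoord e x (∑ i ∈ s, v i) = ∑ i ∈ s, tangentCoord e x (v i) := map_sum _ _ _

lemma tangentCoord_coordField_of_chart (hy : y ∈ e.dom e'.1.source) (a k : Fin (n + 1)) :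
    tangentCoord e' (e.point y) (coordField e a (e.point y)) k = jac e e' y k a := by
  have h := mfderiv_coordField (f := e'.toCoord) (dom_subset_univ hy)
    (mdifferentiableAt_toCoord hy.2) a
  have h' : tangentCoord e' (e.point y) (coordField e a (e.point y)) =
      fderivWithin ℝ (coordChange e e') (halfSpace n) y (EuclideanSpace.single a 1) := h
  rw [h']
  have hd := isRelOpen_dom_source.differentiableWithinAt
    (contDiffOn_coordChange (e := e) (e' := e')) hy
  have h2 : HasFDerivWithinAt (fun z => coordChange e e' z k)
      ((EuclideanSpace.proj k : Coord n →L[ℝ] ℝ).comp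
      (fderivWithin ℝ (coordChange e e') (halfSpace n) y)) (halfSpace n) y :=
    (EuclideanSpace.proj k : Coord n →L[ℝ] ℝ).hasFDerivAt.comp_hasFDerivWithinAt y
      hd.hasFDerivWithinAt
  exact (congrArg (fun L => L (EuclideanSpace.single a 1)) (h2.fderivWithin
    (uniqueDiffOn_halfSpace y (isRelOpen_dom_source.subset hy)))).symm

/-- The coordinate fields of one chart in terms of those of another one. -/
lemma coordField_eq_sum (hy : y ∈ e.dom e'.1.source) (a : Fin (n + 1)) :
    coordField e a (e.point y) = ∑ k, jac e e' y k a • coordField e' k (e.point y) := by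
  apply mfderiv_toCoord_injective hy.2
  change tangentCoord e' _ _ = tangentCoord e' _ _
  rw [tangentCoord_sum]
  simp only [tangentCoord_smul, tangentCoord_coordField hy.2]
  ext k
  rw [tangentCoord_coordField_of_chart hy]
  simp [Pi.single_apply]

lemma tangentCoord_of_chart (hy : y ∈ e.dom e'.1.source)
    (v : TangentSpace (𝓡∂ (n + 1)) (e.point y)) (k : Fin (n + 1)) :
    tangentCoord e' (e.point y) v k =
      ∑ c, jac e e' y k c * tangentCoord e (e.point y) v c := by
  have hv : v = ∑ c, tangentCoord e (e.point y) v c • coordField e c (e.point y) := by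
    apply mfderiv_toCoord_injective (point_mem_source hy)
    change tangentCoord e _ _ = tangentCoord e _ _
    rw [tangentCoord_sum]
    simp only [tangentCoord_smul, tangentCoord_coordField (point_mem_source hy)]
    ext k
    simp [Pi.single_apply]
  conv_lhs => rw [hv]
  rw [tangentCoord_sum]
  simp only [tangentCoord_smul]
  simp [tangentCoord_coordField_of_chart hy, mul_comm]

lemma christoffel_eq (cov : CovOp n M) (e : SmoothChart n M) (y : Coord n) (a b c : Fin (n + 1)) :
    christoffel cov e y a b c =
      tangentCoord e (e.point y) (cov (coordField e b) (e.point y) (coordField e a (e.point y))) c :=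
  rfl

variable [IsManifold (𝓡∂ (n + 1)) ∞ M]

lemma contMDiffAt_coordField (hx : x ∈ e.1.source) (a : Fin (n + 1)) :
    ContMDiffAt (𝓡∂ (n + 1)) ((𝓡∂ (n + 1)).prod 𝓘(ℝ, Coord n)) ∞
      (fun z => (⟨z, coordField e a z⟩ : TangentBundle (𝓡∂ (n + 1)) M)) x := by
  refine ContMDiffAt.mpullback_vectorField_preimage (n := ∞) (m := ∞) ?_
    (contMDiffAt_toCoord hx) (mfderiv_toCoord_isInvertible hx) (by simp)
  have := (contMDiffAt_vectorSpace_iff_contDiffAt (𝕜 := ℝ) (E := Coord n) (n := ∞)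
    (V := fun _ => (EuclideanSpace.single a (1 : ℝ) : Coord n)) (x := e.toCoord x)).2 contDiffAt_const
  exact this

lemma vFieldDiffAt_coordField (hx : x ∈ e.1.source) (a : Fin (n + 1)) :
    VFieldDiffAt (coordField e a) x :=
  (contMDiffAt_coordField hx a).mdifferentiableAt (by simp)

/-- Coordinate fields are pulled back from constant fields, and pullback is compatible with Lie
brackets. -/
lemma mlieBracket_coordField (hx : x ∈ e.1.source) (a b : Fin (n + 1)) :
    VectorField.mlieBracket (𝓡∂ (n + 1)) (coordField e a) (coordField e b) x = 0 := by
  have hd : ∀ c : Fin (n + 1), MDifferentiableAt 𝓘(ℝ, Coord n) (𝓘(ℝ, Coord n).prod 𝓘(ℝ, Coord n))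
      (fun z => (⟨z, (EuclideanSpace.single c (1 : ℝ) : Coord n)⟩ :
        TangentBundle 𝓘(ℝ, Coord n) (Coord n))) (e.toCoord x) := fun c =>
    ((contMDiffAt_vectorSpace_iff_contDiffAt (𝕜 := ℝ) (E := Coord n) (n := ∞)
      (V := fun _ => (EuclideanSpace.single c (1 : ℝ) : Coord n)) (x := e.toCoord x)).2
        contDiffAt_const).mdifferentiableAt (by simp)
  have h2 : minSmoothness ℝ 2 ≤ ∞ := by
    simpa using WithTop.coe_le_coe.2 (le_top (a := (2 : ℕ∞)))
  have : IsManifold (𝓡∂ (n + 1)) (minSmoothness ℝ 2) M := IsManifold.of_le h2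
  have h := VectorField.mpullback_mlieBracket (n := ∞) (I := 𝓡∂ (n + 1)) (I' := 𝓘(ℝ, Coord n))
    (hd a) (hd b) (contMDiffAt_toCoord hx) h2
  rw [coordField, coordField]
  refine h.symm.trans ?_
  change (mfderiv (𝓡∂ (n + 1)) 𝓘(ℝ, Coord n) e.toCoord x).inverse _ = 0
  have h0 : VectorField.mlieBracket 𝓘(ℝ, Coord n)
      (fun _ : Coord n => (EuclideanSpace.single a (1 : ℝ) : Coord n))
      (fun _ : Coord n => (EuclideanSpace.single b (1 : ℝ) : Coord n)) (e.toCoord x) = 0 := by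
    have h3 := congrFun (VectorField.mlieBracketWithin_eq_lieBracketWithin (𝕜 := ℝ) (E := Coord n)
      (V := fun _ : Coord n => (EuclideanSpace.single a (1 : ℝ) : Coord n))
      (W := fun _ : Coord n => (EuclideanSpace.single b (1 : ℝ) : Coord n)) (s := univ))
      (e.toCoord x)
    have h4 : VectorField.lieBracketWithin ℝ
      (fun _ : Coord n => (EuclideanSpace.single a (1 : ℝ) : Coord n))
      (fun _ : Coord n => (EuclideanSpace.single b (1 : ℝ) : Coord n)) univ (e.toCoord x) = 0 := by
      simp [VectorField.lieBracketWithin]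
    exact (congrFun (VectorField.mlieBracketWithin_univ (I := 𝓘(ℝ, Coord n))).symm _).trans (h3.trans h4)
  exact (congrArg _ h0).trans (map_zero _)

variable {cov : CovOp n M}

namespace IsAffineConnectionOn

lemma mono {V : Set M} (h : IsAffineConnectionOn cov U) (hV : V ⊆ U) :
    IsAffineConnectionOn cov V :=
  ⟨h.isCov.mono hV, fun W hW hWo => h.smooth W (hW.trans hV) hWo,
    fun X Y x hx => h.torsionFree X Y x (hV hx)⟩

lemma christoffel_symm (h : IsAffineConnectionOn cov U) (hy : y ∈ e.dom U) (a b c : Fin (n + 1)) :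
    christoffel cov e y a b c = christoffel cov e y b a c := by
  have hx := point_mem_source hy
  have := h.torsionFree (coordField e a) (coordField e b) (e.point y) hy.2
    (vFieldDiffAt_coordField hx a) (vFieldDiffAt_coordField hx b)
  rw [mlieBracket_coordField hx, sub_eq_zero] at this
  rw [christoffel_eq, christoffel_eq, this]

lemma contDiffOn_christoffel (h : IsAffineConnectionOn cov U) (hU : IsOpen U)
    (a b c : Fin (n + 1)) :
    ContDiffOn ℝ ∞ (fun y => christoffel cov e y a b c) (e.dom U) := by
  -- Coordinate fields are smooth only on the chart domain, so smoothness of the connection is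
  -- applied on this smaller open set.
  set V := U ∩ e.1.source
  have hV : IsOpen V := hU.inter e.1.open_source
  have h1 := (h.smooth V inter_subset_left hV).contMDiff (σ := coordField e b)
    (fun x hx => by simpa using (contMDiffAt_coordField hx.2 b).contMDiffWithinAt)
  have h2 := ContMDiffOn.clm_bundle_apply h1
    (v := coordField e a) (fun x hx => (contMDiffAt_coordField hx.2 a).contMDiffWithinAt)
  have h3 : ContMDiffOn (𝓡∂ (n + 1)) 𝓘(ℝ, Coord n) ∞ e.toCoord V :=
    fun x hx => (contMDiffAt_toCoord hx.2).contMDiffWithinAt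
  -- The tangent map of the chart sends the vector field `∇_{∂_a} ∂_b` to its coordinate components,
  -- and is smooth.
  have h4 := h3.contMDiffOn_tangentMapWithin (m := ∞) (by simp) hV.uniqueMDiffOn
  have h5 := h4.comp h2 (fun x hx => hx)
  have h6 := (contMDiff_snd_tangentBundle_modelSpace (n := ∞) (Coord n)
    𝓘(ℝ, Coord n)).comp_contMDiffOn h5
  have h7 : ContMDiffOn (𝓡∂ (n + 1)) 𝓘(ℝ, Coord n) ∞
      (fun x => tangentCoord e x (cov (coordField e b) x (coordField e a x))) V := by
    refine h6.congr fun x hx => ?_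
    have hm : mfderivWithin (𝓡∂ (n + 1)) 𝓘(ℝ, Coord n) e.toCoord V x =
      mfderiv (𝓡∂ (n + 1)) 𝓘(ℝ, Coord n) e.toCoord x := mfderivWithin_of_isOpen hV hx
    exact congrArg (fun L => L (cov (coordField e b) x (coordField e a x))) hm.symm
  have h9 : ContMDiffOn 𝓘(ℝ, Coord n) (𝓡∂ (n + 1)) ∞ e.point (e.dom U) :=
    contMDiffOn_point.mono dom_subset_univ
  have h8 : ContMDiffOn 𝓘(ℝ, Coord n) 𝓘(ℝ, Coord n) ∞
      ((fun x => tangentCoord e x (cov (coordField e b) x (coordField e a x))) ∘ e.point)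
      (e.dom U) := h7.comp h9 (fun y hy => ⟨hy.2, point_mem_source hy⟩)
  have h10 : ContDiff ℝ ∞ fun z : Coord n => z c := contDiff_euclidean.1 contDiff_id c
  exact h10.comp_contDiffOn h8.contDiffOn

/-- The transformation law of the Christoffel symbols. -/
lemma christoffel_transform (h : IsAffineConnectionOn cov U) (hU : IsOpen U)
    (hy : y ∈ e.dom (U ∩ e'.1.source)) (a b k : Fin (n + 1)) :
    ∑ c, jac e e' y k c * christoffel cov e y a b c =
      hess e e' y a b k + ∑ l, ∑ m,
        christoffel cov e' (coordChange e e' y) l m k * jac e e' y l a * jac e e' y m b := by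
  have hyU : y ∈ e.dom U := dom_mono inter_subset_left hy
  have hy' : y ∈ e.dom e'.1.source := dom_mono inter_subset_right hy
  set x := e.point y with hxdef
  have hxe : x ∈ e.1.source := point_mem_source hy
  have hxe' : x ∈ e'.1.source := hy'.2
  have hxU : x ∈ U := hyU.2
  -- The coefficients in `∂_b = J^k_b ∂'_k`, regarded as functions on the manifold so that the
  -- Leibniz rule for `cov` applies. Its derivative term produces the Hessian of the coordinate
  -- change.
  let g : Fin (n + 1) → M → ℝ := fun k z => jac e e' (e.toCoord z) k b
  have hg : ∀ k, MDifferentiableAt (𝓡∂ (n + 1)) 𝓘(ℝ, ℝ) (g k) x := by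
    intro k
    have hmem : e.toCoord x ∈ e.dom e'.1.source := toCoord_mem_dom hxe hxe'
    have h1 : MDifferentiableWithinAt 𝓘(ℝ, Coord n) 𝓘(ℝ, ℝ) (fun z => jac e e' z k b)
        (e.dom e'.1.source) (e.toCoord x) :=
      ((contDiffOn_jac k b).differentiableOn (by simp) _ hmem).mdifferentiableWithinAt
    have h2 := h1.comp_of_preimage_mem_nhdsWithin (x := x) (f := e.toCoord) (s := univ)
      (mdifferentiableAt_toCoord hxe).mdifferentiableWithinAt (by
      rw [nhdsWithin_univ]
      filter_upwards [e.1.open_source.mem_nhds hxe, e'.1.open_source.mem_nhds hxe'] with z hz hz'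
      exact toCoord_mem_dom hz hz')
    exact mdifferentiableWithinAt_univ.1 h2
  have hF : ∀ k, MDifferentiableAt (𝓡∂ (n + 1)) ((𝓡∂ (n + 1)).prod 𝓘(ℝ, Coord n))
      (fun z => (⟨z, coordField e' k z⟩ : TangentBundle (𝓡∂ (n + 1)) M)) x :=
    fun k => vFieldDiffAt_coordField hxe' k
  have hgF : ∀ k, MDifferentiableAt (𝓡∂ (n + 1)) ((𝓡∂ (n + 1)).prod 𝓘(ℝ, Coord n))
      (fun z => (⟨z, (g k • coordField e' k) z⟩ : TangentBundle (𝓡∂ (n + 1)) M)) x :=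
    fun k => (hg k).smul_section (hF k)
  -- Additivity of `cov` requires differentiable summands, so differentiability of the partial sums
  -- is carried through the induction.
  have hsum : ∀ s : Finset (Fin (n + 1)),
      MDifferentiableAt (𝓡∂ (n + 1)) ((𝓡∂ (n + 1)).prod 𝓘(ℝ, Coord n))
        (fun z => (⟨z, (∑ k ∈ s, g k • coordField e' k) z⟩ : TangentBundle (𝓡∂ (n + 1)) M)) x ∧
      cov (∑ k ∈ s, g k • coordField e' k) x = ∑ k ∈ s, cov (g k • coordField e' k) x := by
    intro s
    induction s using Finset.induction_on with
    | empty =>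
      refine ⟨?_, ?_⟩
      · exact mdifferentiableAt_zeroSection ..
      · simpa using h.isCov.zero hxU
    | insert k s hk ih =>
      refine ⟨?_, ?_⟩
      · rw [Finset.sum_insert hk]
        exact mdifferentiableAt_add_section (hgF k) ih.1
      · rw [Finset.sum_insert hk, Finset.sum_insert hk, h.isCov.add (hgF k) ih.1 hxU, ih.2]
  -- The expansion holds only on the overlap of the charts; a covariant derivative depends only on
  -- the germ of the field.
  have hcov : cov (coordField e b) x = ∑ k, cov (g k • coordField e' k) x := by
    rw [← (hsum Finset.univ).2]
    refine h.isCov.congr_of_eventuallyEq (vFieldDiffAt_coordField hxe b) (hsum Finset.univ).1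
      (hU.mem_nhds hxU) ?_
    filter_upwards [e.1.open_source.mem_nhds hxe, e'.1.open_source.mem_nhds hxe'] with z hz hz'
    have := coordField_eq_sum (e := e) (e' := e') (toCoord_mem_dom hz hz') b
    rw [point_toCoord hz] at this
    rw [this, Finset.sum_apply]
    rfl
  have hcov2 : cov (coordField e b) x (coordField e a x) =
      ∑ m, (jac e e' y m b • cov (coordField e' m) x (coordField e a x)
        + hess e e' y a b m • coordField e' m x) := by
    rw [hcov, _root_.sum_apply]
    refine Finset.sum_congr rfl fun m _ => ?_
    rw [h.isCov.leibniz (hF m) (hg m) hxU]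
    have hgm : g m x = jac e e' y m b := by
      simp only [g, hxdef, toCoord_point hy]
    have hdg : mvfderiv (𝓡∂ (n + 1)) (g m) x (coordField e a x) = hess e e' y a b m := by
      have := mfderiv_coordField (dom_subset_univ hy) (hg m) a
      refine this.trans ?_
      exact (isRelOpen_dom_source (e := e) (e' := e')).pd_congr
        (fun z hz => by simp only [g, toCoord_point hz]) a hy'
    rw [_root_.add_apply, ContinuousLinearMap.smulRight_apply, hdg, _root_.smul_apply, hgm]
  have hcov3 : ∀ m, cov (coordField e' m) x (coordField e a x) =
      ∑ l, jac e e' y l a • cov (coordField e' m) x (coordField e' l x) := by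
    intro m
    rw [coordField_eq_sum hy' a, map_sum]
    simp only [map_smul]
    rfl
  have hx' : e'.point (coordChange e e' y) = x := point_coordChange hy'
  simp only [christoffel_eq]
  rw [← tangentCoord_of_chart hy', hx', ← hxdef, hcov2, tangentCoord_sum]
  simp only [hcov3, tangentCoord_add, tangentCoord_smul, tangentCoord_sum,
    tangentCoord_coordField hxe']
  rw [Finset.sum_comm]
  simp [Finset.sum_add_distrib, Pi.single_apply, Finset.mul_sum]
  rw [add_comm]
  congr 1
  exact Finset.sum_congr rfl fun m _ => Finset.sum_congr rfl fun l _ => by ring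

end IsAffineConnectionOn

end Connections

end ProjCompact

namespace ProjCompact
open Filter
open scoped Topology

/-! ### Curvature in coordinates -/

section Curvature

variable {n : ℕ}

/-- Christoffel symbols with values in an open subset are smooth. -/
def SmoothSymbols (G : Coord n → Fin (n + 1) → Fin (n + 1) → Fin (n + 1) → ℝ)
    (S : Set (Coord n)) : Prop :=
  ∀ a b c, ContDiffOn ℝ ∞ (fun y => G y a b c) S

/-- The partial derivative of a matrix valued function. -/
noncomputable def pdMat {ι κ : Type*} (X : Coord n → Matrix ι κ ℝ) (a : Fin (n + 1)) (y : Coord n) :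
    Matrix ι κ ℝ :=
  Matrix.of fun i j => pd (fun z => X z i j) a y

/-- Differentiability of all entries of a matrix valued function. -/
def DiffMat {ι κ : Type*} (X : Coord n → Matrix ι κ ℝ) (y : Coord n) : Prop :=
  ∀ i j, DifferentiableWithinAt ℝ (fun z => X z i j) (halfSpace n) y

section pdMat

variable {ι κ l : Type*} [Fintype κ] {X X' : Coord n → Matrix ι κ ℝ} {Y : Coord n → Matrix κ l ℝ}
  {y : Coord n} (a : Fin (n + 1))

omit [Fintype κ] in
lemma pdMat_add (hX : DiffMat X y) (hY : DiffMat X' y) (hy : y ∈ halfSpace n) :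
    pdMat (fun z => X z + X' z) a y = pdMat X a y + pdMat X' a y := by
  ext i j; exact pd_add a (hX i j) (hY i j) hy

lemma pdMat_mul (hX : DiffMat X y) (hY : DiffMat Y y) (hy : y ∈ halfSpace n) :
    pdMat (fun z => X z * Y z) a y = pdMat X a y * Y y + X y * pdMat Y a y := by
  ext i j
  simp only [pdMat, Matrix.of_apply, Matrix.mul_apply, Matrix.add_apply]
  rw [pd_sum a _ (fun k _ => (hX i k).fun_mul (hY k j)) hy, ← Finset.sum_add_distrib]
  exact Finset.sum_congr rfl fun k _ => pd_mul a (hX i k) (hY k j) hy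

lemma DiffMat.mul (hX : DiffMat X y) (hY : DiffMat Y y) : DiffMat (fun z => X z * Y z) y := by
  intro i j
  simp only [Matrix.mul_apply]
  exact DifferentiableWithinAt.fun_sum fun k _ => (hX i k).fun_mul (hY k j)

omit [Fintype κ] in
lemma IsRelOpen.pdMat_congr {S : Set (Coord n)} (hS : IsRelOpen S) (h : EqOn X X' S)
    (hy : y ∈ S) : pdMat X a y = pdMat X' a y := by
  ext i j
  exact hS.pd_congr (fun z hz => by simp only [h hz]) a hy

end pdMat

/-- The connection matrix of the Christoffel symbols in a coordinate direction. -/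
def symbolMat (G : Coord n → Fin (n + 1) → Fin (n + 1) → Fin (n + 1) → ℝ) (a : Fin (n + 1))
    (y : Coord n) : Matrix (Fin (n + 1)) (Fin (n + 1)) ℝ :=
  Matrix.of fun c b => G y a b c

/-- The curvature matrix `R_{ab}` of the Christoffel symbols. -/
noncomputable def curvMat (G : Coord n → Fin (n + 1) → Fin (n + 1) → Fin (n + 1) → ℝ) (a b : Fin (n + 1))
    (y : Coord n) : Matrix (Fin (n + 1)) (Fin (n + 1)) ℝ :=
  pdMat (symbolMat G b) a y - pdMat (symbolMat G a) b y
    + symbolMat G a y * symbolMat G b y - symbolMat G b y * symbolMat G a y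

lemma ricci_apply (G : Coord n → Fin (n + 1) → Fin (n + 1) → Fin (n + 1) → ℝ) (y : Coord n)
    (b d : Fin (n + 1)) : ricci G y b d = ∑ a, curvMat G a b y a d := by
  simp only [ricci, curvMat, Matrix.of_apply, Matrix.sub_apply, Matrix.add_apply, pdMat, symbolMat,
    Matrix.mul_apply, Finset.sum_sub_distrib, Finset.sum_add_distrib]
  ring

/-- Curvature transforms by conjugation under `JΓ = dJ + AJ`. Here `dGab` stands for the
`b`-derivative of `G_a`. Differentiating the two laws produces the same second derivative `dd`, by
symmetry, and it drops out of the skew combination. -/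
lemma gauge_curvature {R : Type*} [Ring R] {J Ga Gb Aa Ab dJa dJb dGab dGba dAab dAba dd : R}
    (h1 : J * Ga = dJa + Aa * J) (h2 : J * Gb = dJb + Ab * J)
    (h3 : dJb * Ga + J * dGab = dd + (dAab * J + Aa * dJb))
    (h4 : dJa * Gb + J * dGba = dd + (dAba * J + Ab * dJa)) :
    J * (dGab - dGba + Gb * Ga - Ga * Gb) = (dAab - dAba + Ab * Aa - Aa * Ab) * J := by
  have e1 : J * dGab = dd + (dAab * J + Aa * dJb) - dJb * Ga := by rw [← h3]; abel
  have e2 : J * dGba = dd + (dAba * J + Ab * dJa) - dJa * Gb := by rw [← h4]; abel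
  have e3 : dJa = J * Ga - Aa * J := by rw [h1]; abel
  have e4 : dJb = J * Gb - Ab * J := by rw [h2]; abel
  have : J * (dGab - dGba + Gb * Ga - Ga * Gb) =
      J * dGab - J * dGba + J * Gb * Ga - J * Ga * Gb := by noncomm_ring
  rw [this, e1, e2, e3, e4]
  noncomm_ring

variable {M : Type*} [TopologicalSpace M] [ChartedSpace (EuclideanHalfSpace (n + 1)) M]

open SmoothChart

/-- The Ricci tensor of symbols that transform like those of a connection is a tensor. -/
lemma ricci_transform {e e' : SmoothChart n M} {U : Set M} (hU : IsOpen U)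
    {G G' : Coord n → Fin (n + 1) → Fin (n + 1) → Fin (n + 1) → ℝ}
    (hG : SmoothSymbols G (e.dom U)) (hG' : SmoothSymbols G' (e'.dom U))
    (hlaw : ∀ z ∈ e.dom (U ∩ e'.1.source), ∀ a b k, ∑ c, jac e e' z k c * G z a b c =
      hess e e' z a b k + ∑ l, ∑ m,
        G' (coordChange e e' z) l m k * jac e e' z l a * jac e e' z m b)
    {y : Coord n} (hy : y ∈ e.dom (U ∩ e'.1.source)) :
    ricci G y = (jac e e' y)ᵀ * ricci G' (coordChange e e' y) * jac e e' y := by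
  have hS : IsRelOpen (e.dom (U ∩ e'.1.source)) := isRelOpen_dom (hU.inter e'.1.open_source)
  have hy' : y ∈ e.dom e'.1.source := dom_mono inter_subset_right hy
  have hyH := hS.subset hy
  set φ := coordChange e e'
  have hφU : ∀ z ∈ e.dom (U ∩ e'.1.source), φ z ∈ e'.dom U := fun z hz =>
    coordChange_mem_dom (dom_mono inter_subset_right hz) hz.2.1
  have dJ : ∀ k c, DifferentiableWithinAt ℝ (fun z => jac e e' z k c) (halfSpace n) y :=
    fun k c => isRelOpen_dom_source.differentiableWithinAt (contDiffOn_jac k c) hy'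
  have dG' : ∀ a b c, DifferentiableWithinAt ℝ (fun z => G' z a b c) (halfSpace n) (φ y) :=
    fun a b c => (isRelOpen_dom hU).differentiableWithinAt (hG' a b c) (hφU y hy)
  have dG'φ : ∀ a b c, DifferentiableWithinAt ℝ (fun z => G' (φ z) a b c) (halfSpace n) y := by
    intro a b c
    refine hS.differentiableWithinAt ?_ hy
    exact (hG' a b c).comp (contDiffOn_coordChange.mono (dom_mono inter_subset_right)) hφU
  -- The connection matrices of `G'` pulled back by the coordinate change, still in the frame of
  -- `e'`. The Jacobian is then a gauge transformation from the frame of `e`.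
  let A : Fin (n + 1) → Coord n → Matrix (Fin (n + 1)) (Fin (n + 1)) ℝ := fun a z =>
    Matrix.of fun k m => ∑ l, jac e e' z l a * G' (φ z) l m k
  have dA : ∀ a, DiffMat (A a) y := fun a k m =>
    DifferentiableWithinAt.fun_sum (u := Finset.univ)
      (A := fun l z => jac e e' z l a * G' (φ z) l m k) fun l _ => (dJ l a).fun_mul (dG'φ l m k)
  have dΓ : ∀ a, DiffMat (symbolMat G a) y := fun a k m =>
    (isRelOpen_dom hU).differentiableWithinAt (hG a m k) (dom_mono inter_subset_left hy)
  have dJm : DiffMat (jac e e') y := fun k c => dJ k c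
  have dJJ : ∀ a, DiffMat (pdMat (jac e e') a) y := fun a k b =>
    isRelOpen_dom_source.differentiableWithinAt (contDiffOn_hess a b k) hy'
  have law : ∀ a, EqOn (fun z => jac e e' z * symbolMat G a z)
      (fun z => pdMat (jac e e') a z + A a z * jac e e' z) (e.dom (U ∩ e'.1.source)) := by
    intro a z hz
    ext k b
    simp only [Matrix.mul_apply, symbolMat, Matrix.of_apply, Matrix.add_apply, A]
    rw [hlaw z hz a b k]
    congr 1
    simp only [Finset.sum_mul]
    rw [Finset.sum_comm]
    exact Finset.sum_congr rfl fun l _ => Finset.sum_congr rfl fun m _ => by ring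
  have dlaw : ∀ a b, pdMat (jac e e') b y * symbolMat G a y
      + jac e e' y * pdMat (symbolMat G a) b y = pdMat (pdMat (jac e e') a) b y
        + (pdMat (A a) b y * jac e e' y + A a y * pdMat (jac e e') b y) := by
    intro a b
    rw [← pdMat_mul b dJm (dΓ a) hyH, ← pdMat_mul b (dA a) dJm hyH,
      ← pdMat_add b (dJJ a) ((dA a).mul dJm) hyH]
    exact hS.pdMat_congr b (law a) hy
  have hsymm : ∀ a b, pdMat (pdMat (jac e e') a) b y = pdMat (pdMat (jac e e') b) a y := by
    intro a b
    ext k c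
    exact isRelOpen_dom_source.pd_pd_comm a b (contDiffOn_jac k c) hy'
  have hcurv : ∀ a b, jac e e' y * curvMat G a b y =
      (pdMat (A b) a y - pdMat (A a) b y + A a y * A b y - A b y * A a y) * jac e e' y :=
    fun a b => gauge_curvature (law b hy) (law a hy) (dlaw b a) (by rw [dlaw a b, hsymm a b])
  have hpdA : ∀ a b k p, pdMat (A b) a y k p = ∑ l, (hess e e' y a b l * G' (φ y) l p k
      + jac e e' y l b * ∑ m, jac e e' y m a * pd (fun z => G' z l p k) m (φ y)) := by
    intro a b k p
    simp only [pdMat, A, Matrix.of_apply]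
    rw [pd_sum a _ (fun l _ => (dJ l b).fun_mul (dG'φ l p k)) hyH]
    refine Finset.sum_congr rfl fun l _ => ?_
    rw [pd_mul a (dJ l b) (dG'φ l p k) hyH, pd_comp_coordChange hy' (dG' l p k) a]
    rfl
  -- The curvature of the pulled back connection is the pulled back curvature. The terms with second
  -- derivatives of the coordinate change cancel by their symmetry.
  have hF : ∀ a b, pdMat (A b) a y - pdMat (A a) b y + A a y * A b y - A b y * A a y =
      ∑ l, ∑ m, (jac e e' y l a * jac e e' y m b) • curvMat G' l m (φ y) := by
    intro a b
    ext k p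
    rw [Matrix.sub_apply, Matrix.add_apply, Matrix.sub_apply, hpdA, hpdA]
    simp only [Matrix.sub_apply, Matrix.add_apply, Matrix.sum_apply, Matrix.smul_apply,
      Matrix.mul_apply, curvMat, smul_eq_mul, symbolMat, pdMat, A, Matrix.of_apply]
    simp only [Finset.sum_add_distrib, hess_symm hy' b a, mul_add, mul_sub, Finset.sum_sub_distrib]
    have e1 : ∑ l, jac e e' y l b * ∑ m, jac e e' y m a * pd (fun z => G' z l p k) m (φ y) =
        ∑ l, ∑ m, jac e e' y l a * jac e e' y m b * pd (fun z => G' z m p k) l (φ y) := by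
      simp only [Finset.mul_sum]
      rw [Finset.sum_comm]
      exact Finset.sum_congr rfl fun l _ => Finset.sum_congr rfl fun m _ => by ring
    have e2 : ∑ l, jac e e' y l a * ∑ m, jac e e' y m b * pd (fun z => G' z l p k) m (φ y) =
        ∑ l, ∑ m, jac e e' y l a * jac e e' y m b * pd (fun z => G' z l p k) m (φ y) := by
      simp only [Finset.mul_sum]
      exact Finset.sum_congr rfl fun l _ => Finset.sum_congr rfl fun m _ => by ring
    have e3 : ∀ a b : Fin (n + 1), ∑ q, (∑ l, jac e e' y l a * G' (φ y) l q k) *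
        (∑ m, jac e e' y m b * G' (φ y) m p q) =
        ∑ l, ∑ m, jac e e' y l a * jac e e' y m b *
          ∑ q, G' (φ y) l q k * G' (φ y) m p q := by
      intro a b
      simp only [Finset.sum_mul_sum]
      simp only [Finset.mul_sum]
      rw [Finset.sum_comm]
      refine Finset.sum_congr rfl fun l _ => ?_
      rw [Finset.sum_comm]
      exact Finset.sum_congr rfl fun m _ => Finset.sum_congr rfl fun q _ => by ring
    have e4 : ∑ l, ∑ m, jac e e' y l b * jac e e' y m a *
          ∑ q, G' (φ y) l q k * G' (φ y) m p q =
        ∑ l, ∑ m, jac e e' y l a * jac e e' y m b *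
          ∑ q, G' (φ y) m q k * G' (φ y) l p q := by
      rw [Finset.sum_comm]
      exact Finset.sum_congr rfl fun l _ => Finset.sum_congr rfl fun m _ => by ring
    rw [e1, e2, e3, e3, e4]
    ring
  -- In the Ricci trace, the Jacobian of the first form index is contracted with the inverse
  -- Jacobian of the upper index; two Jacobians survive.
  have hJK : jac e' e (φ y) * jac e e' y = 1 := jac_mul_jac hy'
  have hKJ : jac e e' y * jac e' e (φ y) = 1 := mul_eq_one_comm.1 hJK
  ext b d
  have hc : ∀ a, curvMat G a b y a d = ∑ k, jac e' e (φ y) a k *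
      ∑ l, ∑ m, jac e e' y l a * jac e e' y m b *
        (curvMat G' l m (φ y) * jac e e' y) k d := by
    intro a
    have h1 : curvMat G a b y = jac e' e (φ y) * ((∑ l, ∑ m, (jac e e' y l a * jac e e' y m b) •
        curvMat G' l m (φ y)) * jac e e' y) := by
      rw [← hF a b, ← hcurv, ← Matrix.mul_assoc, hJK, Matrix.one_mul]
    rw [h1, Matrix.mul_apply]
    refine Finset.sum_congr rfl fun k _ => ?_
    congr 1
    simp only [Matrix.sum_mul, Matrix.sum_apply, Matrix.smul_mul, Matrix.smul_apply, smul_eq_mul]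
  rw [ricci_apply]
  simp only [hc]
  have h2 : ∑ a, ∑ k, jac e' e (φ y) a k * ∑ l, ∑ m, jac e e' y l a * jac e e' y m b *
        (curvMat G' l m (φ y) * jac e e' y) k d =
      ∑ k, ∑ l, (∑ a, jac e e' y l a * jac e' e (φ y) a k) * ∑ m, jac e e' y m b *
        (curvMat G' l m (φ y) * jac e e' y) k d := by
    rw [Finset.sum_comm]
    refine Finset.sum_congr rfl fun k _ => ?_
    simp only [Finset.mul_sum, Finset.sum_mul]
    rw [Finset.sum_comm]
    refine Finset.sum_congr rfl fun l _ => ?_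
    rw [Finset.sum_comm]
    refine Finset.sum_congr rfl fun m _ => Finset.sum_congr rfl fun a _ => by ring
  rw [h2]
  have h3 : ∀ l k, ∑ a, jac e e' y l a * jac e' e (φ y) a k = if l = k then 1 else 0 := by
    intro l k
    rw [← Matrix.mul_apply, hKJ, Matrix.one_apply]
  simp only [h3, ite_mul, one_mul, zero_mul, Finset.sum_ite_eq', Finset.mem_univ, if_true]
  rw [Matrix.mul_assoc, Matrix.mul_apply]
  simp only [Matrix.mul_apply, Matrix.transpose_apply, ricci_apply, Finset.mul_sum, Finset.sum_mul]
  rw [Finset.sum_comm]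
  refine Finset.sum_congr rfl fun m _ => ?_
  rw [Finset.sum_comm]

/-- The change of the Ricci tensor under a projective change of the connection. -/
lemma ricci_projective_change {S : Set (Coord n)} (hS : IsRelOpen S)
    {G P : Coord n → Fin (n + 1) → Fin (n + 1) → Fin (n + 1) → ℝ} {Υ : Coord n → Fin (n + 1) → ℝ}
    (hP : SmoothSymbols P S) (hPs : ∀ y ∈ S, ∀ a b c, P y a b c = P y b a c)
    (hΥ : ∀ a, ContDiffOn ℝ ∞ (fun y => Υ y a) S)
    (hclosed : ∀ y ∈ S, ∀ a b, pd (fun z => Υ z b) a y = pd (fun z => Υ z a) b y)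
    (hG : ∀ y ∈ S, ∀ a b c, G y a b c = P y a b c + Υ y a * kron b c + Υ y b * kron a c)
    {y : Coord n} (hy : y ∈ S) (b d : Fin (n + 1)) :
    ricci G y b d = ricci P y b d - n * (pd (fun z => Υ z d) b y - ∑ c, P y b d c * Υ y c
      - Υ y b * Υ y d) := by
  have hyH := hS.subset hy
  have hpd : ∀ i a b c, pd (fun z => G z a b c) i y = pd (fun z => P z a b c) i y
      + pd (fun z => Υ z a) i y * kron b c + pd (fun z => Υ z b) i y * kron a c := by
    intro i a b c
    have dP := hS.differentiableWithinAt (hP a b c) hy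
    have d1 := hS.differentiableWithinAt (hΥ a) hy
    have d2 := hS.differentiableWithinAt (hΥ b) hy
    have c1 : ∀ c : ℝ, DifferentiableWithinAt ℝ (fun _ : Coord n => c) (halfSpace n) y :=
      fun c => differentiableWithinAt_const c
    rw [hS.pd_congr (fun z hz => hG z hz a b c) i hy,
      pd_add i (dP.fun_add (d1.fun_mul (c1 _))) (d2.fun_mul (c1 _)) hyH,
      pd_add i dP (d1.fun_mul (c1 _)) hyH, pd_mul i d1 (c1 _) hyH, pd_mul i d2 (c1 _) hyH,
      pd_const, pd_const]
    ring
  simp only [ricci, Matrix.of_apply, hpd, hG y hy]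
  simp only [kron]
  have hb := hclosed y hy
  simp only [Finset.sum_add_distrib, Finset.sum_sub_distrib, add_mul, mul_add, mul_ite, ite_mul,
    mul_one, mul_zero, zero_mul, Finset.sum_ite_eq, Finset.sum_ite_eq', Finset.mem_univ,
    if_true]
  have e1 : ∑ x, ∑ z, (if b = x then Υ y z * P y x d z else 0) = ∑ z, P y b d z * Υ y z := by
    rw [Finset.sum_comm]
    refine Finset.sum_congr rfl fun z _ => ?_
    rw [Finset.sum_ite_eq]; simp [mul_comm]
  have e2 : ∑ x, P y x b x * Υ y d = ∑ x, P y b x x * Υ y d :=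
    Finset.sum_congr rfl fun x _ => by rw [hPs y hy]
  have e3 : ∑ x, Υ y x * P y b d x = ∑ z, P y b d z * Υ y z :=
    Finset.sum_congr rfl fun x _ => mul_comm _ _
  have e4 : ∑ x, P y x d x * Υ y b = ∑ x, Υ y b * P y x d x :=
    Finset.sum_congr rfl fun x _ => mul_comm _ _
  -- The two divergence terms give `∂_d Υ_b + ∂_b Υ_d`, which is `2 ∂_b Υ_d` for a closed form, and
  -- the trace term gives `-(n+2) ∂_b Υ_d`. This is the origin of the factor `-n`.
  rw [e1, e2, e3, e4, hb d b]
  simp only [Finset.sum_const, Finset.card_univ, Fintype.card_fin, nsmul_eq_mul, Nat.cast_add,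
    Nat.cast_one]
  ring

/-- The Ricci tensor of a symmetric connection with trace-free symbols is symmetric. -/
lemma ricci_isSymm {S : Set (Coord n)} (hS : IsRelOpen S)
    {P : Coord n → Fin (n + 1) → Fin (n + 1) → Fin (n + 1) → ℝ}
    (hPs : ∀ y ∈ S, ∀ a b c, P y a b c = P y b a c) (hPt : ∀ y ∈ S, ∀ a, ∑ b, P y a b b = 0)
    (hP : SmoothSymbols P S) {y : Coord n} (hy : y ∈ S) : (ricci P y).IsSymm := by
  have hyH := hS.subset hy
  ext b d
  -- The derivative of the trace is the only term of the Ricci tensor that is not symmetric for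
  -- symmetric symbols.
  have htr : ∀ c d : Fin (n + 1), ∑ a, pd (fun z => P z a d a) c y = 0 := by
    intro c d
    rw [← pd_sum c _ (fun a _ => hS.differentiableWithinAt (hP a d a) hy) hyH]
    rw [hS.pd_congr (g := fun _ => 0) (fun z hz => ?_) c hy, pd_const]
    exact (Finset.sum_congr rfl fun a _ => hPs z hz a d a).trans (hPt z hz d)
  simp only [Matrix.transpose_apply, ricci, Matrix.of_apply, Finset.sum_add_distrib,
    Finset.sum_sub_distrib, htr]
  have e1 : ∑ a, pd (fun z => P z b d a) a y = ∑ a, pd (fun z => P z d b a) a y :=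
    Finset.sum_congr rfl fun a _ => hS.pd_congr (fun z hz => hPs z hz b d a) a hy
  have e2 : ∑ a, ∑ f, P y b f a * P y a d f = ∑ a, ∑ f, P y d f a * P y a b f := by
    rw [Finset.sum_comm]
    exact Finset.sum_congr rfl fun f _ => Finset.sum_congr rfl fun a _ => by
      rw [hPs y hy b f a, hPs y hy a d f]; ring
  have e3 : ∑ a, ∑ f, P y a f a * P y b d f = ∑ a, ∑ f, P y a f a * P y d b f :=
    Finset.sum_congr rfl fun a _ => Finset.sum_congr rfl fun f _ => by rw [hPs y hy b d f]
  rw [e1, e2, e3]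

/-- The components of the Ricci tensor are smooth. -/
lemma contDiffOn_ricci {S : Set (Coord n)} (hS : IsRelOpen S)
    {P : Coord n → Fin (n + 1) → Fin (n + 1) → Fin (n + 1) → ℝ} (hP : SmoothSymbols P S)
    (b d : Fin (n + 1)) : ContDiffOn ℝ ∞ (fun y => ricci P y b d) S := by
  simp only [ricci, Matrix.of_apply]
  refine ContDiffOn.sum fun a _ => ((hS.contDiffOn_pd (hP b d a) a).sub
    (hS.contDiffOn_pd (hP a d a) b)).add (ContDiffOn.sum fun f _ => ?_)
  exact ((hP a f a).mul (hP b d f)).sub ((hP b f a).mul (hP a d f))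

end Curvature

end ProjCompact

namespace ProjCompact
open Filter
open scoped Topology

/-! ### The projective structure on the manifold with boundary -/

section Thomas

variable {n : ℕ}

/-- The one-form `Υ` with `Γ = Π + Υ ⊗ id + id ⊗ Υ` for the trace-free part `Π` of `Γ`. -/
noncomputable def symbolTrace (G : Coord n → Fin (n + 1) → Fin (n + 1) → Fin (n + 1) → ℝ) (y : Coord n)
    (a : Fin (n + 1)) : ℝ := (∑ b, G y a b b) / ((n : ℝ) + 2)

/-- The trace-free part of the Christoffel symbols. -/
noncomputable def thomasPart (G : Coord n → Fin (n + 1) → Fin (n + 1) → Fin (n + 1) → ℝ) (y : Coord n)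
    (a b c : Fin (n + 1)) : ℝ :=
  G y a b c - symbolTrace G y a * kron b c - symbolTrace G y b * kron a c

lemma sum_kron_mul (f : Fin (n + 1) → ℝ) (a : Fin (n + 1)) : ∑ b, f b * kron a b = f a := by
  simp [kron]

lemma sum_mul_kron (f : Fin (n + 1) → ℝ) (a : Fin (n + 1)) : ∑ b, f b * kron b a = f a := by
  simp [kron]

lemma sum_kron_self (r : ℝ) : ∑ b : Fin (n + 1), r * kron b b = ((n : ℝ) + 1) * r := by
  simp [kron]

lemma natCast_add_two_ne : (n : ℝ) + 2 ≠ 0 := by positivity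

variable {G P : Coord n → Fin (n + 1) → Fin (n + 1) → Fin (n + 1) → ℝ} {y : Coord n}

/-- Tracing the two correction terms in dimension `n + 1` gives `(n+1) Υ_a + Υ_a`, which explains
the denominator `n + 2`. -/
lemma symbolTrace_eq {Υ : Fin (n + 1) → ℝ} (hP : ∀ a, ∑ b, P y a b b = 0)
    (hG : ∀ a b c, G y a b c = P y a b c + Υ a * kron b c + Υ b * kron a c) (a : Fin (n + 1)) :
    symbolTrace G y a = Υ a := by
  rw [symbolTrace, div_eq_iff natCast_add_two_ne]
  simp only [hG, Finset.sum_add_distrib, hP, sum_kron_self, sum_kron_mul]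
  ring

lemma sum_thomasPart (a : Fin (n + 1)) : ∑ b, thomasPart G y a b b = 0 := by
  simp only [thomasPart, Finset.sum_sub_distrib, sum_kron_self, sum_kron_mul]
  have : ∑ b, G y a b b = symbolTrace G y a * ((n : ℝ) + 2) := by
    rw [symbolTrace, div_mul_cancel₀ _ natCast_add_two_ne]
  rw [this]; ring

lemma eq_thomasPart_add (a b c : Fin (n + 1)) :
    G y a b c = thomasPart G y a b c + symbolTrace G y a * kron b c
      + symbolTrace G y b * kron a c := by
  rw [thomasPart]; ring

lemma thomasPart_eq {Υ : Fin (n + 1) → ℝ} (hP : ∀ a, ∑ b, P y a b b = 0)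
    (hG : ∀ a b c, G y a b c = P y a b c + Υ a * kron b c + Υ b * kron a c) (a b c : Fin (n + 1)) :
    thomasPart G y a b c = P y a b c := by
  rw [thomasPart, symbolTrace_eq hP hG, symbolTrace_eq hP hG, hG]; ring

/-- The trace-free part is a projective invariant. It therefore extends to the boundary as soon as
one connection in the class does, although the symbols of `∇` themselves blow up. -/
lemma thomasPart_congr {Υ : Fin (n + 1) → ℝ}
    (hG : ∀ a b c, G y a b c = P y a b c + Υ a * kron b c + Υ b * kron a c) (a b c : Fin (n + 1)) :
    thomasPart G y a b c = thomasPart P y a b c := by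
  refine thomasPart_eq (Υ := fun a => symbolTrace P y a + Υ a) sum_thomasPart (fun a b c => ?_) a b c
  rw [hG, eq_thomasPart_add (G := P)]; ring

lemma contDiffOn_symbolTrace {S : Set (Coord n)} (hG : SmoothSymbols G S) (a : Fin (n + 1)) :
    ContDiffOn ℝ ∞ (fun z => symbolTrace G z a) S :=
  (ContDiffOn.sum fun b _ => hG a b b).div_const _

lemma contDiffOn_thomasPart {S : Set (Coord n)} (hG : SmoothSymbols G S) (a b c : Fin (n + 1)) :
    ContDiffOn ℝ ∞ (fun z => thomasPart G z a b c) S :=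
  ((hG a b c).sub ((contDiffOn_symbolTrace hG a).mul contDiffOn_const)).sub
    ((contDiffOn_symbolTrace hG b).mul contDiffOn_const)

/-- The trace-free parts of symbols related by the transformation law of connections are related by
the transformation law of projective structures. -/
lemma thomasPart_transform {J : Matrix (Fin (n + 1)) (Fin (n + 1)) ℝ}
    {H : Fin (n + 1) → Fin (n + 1) → Fin (n + 1) → ℝ} {y' : Coord n}
    (hlaw : ∀ a b k, ∑ c, J k c * G y a b c = H a b k + ∑ l, ∑ m, P y' l m k * J l a * J m b) :
    ∃ Υ : Fin (n + 1) → ℝ, ∀ a b k,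
      ∑ c, J k c * (thomasPart G y a b c + Υ a * kron b c + Υ b * kron a c) =
        H a b k + ∑ l, ∑ m, thomasPart P y' l m k * J l a * J m b := by
  -- The failure of the trace of the symbols to be a one-form is exactly the projective change
  -- needed on the overlap.
  refine ⟨fun a => symbolTrace G y a - ∑ l, J l a * symbolTrace P y' l, fun a b k => ?_⟩
  have e1 : ∀ c, J k c * (thomasPart G y a b c
      + (symbolTrace G y a - ∑ l, J l a * symbolTrace P y' l) * kron b c
      + (symbolTrace G y b - ∑ l, J l b * symbolTrace P y' l) * kron a c) =
      J k c * G y a b c - (∑ l, J l a * symbolTrace P y' l) * J k c * kron b c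
        - (∑ l, J l b * symbolTrace P y' l) * J k c * kron a c := by
    intro c; rw [eq_thomasPart_add (G := G)]; ring
  have e2 : ∀ l m, thomasPart P y' l m k * J l a * J m b = P y' l m k * J l a * J m b
      - symbolTrace P y' l * J l a * J m b * kron m k
      - symbolTrace P y' m * J m b * (J l a * kron l k) := by
    intro l m; rw [eq_thomasPart_add (G := P)]; ring
  simp only [e1, e2, Finset.sum_sub_distrib, sum_kron_mul, hlaw, sum_mul_kron]
  rw [Finset.sum_comm (f := fun l m => symbolTrace P y' m * J m b * (J l a * kron l k))]
  simp only [← Finset.mul_sum, sum_mul_kron, ← Finset.sum_mul]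
  simp only [mul_comm (J _ _) (symbolTrace P y' _)]
  ring

end Thomas

/-! ### Gluing the local extensions of the projective class -/

section Extension

variable {n : ℕ} {M : Type*} [TopologicalSpace M] [ChartedSpace (EuclideanHalfSpace (n + 1)) M]
  [IsManifold (𝓡∂ (n + 1)) ∞ M]

open SmoothChart

variable {e e' : SmoothChart n M} {U : Set M} {y : Coord n} {x : M} {cov : CovOp n M}

lemma IsAffineConnectionOn.smoothSymbols (h : IsAffineConnectionOn cov U) (hU : IsOpen U) :
    SmoothSymbols (christoffel cov e) (e.dom U) := fun a b c => h.contDiffOn_christoffel hU a b c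

omit [IsManifold (𝓡∂ (n + 1)) ∞ M] in
lemma IsDefiningFunctionOn.contDiffOn {ρ : M → ℝ} (hρ : IsDefiningFunctionOn (n := n) ρ U) :
    ContDiffOn ℝ ∞ (fun z => ρ (e.point z)) (e.dom U) := by
  have h9 : ContMDiffOn 𝓘(ℝ, Coord n) (𝓡∂ (n + 1)) ∞ e.point (e.dom U) :=
    contMDiffOn_point.mono dom_subset_univ
  exact (hρ.smooth.comp h9 fun y hy => hy.2).contDiffOn

/-- The relation between the Christoffel symbols of a projectively compact connection and those of
its extension. -/
lemma christoffel_extension {ρ : M → ℝ} (hU : IsOpen U) (hρ : IsDefiningFunctionOn (n := n) ρ U)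
    {cov' : CovOp n M} {α : ℝ}
    (h : ∀ z ∈ U ∩ inner n M, ∀ (η : Π x : M, TangentSpace (𝓡∂ (n + 1)) x), VFieldDiffAt η z →
      ∀ ξ : TangentSpace (𝓡∂ (n + 1)) z,
        cov' η z ξ = cov η z ξ + (α * ρ z)⁻¹ •
          ((show ℝ from mfderiv (𝓡∂ (n + 1)) 𝓘(ℝ, ℝ) ρ z ξ) • η z
            + (show ℝ from mfderiv (𝓡∂ (n + 1)) 𝓘(ℝ, ℝ) ρ z (η z)) • ξ))
    (hy : y ∈ e.dom (U ∩ inner n M)) (a b c : Fin (n + 1)) :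
    christoffel cov' e y a b c = christoffel cov e y a b c
      + (α * ρ (e.point y))⁻¹ * pd (fun z => ρ (e.point z)) a y * kron b c
      + (α * ρ (e.point y))⁻¹ * pd (fun z => ρ (e.point z)) b y * kron a c := by
  have hx := point_mem_source hy
  have hd : MDifferentiableAt (𝓡∂ (n + 1)) 𝓘(ℝ, ℝ) ρ (e.point y) :=
    (hρ.smooth.contMDiffAt (hU.mem_nhds hy.2.1)).mdifferentiableAt (by simp)
  rw [christoffel_eq, h _ hy.2 _ (vFieldDiffAt_coordField hx b), tangentCoord_add,
    tangentCoord_smul, tangentCoord_add, tangentCoord_smul, tangentCoord_smul,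
    mfderiv_coordField (dom_subset_univ hy) hd, mfderiv_coordField (dom_subset_univ hy) hd,
    tangentCoord_coordField hx, tangentCoord_coordField hx, christoffel_eq]
  simp [kron, eq_comm]
  ring

/-- Near each point of a manifold with boundary, the projective class of a projectively compact
connection contains a connection which is smooth up to the boundary. -/
lemma exists_local_extension (hcov : IsAffineConnectionOn cov (inner n M)) {α : ℝ}
    (hcompact : IsProjectivelyCompact cov α) (x : M) :
    ∃ U : Set M, IsOpen U ∧ x ∈ U ∧ ∃ cov' : CovOp n M, IsAffineConnectionOn cov' U ∧
      ∀ e : SmoothChart n M, ∀ y ∈ e.dom (U ∩ inner n M), ∃ Υ : Fin (n + 1) → ℝ, ∀ a b c,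
        christoffel cov' e y a b c = christoffel cov e y a b c + Υ a * kron b c + Υ b * kron a c := by
  rcases (𝓡∂ (n + 1)).isInteriorPoint_or_isBoundaryPoint x with hx | hx
  · exact ⟨inner n M, isOpen_inner, hx, cov, hcov, fun e y _ => ⟨0, by simp⟩⟩
  · obtain ⟨U, hU, hxU, ρ, hρ, cov', hcov', h⟩ := hcompact x hx
    exact ⟨U, hU, hxU, cov', hcov', fun e y hy => ⟨_, fun a b c =>
      christoffel_extension hU hρ h hy a b c⟩⟩

/-- The projective class of a projectively compact connection extends to the boundary. -/
theorem exists_projectiveStructure (hcov : IsAffineConnectionOn cov (inner n M)) {α : ℝ}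
    (hcompact : IsProjectivelyCompact cov α) :
    ∃ 𝔭 : ProjectiveStructure n M, 𝔭.IsClassOf cov := by
  choose U hU hxU cov' hcov' hext using exists_local_extension hcov hcompact
  -- The extensions chosen at different points are projectively equivalent in the interior, so their
  -- trace-free parts agree up to the boundary. The choice made at each point below does therefore
  -- not affect smoothness.
  have key : ∀ (e : SmoothChart n M) (x : M), ∀ y ∈ e.dom (U x), ∀ a b c,
      thomasPart (christoffel (cov' (e.point y)) e) y a b c =
        thomasPart (christoffel (cov' x) e) y a b c := by
    intro e x y hy a b c
    have hmem : y ∈ e.dom (U (e.point y) ∩ U x) := ⟨hy.1, hxU _, hy.2⟩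
    refine eqOn_dom ((hU _).inter (hU x))
      (contDiffOn_thomasPart (((hcov' (e.point y)).mono inter_subset_left).smoothSymbols
        ((hU _).inter (hU x))) a b c).continuousOn
      (contDiffOn_thomasPart (((hcov' x).mono inter_subset_right).smoothSymbols
        ((hU _).inter (hU x))) a b c).continuousOn ?_ hmem
    intro z hz
    obtain ⟨Υ, h1⟩ := hext (e.point y) e z (dom_mono (inter_subset_inter_left _ inter_subset_left) hz)
    obtain ⟨Υ', h2⟩ := hext x e z (dom_mono (inter_subset_inter_left _ inter_subset_right) hz)
    simp only
    rw [thomasPart_congr h1, thomasPart_congr h2]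
  refine ⟨⟨fun e y => thomasPart (christoffel (cov' (e.point y)) e) y, ?_, ?_, ?_, ?_⟩, ?_⟩
  · intro e a b c y hy
    have hy' : y ∈ e.dom (U (e.point y)) := ⟨hy.1, hxU _⟩
    have h1 := contDiffOn_thomasPart (((hcov' (e.point y))).smoothSymbols (e := e) (hU _)) a b c
    have h2 := (isRelOpen_dom (hU _)).contDiffWithinAt h1 hy'
    refine (h2.congr_of_eventuallyEq ?_ rfl).mono isRelOpen_dom_univ.subset
    filter_upwards [(isRelOpen_dom (hU _)).mem_nhdsWithin y hy'] with z hz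
    exact key e _ z hz a b c
  · intro e y hy a b c
    have hy' : y ∈ e.dom (U (e.point y)) := ⟨hy.1, hxU _⟩
    simp only [thomasPart]
    rw [(hcov' (e.point y)).christoffel_symm hy']
    ring
  · intro e y hy a
    exact sum_thomasPart a
  · intro e e' y hy
    have hy' : y ∈ e.dom (U (e.point y) ∩ e'.1.source) := ⟨hy.1, hxU _, hy.2⟩
    obtain ⟨Υ, hΥ⟩ := thomasPart_transform fun a b k =>
      (hcov' (e.point y)).christoffel_transform (hU _) hy' a b k
    refine ⟨Υ, fun a b k => ?_⟩
    rw [hΥ, point_coordChange hy]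
  · intro e y hy
    obtain ⟨Υ, h1⟩ := hext (e.point y) e y ⟨hy.1, hxU _, hy.2⟩
    refine ⟨fun a => symbolTrace (christoffel cov e) y a, fun a b c => ?_⟩
    simp only
    rw [thomasPart_congr h1]
    exact eq_thomasPart_add a b c

end Extension

end ProjCompact

namespace ProjCompact
open Filter
open scoped Topology

/-! ### Extending solutions of logarithmic differential equations to the boundary -/

section LogExtension

variable {n : ℕ}

/-- The linear form with given components. -/
noncomputable def formOf (A : Fin (n + 1) → ℝ) : Coord n →L[ℝ] ℝ :=
  ∑ a, A a • (EuclideanSpace.proj a : Coord n →L[ℝ] ℝ)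

lemma contDiffOn_formOf {A : Coord n → Fin (n + 1) → ℝ} {S : Set (Coord n)}
    (hA : ∀ a, ContDiffOn ℝ ∞ (fun z => A z a) S) : ContDiffOn ℝ ∞ (fun z => formOf (A z)) S :=
  ContDiffOn.sum fun a _ => (hA a).smul contDiffOn_const

lemma fderivWithin_eq_formOf (f : Coord n → ℝ) (y : Coord n) :
    fderivWithin ℝ f (halfSpace n) y = formOf (fun a => pd f a y) := by
  ext v
  rw [fderivWithin_eq_sum_pd]
  simp [formOf, _root_.sum_apply, mul_comm]

/-- A function on the interior whose partial derivatives extend smoothly to the boundary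
extends smoothly to the boundary. -/
lemma exists_extension_of_pd {S : Set (Coord n)} (hS : IsRelOpen S) {u : Coord n → ℝ}
    {A : Coord n → Fin (n + 1) → ℝ} (hA : ∀ a, ContDiffOn ℝ ∞ (fun z => A z a) S)
    (hu : DifferentiableOn ℝ u (S ∩ {y | 0 < y 0}))
    (hpd : ∀ z ∈ S, 0 < z 0 → ∀ a, pd u a z = A z a) {y : Coord n} (hy : y ∈ S) :
    ∃ ε > 0, Metric.ball y ε ∩ halfSpace n ⊆ S ∧ ∃ v : Coord n → ℝ,
      ContDiffOn ℝ ∞ v (Metric.ball y ε ∩ halfSpace n) ∧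
      ∀ z ∈ Metric.ball y ε, 0 < z 0 → v z = u z := by
  have hL := contDiffOn_formOf hA
  -- The prescribed differential is bounded near the point. On a half ball, which is convex, this
  -- makes `u` Lipschitz.
  have hbd : ∀ᶠ z in 𝓝[halfSpace n] y, ‖formOf (A z)‖ < ‖formOf (A y)‖ + 1 := by
    have h1 : ContinuousWithinAt (fun z => ‖formOf (A z)‖) (halfSpace n) y :=
      (hS.contDiffWithinAt hL hy).continuousWithinAt.norm
    exact h1.eventually_lt_const (by linarith)
  obtain ⟨ε, hε, hsub⟩ := Metric.mem_nhdsWithin_iff.1 (Filter.inter_mem (hS.mem_nhdsWithin y hy) hbd)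
  set T := Metric.ball y ε ∩ halfSpace n with hT
  set T' := Metric.ball y ε ∩ {z : Coord n | 0 < z 0} with hT'
  have hTo : IsRelOpen T := by
    rw [hT, inter_comm]; exact isRelOpen_halfSpace.inter_isOpen Metric.isOpen_ball
  have hTT : T ∩ {z | 0 < z 0} = T' := by
    ext z; exact ⟨fun h => ⟨h.1.1, h.2⟩, fun h => ⟨⟨h.1, mem_halfSpace.2 (le_of_lt h.2)⟩, h.2⟩⟩
  have hT'T : T' ⊆ T := hTT ▸ inter_subset_left
  have hTS : T ⊆ S := fun z hz => (hsub hz).1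
  have hT'o : IsOpen T' := Metric.isOpen_ball.inter isOpen_pos
  have hconv : Convex ℝ T' := by
    refine (convex_ball y ε).inter ?_
    rw [← interior_halfSpace_eq]; exact convex_halfSpace.interior
  have hder : ∀ z ∈ T', HasFDerivAt u (formOf (A z)) z := by
    intro z hz
    have hzS := hTS (hT'T hz)
    have hnh : halfSpace n ∈ 𝓝 z :=
      mem_interior_iff_mem_nhds.1 (by rw [interior_halfSpace_eq]; exact hz.2)
    have hSn : S ∩ {y | 0 < y 0} ∈ 𝓝 z := by
      refine Filter.inter_mem ?_ (isOpen_pos.mem_nhds hz.2)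
      have := hS.mem_nhdsWithin z hzS
      rwa [nhdsWithin_eq_nhds.2 hnh] at this
    have hd : DifferentiableAt ℝ u z := (hu z ⟨hzS, hz.2⟩).differentiableAt hSn
    have h1 : fderivWithin ℝ u (halfSpace n) z = formOf (A z) := by
      rw [fderivWithin_eq_formOf]
      congr 1; ext a; exact hpd z hzS hz.2 a
    rw [← h1, fderivWithin_of_mem_nhds hnh]
    exact hd.hasFDerivAt
  -- A real Lipschitz function extends to the whole space. Only continuity of the extension is used;
  -- its values outside the half space are irrelevant.
  obtain ⟨v, hv, hvu⟩ := (hconv.lipschitzOnWith_of_nnnorm_hasFDerivWithin_le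
    (f := u) (C := ⟨‖formOf (A y)‖ + 1, by positivity⟩)
    (fun z hz => (hder z hz).hasFDerivWithinAt)
    (fun z hz => (hsub (hT'T hz)).2.le)).extend_real
  have hder' : ∀ z ∈ T', HasFDerivAt v (formOf (A z)) z := fun z hz =>
    (hder z hz).congr_of_eventuallyEq (by
      filter_upwards [hT'o.mem_nhds hz] with w hw using (hvu hw).symm)
  have hderT : ∀ z ∈ T, HasFDerivWithinAt v (formOf (A z)) T z := by
    intro z hz
    -- A continuous extension is differentiable at a boundary point where the differentials from
    -- inside have a limit. Since this limit is the given smooth form, `v` is smooth.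
    have h1 : HasFDerivWithinAt v (formOf (A z)) (closure T') z := by
      refine hasFDerivWithinAt_closure_of_tendsto_fderiv
        (fun w hw => (hder' w hw).differentiableAt.differentiableWithinAt) hconv hT'o
        (fun w _ => hv.continuous.continuousWithinAt) ?_
      have h2 : ContinuousWithinAt (fun z => formOf (A z)) T' z :=
        ((hL.mono hTS).continuousOn z hz).mono hT'T
      refine h2.tendsto.congr' ?_
      filter_upwards [self_mem_nhdsWithin] with w hw using (hder' w hw).fderiv.symm
    refine h1.mono ?_
    rw [← hTT]; exact hTo.subset_closure_pos
  refine ⟨ε, hε, hTS, v, ?_, fun z hz hz0 => (hvu ⟨hz, hz0⟩).symm⟩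
  rw [contDiffOn_infty_iff_fderivWithin hTo.uniqueDiffOn]
  refine ⟨fun z hz => (hderT z hz).differentiableWithinAt, (hL.mono hTS).congr fun z hz => ?_⟩
  exact (hderT z hz).fderivWithin (hTo.uniqueDiffOn z hz)

/-- A non-vanishing function on the interior whose logarithmic partial derivatives extend smoothly
to the boundary extends to a smooth non-vanishing function. -/
lemma exists_extension_of_log_pd {S : Set (Coord n)} (hS : IsRelOpen S) {f : Coord n → ℝ}
    {A : Coord n → Fin (n + 1) → ℝ} (hA : ∀ a, ContDiffOn ℝ ∞ (fun z => A z a) S)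
    (hf : DifferentiableOn ℝ f (S ∩ {y | 0 < y 0})) (hf0 : ∀ z ∈ S, 0 < z 0 → f z ≠ 0)
    (hpd : ∀ z ∈ S, 0 < z 0 → ∀ a, pd f a z = A z a * f z) {y : Coord n} (hy : y ∈ S) :
    ∃ T ⊆ S, IsRelOpen T ∧ y ∈ T ∧ ∃ g : Coord n → ℝ, ContDiffOn ℝ ∞ g T ∧ (∀ z ∈ T, g z ≠ 0) ∧
      ∀ z ∈ T, 0 < z 0 → g z = f z := by
  -- `Real.log` is the logarithm of the absolute value, so no sign of `f` has to be known at this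
  -- stage.
  obtain ⟨ε, hε, hsub, v, hv, hvu⟩ := exists_extension_of_pd hS (u := fun z => Real.log (f z)) hA
    (fun z hz => (hf z hz).log (hf0 z hz.1 hz.2)) (fun z hz hz0 a => by
      have hd : DifferentiableWithinAt ℝ f (halfSpace n) z := by
        refine (hf z ⟨hz, hz0⟩).mono_of_mem_nhdsWithin ?_
        exact Filter.inter_mem (hS.mem_nhdsWithin z hz)
          (mem_nhdsWithin_of_mem_nhds (isOpen_pos.mem_nhds hz0))
      rw [pd_comp_real a (Real.hasDerivAt_log (hf0 z hz hz0)) hd (hS.subset hz), hpd z hz hz0]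
      field_simp [hf0 z hz hz0]) hy
  set T := Metric.ball y ε ∩ halfSpace n with hT
  have hTo : IsRelOpen T := by
    rw [hT, inter_comm]; exact isRelOpen_halfSpace.inter_isOpen Metric.isOpen_ball
  have hyT : y ∈ T := ⟨Metric.mem_ball_self hε, hS.subset hy⟩
  set T' := Metric.ball y ε ∩ {z : Coord n | 0 < z 0} with hT'
  have hT'S : T' ⊆ S ∩ {y | 0 < y 0} := fun z hz =>
    ⟨hsub ⟨hz.1, mem_halfSpace.2 (le_of_lt hz.2)⟩, hz.2⟩
  have hconv : Convex ℝ T' := by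
    refine (convex_ball y ε).inter ?_
    rw [← interior_halfSpace_eq]; exact convex_halfSpace.interior
  have hcont : ContinuousOn f T' := hf.continuousOn.mono hT'S
  -- The open half ball is connected and `f` has no zeros there, so `f` is `exp v` or `-exp v`
  -- throughout.
  have hsign : (∀ z ∈ T', 0 < f z) ∨ ∀ z ∈ T', f z < 0 := by
    by_contra hcon
    push Not at hcon
    obtain ⟨⟨z, hz, hz0⟩, w, hw, hw0⟩ := hcon
    obtain ⟨p, hp, hp0⟩ := hconv.isPreconnected.intermediate_value hz hw hcont ⟨hz0, hw0⟩
    exact hf0 p (hT'S hp).1 (hT'S hp).2 hp0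
  have hexp : ContDiffOn ℝ ∞ (fun z => Real.exp (v z)) T := hv.exp
  rcases hsign with h | h
  · refine ⟨T, hsub, hTo, hyT, fun z => Real.exp (v z), hexp, fun z _ => (Real.exp_pos _).ne', ?_⟩
    intro z hz hz0
    simp only
    rw [hvu z hz.1 hz0, Real.exp_log (h z ⟨hz.1, hz0⟩)]
  · refine ⟨T, hsub, hTo, hyT, fun z => -Real.exp (v z), hexp.neg,
      fun z _ => neg_ne_zero.2 (Real.exp_pos _).ne', ?_⟩
    intro z hz hz0
    simp only
    rw [hvu z hz.1 hz0, ← Real.log_neg_eq_log, Real.exp_log (neg_pos.2 (h z ⟨hz.1, hz0⟩)), neg_neg]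

end LogExtension

end ProjCompact

namespace ProjCompact
open Filter
open scoped Topology

/-! ### The parallel density near the boundary -/

section DefiningDensity

variable {n : ℕ} {M : Type*} [TopologicalSpace M] [ChartedSpace (EuclideanHalfSpace (n + 1)) M]

open SmoothChart

lemma contDiffOn_of_locally {F : Type*} [NormedAddCommGroup F] [NormedSpace ℝ F] {f : Coord n → F}
    {S : Set (Coord n)} (hS : S ⊆ halfSpace n)
    (h : ∀ y ∈ S, ∃ T, IsRelOpen T ∧ y ∈ T ∧ ContDiffOn ℝ ∞ f T) : ContDiffOn ℝ ∞ f S := by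
  intro y hy
  obtain ⟨T, hT, hyT, hf⟩ := h y hy
  exact (hT.contDiffWithinAt hf hyT).mono hS

variable {e e' : SmoothChart n M} {U : Set M} {y : Coord n} {x : M}

lemma contDiffOn_abs_det_jac_rpow (r : ℝ) :
    ContDiffOn ℝ ∞ (fun z => |(jac e e' z).det| ^ r) (e.dom e'.1.source) :=
  (contDiffOn_det_jac.abs fun _ hy => det_jac_ne_zero hy).rpow_const_of_ne
    fun _ hy => abs_ne_zero.2 (det_jac_ne_zero hy)

lemma isRelOpen_preimage_coordChange {T : Set (Coord n)} (hT : IsRelOpen T) :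
    IsRelOpen (e.dom e'.1.source ∩ coordChange e e' ⁻¹' T) := by
  refine ⟨inter_subset_left.trans isRelOpen_dom_source.subset, fun y hy => ?_⟩
  refine Filter.inter_mem (isRelOpen_dom_source.mem_nhdsWithin y hy.1) ?_
  have h1 := (isRelOpen_dom_source.contDiffWithinAt
    (contDiffOn_coordChange (e := e) (e' := e')) hy.1).continuousWithinAt
  refine (tendsto_nhdsWithin_iff.2 ⟨h1, ?_⟩) (hT.mem_nhdsWithin _ hy.2)
  filter_upwards [isRelOpen_dom_source.mem_nhdsWithin y hy.1] with z hz
  exact isRelOpen_dom_source.subset (coordChange_mem hz)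

variable [IsManifold (𝓡∂ (n + 1)) ∞ M] {cov : CovOp n M}

/-- The logarithmic differential of `τ₀/ρ` is `-2/(n+2) tr Γ'`, with `Γ'` the symbols of the smooth
local extension: the singular term `(n+2) dρ/(2ρ)` of `tr Γ'` accounts precisely for division by
`ρ`. Thus `τ₀/ρ` extends without zeros. -/
lemma exists_log_extension (hcompact : IsProjectivelyCompact cov 2)
    {τ₀ : ProjDensity n M 2 (inner n M)} (hτ₀ : τ₀.NowhereZero) (hτ₀' : τ₀.IsParallel cov)
    (hx : x ∈ bdry n M) :
    ∃ U : Set M, IsOpen U ∧ x ∈ U ∧ ∃ ρ : M → ℝ, IsDefiningFunctionOn (n := n) ρ U ∧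
      ∀ e : SmoothChart n M, ∀ y ∈ e.dom U, ∃ T ⊆ e.dom U, IsRelOpen T ∧ y ∈ T ∧
        ∃ g : Coord n → ℝ, ContDiffOn ℝ ∞ g T ∧ (∀ z ∈ T, g z ≠ 0) ∧
          ∀ z ∈ T, 0 < z 0 → τ₀.coef e z = ρ (e.point z) * g z := by
  obtain ⟨U, hU, hxU, ρ, hρ, cov', hcov', h⟩ := hcompact x hx
  refine ⟨U, hU, hxU, ρ, hρ, fun e y hy => ?_⟩
  have hρ0 : ∀ z ∈ e.dom U, 0 < z 0 → ρ (e.point z) ≠ 0 := fun z hz hz0 h0 => by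
    have := (point_mem_bdry_iff hz).1 ((hρ.zero_iff _ hz.2).1 h0)
    exact hz0.ne' this
  have hin : ∀ z ∈ e.dom U, 0 < z 0 → z ∈ e.dom (U ∩ inner n M) := fun z hz hz0 => by
    rw [dom_inter_inner]; exact ⟨hz, hz0⟩
  have htd : ∀ z ∈ e.dom U, 0 < z 0 →
      DifferentiableWithinAt ℝ (τ₀.coef e) (halfSpace n) z := fun z hz hz0 =>
    (isRelOpen_dom isOpen_inner).differentiableWithinAt (τ₀.smooth e)
      (dom_mono inter_subset_right (hin z hz hz0))
  have hρd : ∀ z ∈ e.dom U, DifferentiableWithinAt ℝ (fun z => ρ (e.point z)) (halfSpace n) z :=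
    fun z hz => (isRelOpen_dom hU).differentiableWithinAt hρ.contDiffOn hz
  obtain ⟨T, hTU, hT, hyT, g, hg, hg0, hgf⟩ := exists_extension_of_log_pd (isRelOpen_dom hU)
    (f := fun z => τ₀.coef e z * (ρ (e.point z))⁻¹)
    (A := fun z a => (-2 / ((n : ℝ) + 2)) * ∑ b, christoffel cov' e z a b b)
    (fun a => contDiffOn_const.mul (ContDiffOn.sum fun b _ => hcov'.contDiffOn_christoffel hU a b b))
    (fun z hz => ((htd z hz.1 hz.2).fun_mul ((hρd z hz.1).fun_inv (hρ0 z hz.1 hz.2))).mono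
      (inter_subset_left.trans (isRelOpen_dom hU).subset))
    (fun z hz hz0 => mul_ne_zero (hτ₀ e z (dom_mono inter_subset_right (hin z hz hz0)))
      (inv_ne_zero (hρ0 z hz hz0)))
    (fun z hz hz0 a => by
      have hzH := (isRelOpen_dom hU).subset hz
      have hr := hρ0 z hz hz0
      have h1 := hτ₀' e z (dom_mono inter_subset_right (hin z hz hz0)) a
      have h2 : ∑ b, christoffel cov' e z a b b = ∑ b, christoffel cov e z a b b
          + ((n : ℝ) + 2) * ((2 * ρ (e.point z))⁻¹ * pd (fun z => ρ (e.point z)) a z) := by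
        simp only [christoffel_extension hU hρ h (hin z hz hz0), Finset.sum_add_distrib,
          sum_kron_self, sum_kron_mul]
        ring
      rw [pd_mul a (htd z hz hz0) ((hρd z hz).fun_inv hr) hzH,
        pd_comp_real a (hasDerivAt_inv hr) (hρd z hz) hzH, h2]
      have h3 : pd (τ₀.coef e) a z = -2 / ((n : ℝ) + 2) * (∑ b, christoffel cov e z a b b)
          * τ₀.coef e z := by linarith
      rw [h3]
      have := natCast_add_two_ne (n := n)
      field_simp
      ring) hy
  refine ⟨T, hTU, hT, hyT, g, hg, hg0, fun z hz hz0 => ?_⟩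
  rw [hgf z hz hz0]
  have := hρ0 z (hTU hz) hz0
  field_simp

/-- The parallel density extends by zero to a smooth density. -/
theorem exists_extends (hcompact : IsProjectivelyCompact cov 2)
    {τ₀ : ProjDensity n M 2 (inner n M)} (hτ₀ : τ₀.NowhereZero) (hτ₀' : τ₀.IsParallel cov) :
    ∃ τ : ProjDensity n M 2 univ, τ.Extends τ₀ := by
  refine ⟨⟨fun e y => if 0 < y 0 then τ₀.coef e y else 0, fun e => ?_, fun e e' y hy => ?_⟩,
    fun e y hy => ?_⟩
  · refine contDiffOn_of_locally isRelOpen_dom_univ.subset fun y hy => ?_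
    by_cases h0 : 0 < y 0
    · refine ⟨e.dom (inner n M), isRelOpen_dom isOpen_inner, by rw [dom_inner]; exact ⟨hy, h0⟩,
        (τ₀.smooth e).congr fun z hz => ?_⟩
      rw [dom_inner] at hz
      exact if_pos hz.2
    · have hb : e.point y ∈ bdry n M := by
        rw [bdry, ← ModelWithCorners.compl_interior, mem_compl_iff, point_mem_inner_iff hy]
        exact h0
      obtain ⟨U, hU, hxU, ρ, hρ, h⟩ := exists_log_extension hcompact hτ₀ hτ₀' hb
      obtain ⟨T, hTU, hT, hyT, g, hg, -, hgf⟩ := h e y ⟨hy.1, hxU⟩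
      -- Near a boundary point the extension by zero is the product `ρ g`, also on the boundary
      -- itself, where `ρ` vanishes.
      refine ⟨T, hT, hyT, ((hρ.contDiffOn.mono hTU).mul hg).congr fun z hz => ?_⟩
      by_cases hz0 : 0 < z 0
      · simp only [if_pos hz0]; exact hgf z hz hz0
      · have hzb : e.point z ∈ bdry n M := by
          rw [bdry, ← ModelWithCorners.compl_interior, mem_compl_iff, point_mem_inner_iff (hTU hz)]
          exact hz0
        simp only [if_neg hz0, (hρ.zero_iff _ (hTU hz).2).2 hzb, zero_mul]
  · rw [univ_inter] at hy
    by_cases h0 : 0 < y 0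
    · rw [if_pos h0, if_pos (coordChange_pos hy h0)]
      refine τ₀.transform e e' y ?_
      rw [inter_comm, dom_inter_inner]; exact ⟨hy, h0⟩
    · rw [if_neg h0, if_neg, mul_zero]
      intro h1
      have := coordChange_pos (coordChange_mem hy) h1
      rw [coordChange_coordChange hy] at this
      exact h0 this
  · rw [dom_inner] at hy
    exact if_pos hy.2

/-- An extension is determined by continuity, so local formulas hold for any extension and not only
for the one constructed above. -/
lemma IsRelOpen.eqOn_density_of_extends {r : ℝ} {τ : Density n M r univ}
    {τ₀ : Density n M r (inner n M)} (hτ : τ.Extends τ₀) {T : Set (Coord n)} (hT : IsRelOpen T)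
    (hTe : T ⊆ e.dom univ) {f : Coord n → ℝ} (hf : ContinuousOn f T)
    (h : ∀ z ∈ T, 0 < z 0 → τ₀.coef e z = f z) : EqOn (τ.coef e) f T := by
  refine hT.eqOn_of_eqOn_pos ((τ.smooth e).continuousOn.mono hTe) hf fun z hz => ?_
  rw [← h z hz.1 hz.2]
  exact hτ e z (by rw [dom_inner]; exact ⟨hTe hz.1, hz.2⟩)

/-- The extension of the parallel density is a defining density. -/
theorem isDefining_of_extends (hcompact : IsProjectivelyCompact cov 2)
    {τ₀ : ProjDensity n M 2 (inner n M)} (hτ₀ : τ₀.NowhereZero) (hτ₀' : τ₀.IsParallel cov)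
    {τ : ProjDensity n M 2 univ} (hτ : τ.Extends τ₀) : τ.IsDefining := by
  refine ⟨fun e y hy => ⟨fun h0 => ?_, fun hb => ?_⟩, fun x hx => ?_⟩
  · rw [bdry, ← ModelWithCorners.compl_interior, mem_compl_iff]
    intro hi
    have hyi : y ∈ e.dom (inner n M) := ⟨hy.1, hi⟩
    exact hτ₀ e y hyi (by rw [← hτ e y hyi, h0])
  · obtain ⟨U, hU, hxU, ρ, hρ, h⟩ := exists_log_extension hcompact hτ₀ hτ₀' hb
    obtain ⟨T, hTU, hT, hyT, g, hg, -, hgf⟩ := h e y ⟨hy.1, hxU⟩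
    rw [hT.eqOn_density_of_extends hτ (hTU.trans dom_subset_univ)
      ((hρ.contDiffOn.mono hTU).mul hg).continuousOn hgf hyT]
    simp only [(hρ.zero_iff _ hxU).2 hb, zero_mul]
  · obtain ⟨U, hU, hxU, ρ, hρ, h⟩ := exists_log_extension hcompact hτ₀ hτ₀' hx
    have h' : ∀ (e : SmoothChart n M) (y : Coord n), ∃ T : Set (Coord n), ∃ g : Coord n → ℝ,
        y ∈ e.dom U → (T ⊆ e.dom U ∧ IsRelOpen T ∧ y ∈ T ∧ ContDiffOn ℝ ∞ g T ∧
          (∀ z ∈ T, g z ≠ 0) ∧ ∀ z ∈ T, 0 < z 0 → τ₀.coef e z = ρ (e.point z) * g z) := by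
      intro e y
      by_cases hy : y ∈ e.dom U
      · obtain ⟨T, hTU, hT, hyT, g, hg⟩ := h e y hy
        exact ⟨T, g, fun _ => ⟨hTU, hT, hyT, hg⟩⟩
      · exact ⟨∅, 0, fun h => (hy h).elim⟩
    choose T g hTg using h'
    have hρ0 : ∀ (e : SmoothChart n M), ∀ z ∈ e.dom U, 0 < z 0 → ρ (e.point z) ≠ 0 :=
      fun e z hz hz0 h0 => hz0.ne' ((point_mem_bdry_iff hz).1 ((hρ.zero_iff _ hz.2).1 h0))
    -- Two local quotients of `τ₀` by `ρ` agree in the interior, where `ρ` can be cancelled, hence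
    -- up to the boundary. Their diagonal values `g e y y` form one smooth density.
    have key : ∀ (e : SmoothChart n M), ∀ y ∈ e.dom U, ∀ z ∈ T e y, g e z z = g e y z := by
      intro e y hy z hz
      obtain ⟨hTU, hT, hyT, hg, -, hgf⟩ := hTg e y hy
      obtain ⟨hTU', hT', hyT', hg', -, hgf'⟩ := hTg e z (hTU hz)
      refine (hT.inter hT').eqOn_of_eqOn_pos (hg'.continuousOn.mono inter_subset_right)
        (hg.continuousOn.mono inter_subset_left) (fun w hw => ?_) ⟨hz, hyT'⟩
      have := hgf w hw.1.1 hw.2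
      rw [hgf' w hw.1.2 hw.2] at this
      exact mul_left_cancel₀ (hρ0 e w (hTU hw.1.1) hw.2) this
    refine ⟨U, hU, hxU, ρ, hρ, ⟨fun e y => g e y y, fun e => ?_, fun e e' y hy => ?_⟩,
      fun e y hy => (hTg e y hy).2.2.2.2.1 y (hTg e y hy).2.2.1, fun e y hy => ?_⟩
    · refine contDiffOn_of_locally (isRelOpen_dom hU).subset fun y hy => ?_
      obtain ⟨hTU, hT, hyT, hg, -⟩ := hTg e y hy
      exact ⟨T e y, hT, hyT, hg.congr fun z hz => key e y hy z hz⟩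
    · have hyU : y ∈ e.dom U := dom_mono inter_subset_left hy
      have hys : y ∈ e.dom e'.1.source := dom_mono inter_subset_right hy
      obtain ⟨hTU, hT, hyT, hg, -, hgf⟩ := hTg e y hyU
      obtain ⟨hTU', hT', hyT', hg', -, hgf'⟩ := hTg e' _ (coordChange_mem_dom hys hyU.2)
      -- The transformation law of the quotient follows from that of `τ₀` by cancelling `ρ` in the
      -- interior; both sides are continuous.
      refine (hT.inter (isRelOpen_preimage_coordChange (e := e) (e' := e') hT')).eqOn_of_eqOn_pos
        (f := g e y) (g := fun z => |(jac e e' z).det| ^ (-2 / ((n : ℝ) + 2)) *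
          g e' (coordChange e e' y) (coordChange e e' z))
        (hg.continuousOn.mono inter_subset_left) (ContinuousOn.mul ?_ ?_) (fun w hw => ?_)
        ⟨hyT, hys, hyT'⟩
      · exact (contDiffOn_abs_det_jac_rpow _).continuousOn.mono fun z hz => hz.2.1
      · exact hg'.continuousOn.comp (contDiffOn_coordChange.continuousOn.mono fun z hz => hz.2.1)
          fun z hz => hz.2.2
      · obtain ⟨⟨hw1, hw2, hw3⟩, hw0⟩ := hw
        have h1 := hgf w hw1 hw0
        have h2 := hgf' _ hw3 (coordChange_pos hw2 hw0)
        have hwi : w ∈ e.dom (inner n M ∩ e'.1.source) := by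
          rw [inter_comm, dom_inter_inner]; exact ⟨hw2, hw0⟩
        rw [τ₀.transform e e' w hwi, h2, point_coordChange hw2] at h1
        refine mul_left_cancel₀ (hρ0 e w (hTU hw1) hw0) ?_
        rw [← h1]; ring
    · obtain ⟨hTU, hT, hyT, hg, -, hgf⟩ := hTg e y hy
      exact hT.eqOn_density_of_extends hτ (hTU.trans dom_subset_univ)
        ((hρ.contDiffOn.mono hTU).mul hg).continuousOn hgf hyT

end DefiningDensity

end ProjCompact

namespace ProjCompact
open Filter
open scoped Topology

/-! ### The splitting operator -/

section LocalSplitting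

variable {n : ℕ}

/-- The components of `L(τ)` for the density with component `t` and the trace-free symbols `P`. -/
noncomputable def splitMat (P : Coord n → Fin (n + 1) → Fin (n + 1) → Fin (n + 1) → ℝ) (t : Coord n → ℝ)
    (y : Coord n) : TMat n :=
  Matrix.fromBlocks (Matrix.of fun _ _ => t y) (Matrix.of fun _ b => 1 / 2 * pd t b y)
    (Matrix.of fun a _ => 1 / 2 * pd t a y)
    (Matrix.of fun a b => 1 / 2 * (pd (pd t b) a y - ∑ c, P y a b c * pd t c y)
      + 1 / (n : ℝ) * ricci P y a b * t y)

/-- The matrix `(1, 0; -Υ, id)`. -/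
def shearMat (Υ : Fin (n + 1) → ℝ) : TMat n :=
  Matrix.fromBlocks 1 0 (Matrix.of fun a _ => -Υ a) 1

/-- The symbols `G` are projectively equivalent to the trace-free symbols `P`, with change `Υ`, and
preserve the density of weight two with component `t`. -/
structure IsParallelScale (S : Set (Coord n))
    (G P : Coord n → Fin (n + 1) → Fin (n + 1) → Fin (n + 1) → ℝ) (Υ : Coord n → Fin (n + 1) → ℝ)
    (t : Coord n → ℝ) : Prop where
  relOpen : IsRelOpen S
  smooth_symbols : SmoothSymbols P S
  symm : ∀ y ∈ S, ∀ a b c, P y a b c = P y b a c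
  traceFree : ∀ y ∈ S, ∀ a, ∑ b, P y a b b = 0
  smooth_form : ∀ a, ContDiffOn ℝ ∞ (fun y => Υ y a) S
  symbols_eq : ∀ y ∈ S, ∀ a b c, G y a b c = P y a b c + Υ y a * kron b c + Υ y b * kron a c
  smooth_density : ContDiffOn ℝ ∞ t S
  ne_zero : ∀ y ∈ S, t y ≠ 0
  pd_density : ∀ y ∈ S, ∀ a, pd t a y = -2 * (t y * Υ y a)

namespace IsParallelScale

variable {S : Set (Coord n)} {G P : Coord n → Fin (n + 1) → Fin (n + 1) → Fin (n + 1) → ℝ}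
  {Υ : Coord n → Fin (n + 1) → ℝ} {t : Coord n → ℝ} (h : IsParallelScale S G P Υ t)
  {y : Coord n} (hy : y ∈ S)

include h hy

lemma pd_pd_density (a b : Fin (n + 1)) : pd (pd t b) a y =
    4 * t y * Υ y a * Υ y b - 2 * t y * pd (fun z => Υ z b) a y := by
  have hyH := h.relOpen.subset hy
  have ht := h.relOpen.differentiableWithinAt h.smooth_density hy
  have hΥ := h.relOpen.differentiableWithinAt (h.smooth_form b) hy
  rw [h.relOpen.pd_congr (fun z hz => h.pd_density z hz b) a hy,
    pd_const_mul a _ (ht.fun_mul hΥ) hyH, pd_mul a ht hΥ hyH, h.pd_density y hy]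
  ring

/-- `Υ` is `-1/2` times the logarithmic differential of `t`; its closedness is symmetry of the
second derivatives of `t`. -/
lemma closed (a b : Fin (n + 1)) : pd (fun z => Υ z b) a y = pd (fun z => Υ z a) b y := by
  have h1 := h.pd_pd_density hy a b
  rw [h.relOpen.pd_pd_comm b a h.smooth_density hy, h.pd_pd_density hy b a] at h1
  refine mul_left_cancel₀ (h.ne_zero y hy) ?_
  linarith

lemma ricci_eq (b d : Fin (n + 1)) : ricci G y b d = ricci P y b d
    - n * (pd (fun z => Υ z d) b y - ∑ c, P y b d c * Υ y c - Υ y b * Υ y d) :=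
  ricci_projective_change h.relOpen h.smooth_symbols h.symm h.smooth_form
    (fun _ hz => h.closed hz) h.symbols_eq hy b d

lemma ricci_isSymm : (ricci G y).IsSymm := by
  have h1 := ProjCompact.ricci_isSymm h.relOpen h.symm h.traceFree h.smooth_symbols hy
  ext b d
  rw [Matrix.transpose_apply, h.ricci_eq hy, h.ricci_eq hy, h1.apply, h.closed hy]
  simp only [h.symm y hy d b]
  ring

/-- The terms `∂Υ` and `ΠΥ` from the Hessian of `t` cancel those from the projective change of the
Ricci tensor. Of `ΥΥ`, two copies come from the Hessian and one is subtracted. -/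
lemma splitMat_bottom (hn : (n : ℝ) ≠ 0) (a b : Fin (n + 1)) :
    splitMat P t y (Sum.inr a) (Sum.inr b) =
      t y * (1 / (n : ℝ) * ricci G y a b + Υ y a * Υ y b) := by
  simp only [splitMat, Matrix.fromBlocks_apply₂₂, Matrix.of_apply, h.pd_pd_density hy,
    h.pd_density y hy, h.ricci_eq hy]
  have : ∑ c, P y a b c * (-2 * (t y * Υ y c)) = -2 * t y * ∑ c, P y a b c * Υ y c := by
    rw [Finset.mul_sum]; exact Finset.sum_congr rfl fun c _ => by ring
  rw [this]
  field_simp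
  ring

/-- `shearMat` passes from the splitting given by the chart to the one given by `∇`, in which the
middle slot of `L(τ)` is zero since `τ` is parallel. The factorization yields both the invariance of
the formula and its determinant. -/
lemma splitMat_eq (hn : (n : ℝ) ≠ 0) : splitMat P t y = t y • (shearMat (Υ y) *
    Matrix.fromBlocks 1 0 0 ((1 / (n : ℝ)) • ricci G y) * (shearMat (Υ y))ᵀ) := by
  ext (i | a) (j | b)
  · simp [splitMat, shearMat, Matrix.fromBlocks_multiply, Matrix.fromBlocks_transpose]
  · simp [splitMat, shearMat, Matrix.fromBlocks_multiply, Matrix.fromBlocks_transpose,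
      h.pd_density y hy]
  · simp [splitMat, shearMat, Matrix.fromBlocks_multiply, Matrix.fromBlocks_transpose,
      h.pd_density y hy]
  · rw [h.splitMat_bottom hy hn]
    simp [shearMat, Matrix.fromBlocks_multiply, Matrix.fromBlocks_transpose, Matrix.mul_apply,
      add_comm]

end IsParallelScale

end LocalSplitting

/-! ### Independence of `L(τ)` of the chart -/

section Splitting

variable {n : ℕ} {M : Type*} [TopologicalSpace M] [ChartedSpace (EuclideanHalfSpace (n + 1)) M]

open SmoothChart

variable {e e' : SmoothChart n M} {U : Set M} {y : Coord n} {x : M}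

/-- The components `∂_a log κ`, for `κ = |det J|^(-1/(n+2))`. -/
noncomputable def changeForm (e e' : SmoothChart n M) (y : Coord n) (a : Fin (n + 1)) : ℝ :=
  -1 / ((n : ℝ) + 2) * pd (fun z => Real.log |(jac e e' z).det|) a y

lemma contDiffOn_log_det_jac :
    ContDiffOn ℝ ∞ (fun z => Real.log |(jac e e' z).det|) (e.dom e'.1.source) := by
  simp only [Real.log_abs]
  exact contDiffOn_det_jac.log fun _ hy => det_jac_ne_zero hy

lemma contDiffOn_changeForm (a : Fin (n + 1)) :
    ContDiffOn ℝ ∞ (fun z => changeForm e e' z a) (e.dom e'.1.source) :=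
  contDiffOn_const.mul (isRelOpen_dom_source.contDiffOn_pd contDiffOn_log_det_jac a)

lemma contDiffOn_cotractorChange (i j : TIdx n) :
    ContDiffOn ℝ ∞ (fun z => cotractorChange e e' z i j) (e.dom e'.1.source) := by
  refine (contDiffOn_abs_det_jac_rpow _).mul ?_
  rcases i with i | a <;> rcases j with j | b
  · exact contDiffOn_const
  · exact contDiffOn_const
  · exact contDiffOn_changeForm a
  · exact contDiffOn_jac b a

lemma cotractorChange_eq : cotractorChange e e' y =
    |(jac e e' y).det| ^ (-1 / ((n : ℝ) + 2)) •
      Matrix.fromBlocks 1 0 (Matrix.of fun a _ => changeForm e e' y a) (jac e e' y)ᵀ := rfl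

lemma contDiffOn_splitMat {S : Set (Coord n)} (hS : IsRelOpen S)
    {P : Coord n → Fin (n + 1) → Fin (n + 1) → Fin (n + 1) → ℝ} {t : Coord n → ℝ}
    (hP : SmoothSymbols P S) (ht : ContDiffOn ℝ ∞ t S) (i j : TIdx n) :
    ContDiffOn ℝ ∞ (fun z => splitMat P t z i j) S := by
  rcases i with i | a <;> rcases j with j | b
  · exact ht
  · exact contDiffOn_const.mul (hS.contDiffOn_pd ht b)
  · exact contDiffOn_const.mul (hS.contDiffOn_pd ht a)
  · exact (contDiffOn_const.mul ((hS.contDiffOn_pd (hS.contDiffOn_pd ht b) a).sub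
      (ContDiffOn.sum fun c _ => (hP a b c).mul (hS.contDiffOn_pd ht c)))).add
      ((contDiffOn_const.mul (contDiffOn_ricci hS hP a b)).mul ht)

lemma splitMat_isSymm {S : Set (Coord n)} (hS : IsRelOpen S)
    {P : Coord n → Fin (n + 1) → Fin (n + 1) → Fin (n + 1) → ℝ} {t : Coord n → ℝ}
    (hP : SmoothSymbols P S) (hPs : ∀ y ∈ S, ∀ a b c, P y a b c = P y b a c)
    (hPt : ∀ y ∈ S, ∀ a, ∑ b, P y a b b = 0) (ht : ContDiffOn ℝ ∞ t S) (hy : y ∈ S) :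
    (splitMat P t y).IsSymm := by
  ext (i | a) (j | b)
  · rfl
  · rfl
  · rfl
  · simp only [splitMat, Matrix.transpose_apply, Matrix.fromBlocks_apply₂₂, Matrix.of_apply]
    rw [hS.pd_pd_comm b a ht hy, (ricci_isSymm hS hPs hPt hP hy).apply]
    simp only [hPs y hy b a]

variable [IsManifold (𝓡∂ (n + 1)) ∞ M] {cov : CovOp n M} {𝔭 : ProjectiveStructure n M}
  {τ₀ : ProjDensity n M 2 (inner n M)} {τ : ProjDensity n M 2 univ}

/-- The connection `cov`, its projective class and the parallel density in a chart. -/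
lemma isParallelScale (hcov : IsAffineConnectionOn cov (inner n M)) (hp : 𝔭.IsClassOf cov)
    (hτ₀ : τ₀.NowhereZero) (hτ₀' : τ₀.IsParallel cov) (hτ : τ.Extends τ₀) (e : SmoothChart n M) :
    IsParallelScale (e.dom (inner n M)) (christoffel cov e) (𝔭.thomas e)
      (symbolTrace (christoffel cov e)) (τ.coef e) := by
  have hS : IsRelOpen (e.dom (inner n M)) := isRelOpen_dom isOpen_inner
  have heq : EqOn (τ.coef e) (τ₀.coef e) (e.dom (inner n M)) := fun y hy => hτ e y hy
  refine ⟨hS, fun a b c => (𝔭.smooth e a b c).mono dom_subset_univ,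
    fun y hy => 𝔭.symm e y (dom_subset_univ hy), fun y hy => 𝔭.traceFree e y (dom_subset_univ hy),
    contDiffOn_symbolTrace (hcov.smoothSymbols isOpen_inner), fun y hy a b c => ?_,
    (τ.smooth e).mono dom_subset_univ, fun y hy => by rw [heq hy]; exact hτ₀ e y hy,
    fun y hy a => ?_⟩
  · obtain ⟨Υ, hΥ⟩ := hp e y hy
    have := symbolTrace_eq (P := 𝔭.thomas e) (𝔭.traceFree e y (dom_subset_univ hy)) hΥ
    rw [this, this, hΥ]
  · have h1 := hτ₀' e y hy a
    rw [hS.pd_congr heq a hy, heq hy, symbolTrace]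
    have := natCast_add_two_ne (n := n)
    rw [sub_eq_zero.1 h1]
    field_simp

/-- The transformation law of the one-forms defined by the parallel density. -/
lemma symbolTrace_transform (hcov : IsAffineConnectionOn cov (inner n M)) (hp : 𝔭.IsClassOf cov)
    (hτ₀ : τ₀.NowhereZero) (hτ₀' : τ₀.IsParallel cov) (hτ : τ.Extends τ₀)
    (hy : y ∈ e.dom (inner n M ∩ e'.1.source)) (a : Fin (n + 1)) :
    symbolTrace (christoffel cov e) y a = -changeForm e e' y a
      + ∑ b, jac e e' y b a * symbolTrace (christoffel cov e') (coordChange e e' y) b := by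
  have hs := isParallelScale hcov hp hτ₀ hτ₀' hτ e
  have hs' := isParallelScale hcov hp hτ₀ hτ₀' hτ e'
  have hyi : y ∈ e.dom (inner n M) := dom_mono inter_subset_left hy
  have hys : y ∈ e.dom e'.1.source := dom_mono inter_subset_right hy
  have hyi' : coordChange e e' y ∈ e'.dom (inner n M) := coordChange_mem_dom hys hyi.2
  have hyH := hs.relOpen.subset hyi
  have hS : IsRelOpen (e.dom (inner n M ∩ e'.1.source)) :=
    isRelOpen_dom (isOpen_inner.inter e'.1.open_source)
  -- `Υ` is `-1/2` times `d log τ` in each chart, so its transformation law is the logarithmic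
  -- derivative of the law for `τ`.
  have hlog : EqOn (fun z => Real.log (τ.coef e z)) (fun z => (-2 / ((n : ℝ) + 2)) *
      Real.log |(jac e e' z).det| + Real.log (τ.coef e' (coordChange e e' z)))
      (e.dom (inner n M ∩ e'.1.source)) := by
    intro z hz
    have hzs : z ∈ e.dom e'.1.source := dom_mono inter_subset_right hz
    have hzi : coordChange e e' z ∈ e'.dom (inner n M) := coordChange_mem_dom hzs hz.2.1
    have hpos : 0 < |(jac e e' z).det| := abs_pos.2 (det_jac_ne_zero hzs)
    simp only
    rw [τ.transform e e' z (by rwa [univ_inter]),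
      Real.log_mul (Real.rpow_pos_of_pos hpos _).ne' (hs'.ne_zero _ hzi), Real.log_rpow hpos]
  have hlogt : ∀ (c : SmoothChart n M), ∀ z ∈ c.dom (inner n M), ∀ b,
      pd (fun w => Real.log (τ.coef c w)) b z = -2 * symbolTrace (christoffel cov c) z b := by
    intro c z hz b
    have hc := isParallelScale hcov hp hτ₀ hτ₀' hτ c
    rw [pd_comp_real b (Real.hasDerivAt_log (hc.ne_zero z hz))
      (hc.relOpen.differentiableWithinAt hc.smooth_density hz) (hc.relOpen.subset hz),
      hc.pd_density z hz]
    have := hc.ne_zero z hz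
    field_simp
  have hd1 : DifferentiableWithinAt ℝ (fun z => Real.log |(jac e e' z).det|) (halfSpace n) y :=
    isRelOpen_dom_source.differentiableWithinAt contDiffOn_log_det_jac hys
  have hl : ContDiffOn ℝ ∞ (fun w => Real.log (τ.coef e' w)) (e'.dom (inner n M)) :=
    hs'.smooth_density.log hs'.ne_zero
  have hd2 : DifferentiableWithinAt ℝ (fun w => Real.log (τ.coef e' w)) (halfSpace n)
      (coordChange e e' y) := hs'.relOpen.differentiableWithinAt hl hyi'
  have hl' : ContDiffOn ℝ ∞ (fun z => Real.log (τ.coef e' (coordChange e e' z)))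
      (e.dom (inner n M ∩ e'.1.source)) :=
    hl.comp (contDiffOn_coordChange.mono (dom_mono inter_subset_right))
      fun z hz => coordChange_mem_dom (dom_mono inter_subset_right hz) hz.2.1
  have key := hS.pd_congr hlog a hy
  rw [hlogt e y hyi, pd_add a (hd1.const_mul _) (hS.differentiableWithinAt hl' hy) hyH,
    pd_const_mul a _ hd1 hyH, pd_comp_coordChange hys hd2] at key
  simp only [hlogt e' _ hyi', smul_eq_mul] at key
  have h2 : ∑ b, jac e e' y b a * (-2 * symbolTrace (christoffel cov e') (coordChange e e' y) b) =
      -2 * ∑ b, jac e e' y b a * symbolTrace (christoffel cov e') (coordChange e e' y) b := by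
    rw [Finset.mul_sum]; exact Finset.sum_congr rfl fun b _ => by ring
  rw [h2] at key
  rw [changeForm]
  linear_combination (-1 / 2) * key

lemma ricci_christoffel_transform (hcov : IsAffineConnectionOn cov (inner n M))
    (hy : y ∈ e.dom (inner n M ∩ e'.1.source)) :
    ricci (christoffel cov e) y =
      (jac e e' y)ᵀ * ricci (christoffel cov e') (coordChange e e' y) * jac e e' y :=
  ricci_transform isOpen_inner (hcov.smoothSymbols isOpen_inner) (hcov.smoothSymbols isOpen_inner)
    (fun _ hz a b k => hcov.christoffel_transform isOpen_inner hz a b k) hy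

omit [IsManifold (𝓡∂ (n + 1)) ∞ M] in
lemma abs_det_rpow_sq (hy : y ∈ e.dom e'.1.source) :
    |(jac e e' y).det| ^ (-2 / ((n : ℝ) + 2)) =
      |(jac e e' y).det| ^ (-1 / ((n : ℝ) + 2)) * |(jac e e' y).det| ^ (-1 / ((n : ℝ) + 2)) := by
  rw [← Real.rpow_add (abs_pos.2 (det_jac_ne_zero hy))]
  congr 1; ring

/-- By `splitMat_eq` each side is a product of three known objects. The Ricci tensor transforms as a
tensor, `τ` by the square of the factor for weight one, and the law for `Υ` says that the shear
matrices intertwine the two changes of frame. -/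
lemma splitMat_transform_inner (hn : (n : ℝ) ≠ 0) (hcov : IsAffineConnectionOn cov (inner n M))
    (hp : 𝔭.IsClassOf cov) (hτ₀ : τ₀.NowhereZero) (hτ₀' : τ₀.IsParallel cov) (hτ : τ.Extends τ₀)
    (hy : y ∈ e.dom (inner n M ∩ e'.1.source)) :
    splitMat (𝔭.thomas e) (τ.coef e) y = cotractorChange e e' y *
      splitMat (𝔭.thomas e') (τ.coef e') (coordChange e e' y) * (cotractorChange e e' y)ᵀ := by
  have hyi : y ∈ e.dom (inner n M) := dom_mono inter_subset_left hy
  have hys : y ∈ e.dom e'.1.source := dom_mono inter_subset_right hy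
  have hyi' : coordChange e e' y ∈ e'.dom (inner n M) := coordChange_mem_dom hys hyi.2
  rw [(isParallelScale hcov hp hτ₀ hτ₀' hτ e).splitMat_eq hyi hn,
    (isParallelScale hcov hp hτ₀ hτ₀' hτ e').splitMat_eq hyi' hn,
    τ.transform e e' y (by rwa [univ_inter]), abs_det_rpow_sq hys,
    ricci_christoffel_transform hcov hy, cotractorChange_eq]
  set K : TMat n := Matrix.fromBlocks 1 0 (Matrix.of fun a _ => changeForm e e' y a) (jac e e' y)ᵀ
    with hK
  set Υ := symbolTrace (christoffel cov e) y
  set Υ' := symbolTrace (christoffel cov e') (coordChange e e' y) with hΥ'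
  have h1 : shearMat Υ * Matrix.fromBlocks 1 0 0 (jac e e' y)ᵀ = K * shearMat Υ' := by
    rw [hK, shearMat, shearMat, Matrix.fromBlocks_multiply, Matrix.fromBlocks_multiply]
    congr 1
    · simp
    · simp
    · ext a i
      have := symbolTrace_transform hcov hp hτ₀ hτ₀' hτ hy a
      simp only [Matrix.mul_one, Matrix.mul_zero, Matrix.of_apply, Matrix.add_apply,
        Matrix.mul_apply, Matrix.transpose_apply, mul_neg, Finset.sum_neg_distrib]
      rw [show Υ a = _ from this, Matrix.zero_apply]
      ring
    · simp
  have h2 : Matrix.fromBlocks (1 : Matrix Unit Unit ℝ) 0 0 ((1 / (n : ℝ)) • ((jac e e' y)ᵀ *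
      ricci (christoffel cov e') (coordChange e e' y) * jac e e' y)) =
      Matrix.fromBlocks 1 0 0 (jac e e' y)ᵀ * Matrix.fromBlocks 1 0 0 ((1 / (n : ℝ)) •
        ricci (christoffel cov e') (coordChange e e' y)) *
        (Matrix.fromBlocks 1 0 0 (jac e e' y)ᵀ)ᵀ := by
    simp [Matrix.fromBlocks_multiply, Matrix.fromBlocks_transpose]
  rw [h2]
  have h3 : ∀ (A B C : TMat n), A * (B * C * Bᵀ) * Aᵀ = (A * B) * C * (A * B)ᵀ := by
    intro A B C; rw [Matrix.transpose_mul]; simp only [Matrix.mul_assoc]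
  rw [h3, h1, ← h3]
  simp only [Matrix.transpose_smul, Matrix.smul_mul, Matrix.mul_smul, smul_smul]
  congr 1; ring

/-- The section `L(τ)`. -/
noncomputable def splitting (hn : (n : ℝ) ≠ 0) (hcov : IsAffineConnectionOn cov (inner n M))
    (hp : 𝔭.IsClassOf cov) (hτ₀ : τ₀.NowhereZero) (hτ₀' : τ₀.IsParallel cov)
    (hτ : τ.Extends τ₀) : S2Cotractor n M where
  mat e := splitMat (𝔭.thomas e) (τ.coef e)
  smooth e := contDiffOn_splitMat isRelOpen_dom_univ (𝔭.smooth e) (τ.smooth e)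
  symm e _ hy := splitMat_isSymm isRelOpen_dom_univ (𝔭.smooth e) (𝔭.symm e) (𝔭.traceFree e)
    (τ.smooth e) hy
  transform e e' y hy := by
    have hc : ∀ i j, ContinuousOn (fun z => splitMat (𝔭.thomas e) (τ.coef e) z i j)
        (e.dom e'.1.source) := fun i j => (contDiffOn_splitMat isRelOpen_dom_univ (𝔭.smooth e)
          (τ.smooth e) i j).continuousOn.mono dom_subset_univ
    have hc' : ∀ i j, ContinuousOn (fun z => splitMat (𝔭.thomas e') (τ.coef e')
        (coordChange e e' z) i j) (e.dom e'.1.source) := fun i j =>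
      (contDiffOn_splitMat isRelOpen_dom_univ (𝔭.smooth e')
          (τ.smooth e') i j).continuousOn.comp contDiffOn_coordChange.continuousOn
            fun z hz => coordChange_mem_dom hz (mem_univ _)
    have hk : ∀ i j, ContinuousOn (fun z => cotractorChange e e' z i j) (e.dom e'.1.source) :=
      fun i j => (contDiffOn_cotractorChange i j).continuousOn
    ext i j
    -- The law was proved where `∇` exists; the components and the change of frame are continuous up
    -- to the boundary.
    refine eqOn_dom (f := fun z => splitMat (𝔭.thomas e) (τ.coef e) z i j)
      (g := fun z => (cotractorChange e e' z * splitMat (𝔭.thomas e') (τ.coef e')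
        (coordChange e e' z) * (cotractorChange e e' z)ᵀ) i j) e'.1.open_source (hc i j) ?_ ?_ hy
    · simp only [Matrix.mul_apply, Matrix.transpose_apply]
      exact continuousOn_finsetSum _ fun k _ =>
        (continuousOn_finsetSum _ fun l _ => (hk i l).mul (hc' l k)).mul (hk j k)
    · intro z hz
      simp only
      rw [splitMat_transform_inner hn hcov hp hτ₀ hτ₀' hτ (by rwa [inter_comm])]

end Splitting

end ProjCompact

namespace ProjCompact
open Filter
open scoped Topology

/-! ### The Kostant codifferential -/

section Codifferential

variable {n : ℕ}

lemma codiffOne_apply_inl_inl (θ : Fin (n + 1) → TMat n) :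
    codiffOne θ (Sum.inl ()) (Sum.inl ()) = 0 := by
  simp [codiffOne, covectorAct, Matrix.sum_apply]

lemma codiffOne_apply_inr_inl (θ : Fin (n + 1) → TMat n) (a : Fin (n + 1)) :
    codiffOne θ (Sum.inr a) (Sum.inl ()) = θ a (Sum.inl ()) (Sum.inl ()) := by
  simp [codiffOne, covectorAct, Matrix.sum_apply, Matrix.mul_apply, Matrix.single_apply]

lemma codiffOne_apply_inl_inr (θ : Fin (n + 1) → TMat n) (a : Fin (n + 1)) :
    codiffOne θ (Sum.inl ()) (Sum.inr a) = θ a (Sum.inl ()) (Sum.inl ()) := by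
  simp [codiffOne, covectorAct, Matrix.sum_apply, Matrix.mul_apply, Matrix.single_apply]

lemma codiffOne_apply_inr_inr (θ : Fin (n + 1) → TMat n) (a b : Fin (n + 1)) :
    codiffOne θ (Sum.inr a) (Sum.inr b) =
      θ a (Sum.inl ()) (Sum.inr b) + θ b (Sum.inr a) (Sum.inl ()) := by
  simp [codiffOne, covectorAct, Matrix.sum_apply, Matrix.mul_apply, Matrix.single_apply,
    Finset.sum_add_distrib]

/-- The codifferential moves slots down by one: the top slot of `θ` becomes the middle slot, and the
symmetrized middle slot becomes the bottom slot. The bottom slot of `θ` is unconstrained. -/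
lemma codiffOne_eq_zero_iff {θ : Fin (n + 1) → TMat n} (hθ : ∀ a, (θ a).IsSymm) :
    codiffOne θ = 0 ↔ (∀ a, θ a (Sum.inl ()) (Sum.inl ()) = 0) ∧
      ∀ a b, θ a (Sum.inr b) (Sum.inl ()) + θ b (Sum.inr a) (Sum.inl ()) = 0 := by
  constructor
  · intro h
    refine ⟨fun a => ?_, fun a b => ?_⟩
    · rw [← codiffOne_apply_inr_inl θ, h]; rfl
    · rw [← (hθ a).apply, ← codiffOne_apply_inr_inr θ, h]; rfl
  · rintro ⟨h1, h2⟩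
    ext (i | a) (j | b)
    · exact codiffOne_apply_inl_inl θ
    · rw [codiffOne_apply_inl_inr, h1]; rfl
    · rw [codiffOne_apply_inr_inl, h1]; rfl
    · rw [codiffOne_apply_inr_inr, (hθ a).apply, h2]; rfl

lemma codiffTwo_eq (Θ : Fin (n + 1) → Fin (n + 1) → TMat n) (b : Fin (n + 1)) :
    codiffTwo Θ b = codiffOne fun a => Θ a b := rfl

/-- A one-form with values in the bottom slot lies in the image of the codifferential if and only
if its total symmetrization vanishes. -/
lemma inImageCodiff_iff {θ : Fin (n + 1) → TMat n} (hθ : ∀ a, (θ a).IsSymm)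
    (h0 : ∀ a, θ a (Sum.inl ()) (Sum.inl ()) = 0) (h1 : ∀ a b, θ a (Sum.inr b) (Sum.inl ()) = 0) :
    InImageCodiff θ ↔ ∀ a b c, θ a (Sum.inr b) (Sum.inr c) + θ b (Sum.inr c) (Sum.inr a)
      + θ c (Sum.inr a) (Sum.inr b) = 0 := by
  constructor
  · rintro ⟨Θ, hs, ha, rfl⟩ a b c
    -- Skewness in the form indices makes the six terms of the cyclic sum cancel in pairs.
    have ha' : ∀ a b c, Θ a b (Sum.inr c) (Sum.inl ()) = - Θ b a (Sum.inr c) (Sum.inl ()) := by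
      intro a b c; rw [ha]; rfl
    simp only [codiffTwo_eq, codiffOne_apply_inr_inr]
    rw [← (hs b a).apply, ← (hs c b).apply, ← (hs a c).apply, ha' b a, ha' c b, ha' a c]
    ring
  · intro h
    have hs : ∀ a b c, θ a (Sum.inr b) (Sum.inr c) = θ a (Sum.inr c) (Sum.inr b) := fun a b c =>
      (hθ a).apply _ _
    -- The explicit preimage. Its codifferential is `(2θ_{bcd} - θ_{cbd} - θ_{dbc})/3`, and the
    -- vanishing symmetrization turns the last two terms into a third copy of `θ_{bcd}`.
    set u : Fin (n + 1) → Fin (n + 1) → Fin (n + 1) → ℝ := fun a b c =>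
      (θ b (Sum.inr a) (Sum.inr c) - θ a (Sum.inr b) (Sum.inr c)) / 3 with hu
    refine ⟨fun a b => Matrix.fromBlocks 0 (Matrix.of fun _ c => u a b c)
      (Matrix.of fun c _ => u a b c) 0, fun a b => ?_, fun a b => ?_, ?_⟩
    · ext (i | c) (j | d) <;> rfl
    · ext (i | c) (j | d) <;> simp [hu] <;> ring
    · ext b (i | c) (j | d)
      · rw [codiffTwo_eq, codiffOne_apply_inl_inl, h0]
      · rw [codiffTwo_eq, codiffOne_apply_inl_inr, (hθ b).apply, h1]; rfl
      · rw [codiffTwo_eq, codiffOne_apply_inr_inl, h1]; rfl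
      · rw [codiffTwo_eq, codiffOne_apply_inr_inr]
        simp only [Matrix.fromBlocks_apply₁₂, Matrix.fromBlocks_apply₂₁, Matrix.of_apply, hu]
        have h2 := h b c d
        rw [hs c d b] at h2
        rw [hs b d c, hs d b c]
        have h3 := hs d b c
        linarith

end Codifferential

/-! ### The tractor derivative of `L(τ)` -/

section TractorDerivative

variable {n : ℕ} {M : Type*} [TopologicalSpace M] [ChartedSpace (EuclideanHalfSpace (n + 1)) M]

open SmoothChart

variable {e e' : SmoothChart n M} {U : Set M} {y : Coord n} {x : M}
  {𝔭 : ProjectiveStructure n M} {h : S2Cotractor n M} {τ : ProjDensity n M 2 univ}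

lemma tractorDeriv_eq (𝔭 : ProjectiveStructure n M) (h : S2Cotractor n M) (e : SmoothChart n M)
    (y : Coord n) (a : Fin (n + 1)) : tractorDeriv 𝔭 h e y a =
      pdMat (h.mat e) a y + tractorConn 𝔭 e y a * h.mat e y
        + h.mat e y * (tractorConn 𝔭 e y a)ᵀ := rfl

lemma tractorDeriv_isSymm (hy : y ∈ e.dom univ) (a : Fin (n + 1)) :
    (tractorDeriv 𝔭 h e y a).IsSymm := by
  have hs : (h.mat e y)ᵀ = h.mat e y := h.symm e y hy
  have hp : (pdMat (h.mat e) a y)ᵀ = pdMat (h.mat e) a y := by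
    ext i j
    exact isRelOpen_dom_univ.pd_congr (fun z hz => (h.symm e z hz).apply i j) a hy
  rw [Matrix.IsSymm, tractorDeriv_eq, Matrix.transpose_add, Matrix.transpose_add,
    Matrix.transpose_mul, Matrix.transpose_mul, Matrix.transpose_transpose, hp, hs, add_assoc,
    add_assoc, add_comm (h.mat e y * _)]

lemma tractorDeriv_top (hy : y ∈ e.dom univ) (a : Fin (n + 1)) :
    tractorDeriv 𝔭 h e y a (Sum.inl ()) (Sum.inl ()) =
      pd (fun z => h.mat e z (Sum.inl ()) (Sum.inl ())) a y
        - 2 * h.mat e y (Sum.inr a) (Sum.inl ()) := by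
  have := (h.symm e y hy).apply (Sum.inr a) (Sum.inl ())
  simp [tractorDeriv, tractorConn, Matrix.mul_apply, kron, this]
  ring

lemma tractorDeriv_mid (a b : Fin (n + 1)) :
    tractorDeriv 𝔭 h e y a (Sum.inr b) (Sum.inl ()) =
      pd (fun z => h.mat e z (Sum.inr b) (Sum.inl ())) a y
        + schouten 𝔭 e y a b * h.mat e y (Sum.inl ()) (Sum.inl ())
        - ∑ c, 𝔭.thomas e y a b c * h.mat e y (Sum.inr c) (Sum.inl ())
        - h.mat e y (Sum.inr b) (Sum.inr a) := by
  simp [tractorDeriv, tractorConn, Matrix.mul_apply, kron]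
  ring

lemma tractorDeriv_bottom (a b c : Fin (n + 1)) :
    tractorDeriv 𝔭 h e y a (Sum.inr b) (Sum.inr c) =
      pd (fun z => h.mat e z (Sum.inr b) (Sum.inr c)) a y
        + schouten 𝔭 e y a b * h.mat e y (Sum.inl ()) (Sum.inr c)
        + schouten 𝔭 e y a c * h.mat e y (Sum.inr b) (Sum.inl ())
        - ∑ d, 𝔭.thomas e y a b d * h.mat e y (Sum.inr d) (Sum.inr c)
        - ∑ d, 𝔭.thomas e y a c d * h.mat e y (Sum.inr b) (Sum.inr d) := by
  simp [tractorDeriv, tractorConn, Matrix.mul_apply, mul_comm]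
  ring

lemma schouten_isSymm (hy : y ∈ e.dom univ) : (schouten 𝔭 e y).IsSymm :=
  (ricci_isSymm isRelOpen_dom_univ (𝔭.symm e) (𝔭.traceFree e) (𝔭.smooth e) hy).smul _

lemma contDiffOn_schouten (a b : Fin (n + 1)) :
    ContDiffOn ℝ ∞ (fun y => schouten 𝔭 e y a b) (e.dom univ) :=
  contDiffOn_const.mul (contDiffOn_ricci isRelOpen_dom_univ (𝔭.smooth e) a b)

lemma contDiffOn_tractorConn (a : Fin (n + 1)) (i j : TIdx n) :
    ContDiffOn ℝ ∞ (fun y => tractorConn 𝔭 e y a i j) (e.dom univ) := by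
  rcases i with i | b <;> rcases j with j | c
  · exact contDiffOn_const
  · exact contDiffOn_const
  · exact contDiffOn_schouten a b
  · exact (𝔭.smooth e a b c).neg

lemma continuousOn_tractorDeriv (a : Fin (n + 1)) (i j : TIdx n) :
    ContinuousOn (fun y => tractorDeriv 𝔭 h e y a i j) (e.dom univ) := by
  refine ContDiffOn.continuousOn (𝕜 := ℝ) (n := ∞) ?_
  simp only [tractorDeriv_eq, Matrix.add_apply, Matrix.mul_apply, Matrix.transpose_apply]
  exact ((isRelOpen_dom_univ.contDiffOn_pd (h.smooth e i j) a).add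
    (ContDiffOn.sum fun k _ => (contDiffOn_tractorConn a i k).mul (h.smooth e k j))).add
    (ContDiffOn.sum fun k _ => (h.smooth e i k).mul (contDiffOn_tractorConn a j k))

/-- The kernel condition only concerns the symmetric part of the middle slot. The skew part vanishes
as well, because the middle slot of `L(τ)` is exact and the symbols and the Schouten tensor are
symmetric. -/
lemma tractorDeriv_mid_eq_zero
    (hs : ∀ y ∈ e.dom univ, h.mat e y = splitMat (𝔭.thomas e) (τ.coef e) y)
    (hy : y ∈ e.dom univ) (a b : Fin (n + 1)) :
    tractorDeriv 𝔭 h e y a (Sum.inr b) (Sum.inl ()) = 0 := by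
  have hyH := isRelOpen_dom_univ.subset hy
  have hij : ∀ i j, EqOn (fun z => h.mat e z i j)
      (fun z => splitMat (𝔭.thomas e) (τ.coef e) z i j) (e.dom univ) := fun i j z hz => by
    simp only [hs z hz]
  rw [tractorDeriv_mid, isRelOpen_dom_univ.pd_congr (hij _ _) a hy, hs y hy]
  change pd (fun z => 1 / 2 * pd (τ.coef e) b z) a y
    + schouten 𝔭 e y a b * τ.coef e y
    - ∑ c, 𝔭.thomas e y a b c * (1 / 2 * pd (τ.coef e) c y)
    - (1 / 2 * (pd (pd (τ.coef e) a) b y - ∑ c, 𝔭.thomas e y b a c * pd (τ.coef e) c y)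
      + schouten 𝔭 e y b a * τ.coef e y) = 0
  have hd := isRelOpen_dom_univ.differentiableWithinAt
    (isRelOpen_dom_univ.contDiffOn_pd (τ.smooth e) b) hy
  have h3 : ∑ c, 𝔭.thomas e y a b c * (1 / 2 * pd (τ.coef e) c y) =
      1 / 2 * ∑ c, 𝔭.thomas e y a b c * pd (τ.coef e) c y := by
    rw [Finset.mul_sum]; exact Finset.sum_congr rfl fun c _ => by ring
  rw [pd_const_mul _ _ hd hyH, isRelOpen_dom_univ.pd_pd_comm a b (τ.smooth e) hy, h3,
    (schouten_isSymm hy).apply a b]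
  simp only [𝔭.symm e y hy b a]
  ring

/-- The characterization of `L(τ)` by its components. -/
theorem isSplitting_iff : IsSplitting 𝔭 τ h ↔
    ∀ e : SmoothChart n M, ∀ y ∈ e.dom univ, h.mat e y = splitMat (𝔭.thomas e) (τ.coef e) y := by
  constructor
  · intro hs e
    have h0 : EqOn (fun z => h.mat e z (Sum.inl ()) (Sum.inl ())) (τ.coef e) (e.dom univ) :=
      fun y hy => (hs e y hy).1
    have hc := fun y (hy : y ∈ e.dom univ) => (codiffOne_eq_zero_iff
      (fun a => tractorDeriv_isSymm (𝔭 := 𝔭) (h := h) hy a)).1 (hs e y hy).2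
    -- The condition on the top slot forces the middle slot of `h` to be half the differential of
    -- `τ`. The symmetrized middle slot then determines the bottom slot.
    have h1 : ∀ a, EqOn (fun z => h.mat e z (Sum.inr a) (Sum.inl ()))
        (fun z => 1 / 2 * pd (τ.coef e) a z) (e.dom univ) := by
      intro a y hy
      have := (hc y hy).1 a
      rw [tractorDeriv_top hy, isRelOpen_dom_univ.pd_congr h0 a hy] at this
      simp only
      linarith
    intro y hy
    have hsy := h.symm e y hy
    ext (i | a) (j | b)
    · exact h0 hy
    · rw [← hsy.apply]; exact h1 b hy
    · exact h1 a hy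
    · have h2 := (hc y hy).2 a b
      have hd := isRelOpen_dom_univ.differentiableWithinAt
        (isRelOpen_dom_univ.contDiffOn_pd (τ.smooth e) a) hy
      have hd' := isRelOpen_dom_univ.differentiableWithinAt
        (isRelOpen_dom_univ.contDiffOn_pd (τ.smooth e) b) hy
      have hyH := isRelOpen_dom_univ.subset hy
      rw [tractorDeriv_mid, tractorDeriv_mid, isRelOpen_dom_univ.pd_congr (h1 b) a hy,
        isRelOpen_dom_univ.pd_congr (h1 a) b hy, pd_const_mul _ _ hd hyH, pd_const_mul _ _ hd' hyH,
        isRelOpen_dom_univ.pd_pd_comm a b (τ.smooth e) hy, (schouten_isSymm hy).apply a b,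
        hsy.apply (Sum.inr a) (Sum.inr b), show h.mat e y (Sum.inl ()) (Sum.inl ()) = τ.coef e y from h0 hy] at h2
      simp only [𝔭.symm e y hy b a,
        fun c => show h.mat e y (Sum.inr c) (Sum.inl ()) = 1 / 2 * pd (τ.coef e) c y
          from h1 c hy] at h2
      have h3 : ∑ c, 𝔭.thomas e y a b c * (1 / 2 * pd (τ.coef e) c y) =
          1 / 2 * ∑ c, 𝔭.thomas e y a b c * pd (τ.coef e) c y := by
        rw [Finset.mul_sum]; exact Finset.sum_congr rfl fun c _ => by ring
      rw [h3] at h2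
      have h4 : schouten 𝔭 e y a b = 1 / (n : ℝ) * ricci (𝔭.thomas e) y a b := rfl
      rw [h4] at h2
      simp only [splitMat, Matrix.fromBlocks_apply₂₂, Matrix.of_apply]
      linarith
  · intro hs e
    have hij : ∀ i j, EqOn (fun z => h.mat e z i j)
        (fun z => splitMat (𝔭.thomas e) (τ.coef e) z i j) (e.dom univ) := fun i j z hz => by
      simp only [hs e z hz]
    intro y hy
    have hyH := isRelOpen_dom_univ.subset hy
    refine ⟨hij _ _ hy, (codiffOne_eq_zero_iff fun a => tractorDeriv_isSymm hy a).2
      ⟨fun a => ?_, fun a b => ?_⟩⟩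
    · rw [tractorDeriv_top hy, isRelOpen_dom_univ.pd_congr (hij _ _) a hy, hs e y hy]
      change pd (τ.coef e) a y - 2 * (1 / 2 * pd (τ.coef e) a y) = 0
      ring
    · rw [tractorDeriv_mid_eq_zero (hs e) hy, tractorDeriv_mid_eq_zero (hs e) hy, add_zero]

variable [IsManifold (𝓡∂ (n + 1)) ∞ M] {cov : CovOp n M} {τ₀ : ProjDensity n M 2 (inner n M)}

theorem exists_isSplitting (hn : (n : ℝ) ≠ 0) (hcov : IsAffineConnectionOn cov (inner n M))
    (hp : 𝔭.IsClassOf cov) (hτ₀ : τ₀.NowhereZero) (hτ₀' : τ₀.IsParallel cov) (hτ : τ.Extends τ₀) :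
    ∃ h : S2Cotractor n M, IsSplitting 𝔭 τ h :=
  ⟨splitting hn hcov hp hτ₀ hτ₀' hτ, isSplitting_iff.2 fun _ _ _ => rfl⟩

omit [IsManifold (𝓡∂ (n + 1)) ∞ M] in
lemma tractorDeriv_top_eq_zero (hs : IsSplitting 𝔭 τ h) (hy : y ∈ e.dom univ) (a : Fin (n + 1)) :
    tractorDeriv 𝔭 h e y a (Sum.inl ()) (Sum.inl ()) = 0 :=
  ((codiffOne_eq_zero_iff fun a => tractorDeriv_isSymm hy a).1 (hs e y hy).2).1 a

/-- The tractor derivative of `L(τ)` in the interior is the derivative of the Ricci tensor. -/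
lemma tractorDeriv_bottom_inner (hn : (n : ℝ) ≠ 0) (hcov : IsAffineConnectionOn cov (inner n M))
    (hp : 𝔭.IsClassOf cov) (hτ₀ : τ₀.NowhereZero) (hτ₀' : τ₀.IsParallel cov) (hτ : τ.Extends τ₀)
    (hs : IsSplitting 𝔭 τ h) (hy : y ∈ e.dom (inner n M)) (a b c : Fin (n + 1)) :
    tractorDeriv 𝔭 h e y a (Sum.inr b) (Sum.inr c) =
      1 / (n : ℝ) * τ.coef e y * covTensor cov (Ric cov) e y a b c := by
  have hsc := isParallelScale hcov hp hτ₀ hτ₀' hτ e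
  have hyu : y ∈ e.dom univ := dom_subset_univ hy
  have hyH := hsc.relOpen.subset hy
  have hmat := isSplitting_iff.1 hs e
  set t := τ.coef e with ht
  set Υ := symbolTrace (christoffel cov e) with hΥ
  have h0 : h.mat e y (Sum.inl ()) (Sum.inl ()) = t y := by rw [hmat y hyu]; rfl
  have h1 : ∀ a, h.mat e y (Sum.inr a) (Sum.inl ()) = -(t y * Υ y a) := by
    intro a
    rw [hmat y hyu]
    change 1 / 2 * pd t a y = _
    rw [hsc.pd_density y hy]; ring
  have h1' : ∀ a, h.mat e y (Sum.inl ()) (Sum.inr a) = -(t y * Υ y a) := by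
    intro a; rw [← h1, (h.symm e y hyu).apply]
  have h2 : ∀ b c, EqOn (fun z => h.mat e z (Sum.inr b) (Sum.inr c))
      (fun z => t z * (1 / (n : ℝ) * ricci (christoffel cov e) z b c + Υ z b * Υ z c))
      (e.dom (inner n M)) := by
    intro b c z hz
    simp only
    rw [hmat z (dom_subset_univ hz), hsc.splitMat_bottom hz hn]
  have h2y : ∀ b c, h.mat e y (Sum.inr b) (Sum.inr c) =
    t y * (1 / (n : ℝ) * ricci (christoffel cov e) y b c + Υ y b * Υ y c) := fun b c => h2 b c hy
  have hdt := hsc.relOpen.differentiableWithinAt hsc.smooth_density hy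
  have hdΥ := fun a => hsc.relOpen.differentiableWithinAt (hsc.smooth_form a) hy
  have hdr := hsc.relOpen.differentiableWithinAt (contDiffOn_ricci hsc.relOpen
    (hcov.smoothSymbols (e := e) isOpen_inner) b c) hy
  -- The projective change of the Ricci tensor, solved for the Schouten tensor of the scale of the
  -- chart.
  have hS : ∀ b c, schouten 𝔭 e y b c = 1 / (n : ℝ) * ricci (christoffel cov e) y b c
      + (pd (fun z => Υ z c) b y - ∑ d, 𝔭.thomas e y b c d * Υ y d - Υ y b * Υ y c) := by
    intro b c
    change 1 / (n : ℝ) * ricci (𝔭.thomas e) y b c = _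
    rw [hsc.ricci_eq hy]
    field_simp
    ring
  have e1 : ∀ b c, ∑ d, 𝔭.thomas e y a b d *
      (t y * (1 / (n : ℝ) * ricci (christoffel cov e) y d c + Υ y d * Υ y c)) =
      t y * (1 / (n : ℝ) * ∑ d, 𝔭.thomas e y a b d * ricci (christoffel cov e) y d c)
        + t y * Υ y c * ∑ d, 𝔭.thomas e y a b d * Υ y d := by
    intro b c
    simp only [Finset.mul_sum, ← Finset.sum_add_distrib]
    exact Finset.sum_congr rfl fun d _ => by ring
  have e2 : ∀ b c, ∑ d, 𝔭.thomas e y a b d *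
      (t y * (1 / (n : ℝ) * ricci (christoffel cov e) y c d + Υ y c * Υ y d)) =
      t y * (1 / (n : ℝ) * ∑ d, 𝔭.thomas e y a b d * ricci (christoffel cov e) y c d)
        + t y * Υ y c * ∑ d, 𝔭.thomas e y a b d * Υ y d := by
    intro b c
    simp only [Finset.mul_sum, ← Finset.sum_add_distrib]
    exact Finset.sum_congr rfl fun d _ => by ring
  have e3 : ∀ (b : Fin (n + 1)) (f : Fin (n + 1) → ℝ), ∑ d, christoffel cov e y a b d * f d =
      ∑ d, 𝔭.thomas e y a b d * f d + Υ y a * f b + Υ y b * f a := by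
    intro b f
    have : ∀ d, christoffel cov e y a b d * f d = 𝔭.thomas e y a b d * f d
        + Υ y a * (f d * kron b d) + Υ y b * (f d * kron a d) := fun d => by
      rw [hsc.symbols_eq y hy]; ring
    simp only [this, Finset.sum_add_distrib, ← Finset.mul_sum, sum_kron_mul]
  have hsym : ricci (christoffel cov e) y b a = ricci (christoffel cov e) y a b :=
    (hsc.ricci_isSymm hy).apply _ _
  have hpd : pd (fun z => h.mat e z (Sum.inr b) (Sum.inr c)) a y =
      -2 * (t y * Υ y a) * (1 / (n : ℝ) * ricci (christoffel cov e) y b c + Υ y b * Υ y c)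
      + t y * (1 / (n : ℝ) * pd (fun z => ricci (christoffel cov e) z b c) a y
        + (pd (fun z => Υ z b) a y * Υ y c + Υ y b * pd (fun z => Υ z c) a y)) := by
    rw [hsc.relOpen.pd_congr (h2 b c) a hy,
      pd_mul a hdt ((hdr.const_mul _).fun_add ((hdΥ b).fun_mul (hdΥ c))) hyH,
      pd_add a (hdr.const_mul _) ((hdΥ b).fun_mul (hdΥ c)) hyH, pd_const_mul a _ hdr hyH,
      pd_mul a (hdΥ b) (hdΥ c) hyH, hsc.pd_density y hy]
  rw [tractorDeriv_bottom, hpd]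
  -- After substitution every term with `Υ` or its derivatives cancels. Symmetry of the Ricci tensor
  -- is needed since the change of symbols produces `Υ_c Ric_{ba}`, whereas the Schouten terms
  -- contain `Υ_c Ric_{ab}`.
  simp only [h2y, h1, h1', hS, covTensor, Ric, e1, e2, e3, hsym]
  ring

omit [IsManifold (𝓡∂ (n + 1)) ∞ M] in
lemma inImageCodiff_tractorDeriv_iff (hs : IsSplitting 𝔭 τ h) (hy : y ∈ e.dom univ) :
    InImageCodiff (tractorDeriv 𝔭 h e y) ↔ ∀ a b c, tractorDeriv 𝔭 h e y a (Sum.inr b) (Sum.inr c)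
      + tractorDeriv 𝔭 h e y b (Sum.inr c) (Sum.inr a)
      + tractorDeriv 𝔭 h e y c (Sum.inr a) (Sum.inr b) = 0 :=
  inImageCodiff_iff (tractorDeriv_isSymm hy) (tractorDeriv_top_eq_zero hs hy)
    (tractorDeriv_mid_eq_zero (isSplitting_iff.1 hs e) hy)

omit [IsManifold (𝓡∂ (n + 1)) ∞ M] in
lemma tractorDeriv_eq_zero_iff (hs : IsSplitting 𝔭 τ h) (hy : y ∈ e.dom univ) (a : Fin (n + 1)) :
    tractorDeriv 𝔭 h e y a = 0 ↔ ∀ b c, tractorDeriv 𝔭 h e y a (Sum.inr b) (Sum.inr c) = 0 := by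
  refine ⟨fun h b c => by rw [h]; rfl, fun h => ?_⟩
  ext (i | b) (j | c)
  · exact tractorDeriv_top_eq_zero hs hy a
  · rw [← (tractorDeriv_isSymm hy a).apply]
    exact tractorDeriv_mid_eq_zero (isSplitting_iff.1 hs e) hy a c
  · exact tractorDeriv_mid_eq_zero (isSplitting_iff.1 hs e) hy a b
  · exact h b c

/-- In the interior the bottom slot of `∇L(τ)` is a non-zero multiple of `∇Ric`, so the criterion
for the image becomes a vanishing symmetrization. At the boundary only the symmetrized bottom slot,
a continuous function, has to be controlled. -/
theorem isBGGSolution_iff (hn : (n : ℝ) ≠ 0) (hcov : IsAffineConnectionOn cov (inner n M))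
    (hp : 𝔭.IsClassOf cov) (hτ₀ : τ₀.NowhereZero) (hτ₀' : τ₀.IsParallel cov) (hτ : τ.Extends τ₀) :
    IsBGGSolution 𝔭 τ ↔ IsSymParallelTensor cov (Ric cov) (inner n M) := by
  have key : ∀ h : S2Cotractor n M, IsSplitting 𝔭 τ h → ∀ e : SmoothChart n M,
      ∀ y ∈ e.dom (inner n M), ∀ a b c, covTensor cov (Ric cov) e y a b c
        = covTensor cov (Ric cov) e y a c b := by
    intro h hs e y hy a b c
    have h1 := tractorDeriv_bottom_inner hn hcov hp hτ₀ hτ₀' hτ hs hy a b c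
    rw [← (tractorDeriv_isSymm (dom_subset_univ hy) a).apply,
      tractorDeriv_bottom_inner hn hcov hp hτ₀ hτ₀' hτ hs hy a c b] at h1
    exact (mul_left_cancel₀ (mul_ne_zero (one_div_ne_zero hn)
      ((isParallelScale hcov hp hτ₀ hτ₀' hτ e).ne_zero y hy)) h1).symm
  constructor
  · rintro ⟨h, hs, him⟩ e y hy a b c
    have h1 := (inImageCodiff_tractorDeriv_iff hs (dom_subset_univ hy)).1
      (him e y (dom_subset_univ hy)) a b c
    simp only [tractorDeriv_bottom_inner hn hcov hp hτ₀ hτ₀' hτ hs hy] at h1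
    have h2 : 1 / (n : ℝ) * τ.coef e y ≠ 0 := mul_ne_zero (one_div_ne_zero hn)
      ((isParallelScale hcov hp hτ₀ hτ₀' hτ e).ne_zero y hy)
    have h3 : covTensor cov (Ric cov) e y a b c + covTensor cov (Ric cov) e y b c a
        + covTensor cov (Ric cov) e y c a b = 0 := by
      refine mul_left_cancel₀ h2 ?_
      linarith
    -- The criterion has three cyclic terms and the symmetrization of `∇Ric` has six; symmetry in
    -- the last two indices pairs them.
    rw [key h hs e y hy a c b, key h hs e y hy b a c, key h hs e y hy c b a]
    linarith
  · intro hsym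
    obtain ⟨h, hs⟩ := exists_isSplitting hn hcov hp hτ₀ hτ₀' hτ
    refine ⟨h, hs, fun e y hy => (inImageCodiff_tractorDeriv_iff hs hy).2 fun a b c => ?_⟩
    refine eqOn_dom (f := fun y => tractorDeriv 𝔭 h e y a (Sum.inr b) (Sum.inr c)
      + tractorDeriv 𝔭 h e y b (Sum.inr c) (Sum.inr a)
      + tractorDeriv 𝔭 h e y c (Sum.inr a) (Sum.inr b)) (g := fun _ => 0) isOpen_univ
      (((continuousOn_tractorDeriv a _ _).add (continuousOn_tractorDeriv b _ _)).add
        (continuousOn_tractorDeriv c _ _)) continuousOn_const (fun z hz => ?_) hy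
    rw [univ_inter] at hz
    simp only [tractorDeriv_bottom_inner hn hcov hp hτ₀ hτ₀' hτ hs hz]
    have h1 := hsym e z hz a b c
    rw [key h hs e z hz a c b, key h hs e z hz b a c, key h hs e z hz c b a] at h1
    linear_combination (1 / 2) * (1 / (n : ℝ) * τ.coef e z) * h1

theorem isParallel_iff (hn : (n : ℝ) ≠ 0) (hcov : IsAffineConnectionOn cov (inner n M))
    (hp : 𝔭.IsClassOf cov) (hτ₀ : τ₀.NowhereZero) (hτ₀' : τ₀.IsParallel cov) (hτ : τ.Extends τ₀)
    (hs : IsSplitting 𝔭 τ h) :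
    h.IsParallel 𝔭 ↔ IsParallelTensor cov (Ric cov) (inner n M) := by
  constructor
  · intro hpar e y hy a b c
    have h1 := tractorDeriv_bottom_inner hn hcov hp hτ₀ hτ₀' hτ hs hy a b c
    rw [hpar e y (dom_subset_univ hy) a] at h1
    exact (mul_eq_zero.1 h1.symm).resolve_left (mul_ne_zero (one_div_ne_zero hn)
      ((isParallelScale hcov hp hτ₀ hτ₀' hτ e).ne_zero y hy))
  · intro hpar e y hy a
    refine (tractorDeriv_eq_zero_iff hs hy a).2 fun b c => ?_
    refine eqOn_dom (f := fun y => tractorDeriv 𝔭 h e y a (Sum.inr b) (Sum.inr c))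
      (g := fun _ => 0) isOpen_univ (continuousOn_tractorDeriv a _ _) continuousOn_const
      (fun z hz => ?_) hy
    rw [univ_inter] at hz
    simp only
    rw [tractorDeriv_bottom_inner hn hcov hp hτ₀ hτ₀' hτ hs hz, hpar e z hz, mul_zero]

theorem isNormalSolution_iff (hn : (n : ℝ) ≠ 0) (hcov : IsAffineConnectionOn cov (inner n M))
    (hp : 𝔭.IsClassOf cov) (hτ₀ : τ₀.NowhereZero) (hτ₀' : τ₀.IsParallel cov) (hτ : τ.Extends τ₀) :
    IsNormalSolution 𝔭 τ ↔ IsParallelTensor cov (Ric cov) (inner n M) := by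
  refine ⟨fun ⟨h, hs, hpar⟩ => (isParallel_iff hn hcov hp hτ₀ hτ₀' hτ hs).1 hpar, fun hpar => ?_⟩
  obtain ⟨h, hs⟩ := exists_isSplitting hn hcov hp hτ₀ hτ₀' hτ
  exact ⟨h, hs, (isParallel_iff hn hcov hp hτ₀ hτ₀' hτ hs).2 hpar⟩

/-- A non-degenerate parallel Ricci tensor is an Einstein metric. -/
theorem isEinsteinOn (hcov : IsAffineConnectionOn cov (inner n M))
    (hp : 𝔭.IsClassOf cov) (hτ₀ : τ₀.NowhereZero) (hτ₀' : τ₀.IsParallel cov) (hτ : τ.Extends τ₀)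
    (hpar : IsParallelTensor cov (Ric cov) (inner n M))
    (hnd : IsNondegenerateOn (Ric cov) (inner n M)) :
    IsEinsteinOn cov (Ric cov) (inner n M) :=
  ⟨⟨fun _ b c => contDiffOn_ricci (isRelOpen_dom isOpen_inner) (hcov.smoothSymbols isOpen_inner) b c,
    fun _ _ _ hy => ricci_christoffel_transform hcov hy,
    fun e _ hy => (isParallelScale hcov hp hτ₀ hτ₀' hτ e).ricci_isSymm hy, hnd⟩,
    ⟨hcov.torsionFree, hpar⟩, 1, fun _ _ _ => (one_smul ℝ _).symm⟩

end TractorDerivative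

end ProjCompact

namespace ProjCompact
open Filter
open scoped Topology

/-! ### Signatures of symmetric matrices -/

section Signature

open QuadraticMap Matrix

variable {ι κ : Type*} [Fintype ι] [DecidableEq ι] [Fintype κ] [DecidableEq κ]
  {A B : Matrix ι ι ℝ} {p q : ℕ}

lemma toQuadraticForm'_apply (A : Matrix ι ι ℝ) (v : ι → ℝ) :
    A.toQuadraticForm' v = v ⬝ᵥ A *ᵥ v := by
  rw [Matrix.toQuadraticForm', LinearMap.BilinMap.toQuadraticMap_apply,
    Matrix.toLinearMap₂'_apply']

omit [DecidableEq ι] in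
lemma isSymm_dotProduct (hA : A.IsSymm) (v w : ι → ℝ) : v ⬝ᵥ A *ᵥ w = w ⬝ᵥ A *ᵥ v := by
  rw [dotProduct_mulVec, dotProduct_comm, ← mulVec_transpose, hA.eq]

lemma toQuadraticForm'_add (hA : A.IsSymm) (v w : ι → ℝ) : A.toQuadraticForm' (v + w) =
    A.toQuadraticForm' v + A.toQuadraticForm' w + 2 * (w ⬝ᵥ A *ᵥ v) := by
  simp only [toQuadraticForm'_apply, mulVec_add, add_dotProduct, dotProduct_add]
  rw [isSymm_dotProduct hA v w]; ring

lemma mem_radical_toQuadraticForm'_iff (hA : A.IsSymm) (v : ι → ℝ) :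
    v ∈ A.toQuadraticForm'.radical ↔ A *ᵥ v = 0 := by
  rw [mem_radical_iff']
  constructor
  · rintro ⟨h1, h2⟩
    refine dotProduct_eq_zero _ fun w => ?_
    have := h2 w
    rw [toQuadraticForm'_add hA, h1] at this
    rw [dotProduct_comm]
    linarith
  · intro h
    have h1 : A.toQuadraticForm' v = 0 := by rw [toQuadraticForm'_apply, h, dotProduct_zero]
    refine ⟨h1, fun w => ?_⟩
    rw [toQuadraticForm'_add hA, h1, h, dotProduct_zero]; ring

lemma radical_eq_bot_iff (hA : A.IsSymm) : A.toQuadraticForm'.radical = ⊥ ↔ A.det ≠ 0 := by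
  rw [Submodule.eq_bot_iff, ne_eq, ← exists_mulVec_eq_zero_iff]
  simp only [mem_radical_toQuadraticForm'_iff hA]
  push Not
  exact forall_congr' fun v => ⟨fun h h0 h1 => h0 (h h1), fun h h1 => by
    by_contra h0; exact h h0 h1⟩

/-- Non-degeneracy is traded for the dimension count `p + q = card ι`, since positive index,
negative index and radical add up to the dimension. This form of the condition combines directly
with semicontinuity and with orthogonal sums. -/
lemma hasSignature_iff : HasSignature A p q ↔ A.IsSymm ∧ sigPos A.toQuadraticForm' = p ∧
    sigNeg A.toQuadraticForm' = q ∧ p + q = Fintype.card ι := by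
  have h := QuadraticForm.sigPos_add_sigNeg_add_radical (Q := A.toQuadraticForm')
  rw [Module.finrank_fintype_fun_eq_card] at h
  constructor
  · rintro ⟨hA, hd, rfl, rfl⟩
    refine ⟨hA, rfl, rfl, ?_⟩
    rw [(radical_eq_bot_iff hA).2 hd, finrank_bot] at h
    exact h
  · rintro ⟨hA, rfl, rfl, hc⟩
    refine ⟨hA, (radical_eq_bot_iff hA).1 ?_, rfl, rfl⟩
    exact Submodule.finrank_eq_zero.1 (by omega)

lemma HasSignature.card_eq (h : HasSignature A p q) : p + q = Fintype.card ι :=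
  (hasSignature_iff.1 h).2.2.2

lemma HasSignature.unique {p' q' : ℕ} (h : HasSignature A p q) (h' : HasSignature A p' q') :
    p = p' ∧ q = q' := ⟨h.2.2.1.symm.trans h'.2.2.1, h.2.2.2.symm.trans h'.2.2.2⟩

lemma exists_hasSignature (hA : A.IsSymm) (hd : A.det ≠ 0) : ∃ p q, HasSignature A p q :=
  ⟨_, _, hA, hd, rfl, rfl⟩

lemma toQuadraticForm'_mul (B : Matrix ι ι ℝ) (g : Matrix ι ι ℝ) (v : ι → ℝ) :
    (gᵀ * B * g).toQuadraticForm' v = B.toQuadraticForm' (g *ᵥ v) := by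
  rw [toQuadraticForm'_apply, toQuadraticForm'_apply, ← mulVec_mulVec, ← mulVec_mulVec,
    dotProduct_mulVec, vecMul_transpose]

lemma HasSignature.congr {g : Matrix ι ι ℝ} (hg : IsUnit g.det) (hB : HasSignature B p q) :
    HasSignature (gᵀ * B * g) p q := by
  have he : Equivalent (gᵀ * B * g).toQuadraticForm' B.toQuadraticForm' :=
    ⟨⟨LinearEquiv.ofBijective (mulVecLin g)
      ⟨mulVec_injective_iff_isUnit.2 ((isUnit_iff_isUnit_det g).2 hg),
        mulVec_surjective_iff_isUnit.2 ((isUnit_iff_isUnit_det g).2 hg)⟩,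
      fun v => (toQuadraticForm'_mul B g v).symm⟩⟩
  obtain ⟨hs, h1, h2, hc⟩ := hasSignature_iff.1 hB
  refine hasSignature_iff.2 ⟨?_, he.sigPos_eq.trans h1, he.sigNeg_eq.trans h2, hc⟩
  rw [IsSymm, transpose_mul, transpose_mul, transpose_transpose, hs.eq, Matrix.mul_assoc]

/-! Semicontinuity -/

/-- On the unit sphere of a maximal positive definite subspace, which is compact, positivity is an
open condition on the form. The same subspace therefore serves for nearby forms. -/
lemma eventually_sigPos_le (A : Matrix ι ι ℝ) :
    ∀ᶠ B in 𝓝 A, sigPos A.toQuadraticForm' ≤ sigPos B.toQuadraticForm' := by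
  obtain ⟨V, hV, hpos⟩ := exists_finrank_eq_sigPos_and_posDef A.toQuadraticForm'
  have hK : IsCompact ((V : Set (ι → ℝ)) ∩ Metric.sphere 0 1) :=
    (isCompact_sphere _ _).inter_left V.closed_of_finiteDimensional
  have hc : Continuous fun z : Matrix ι ι ℝ × (ι → ℝ) => z.2 ⬝ᵥ z.1 *ᵥ z.2 :=
    continuous_snd.dotProduct (continuous_fst.matrix_mulVec continuous_snd)
  have h1 : ∀ᶠ B in 𝓝 A, ∀ v ∈ (V : Set (ι → ℝ)) ∩ Metric.sphere 0 1, 0 < v ⬝ᵥ B *ᵥ v := by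
    refine hK.eventually_forall_of_forall_eventually fun v hv => ?_
    refine hc.continuousAt.eventually (lt_mem_nhds ?_)
    have := hpos ⟨v, hv.1⟩ (fun h => by
      have h0 : v = 0 := congrArg Subtype.val h
      simpa [h0] using hv.2)
    rwa [QuadraticMap.restrict_apply, toQuadraticForm'_apply] at this
  filter_upwards [h1] with B hB
  rw [← hV]
  refine le_sigPos_of_posDef _ fun v hv => ?_
  have hv0 : (v : ι → ℝ) ≠ 0 := fun h => hv (Subtype.ext h)
  have hn : ‖(v : ι → ℝ)‖ ≠ 0 := norm_ne_zero_iff.2 hv0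
  have h2 := hB (‖(v : ι → ℝ)‖⁻¹ • (v : ι → ℝ)) ⟨V.smul_mem _ v.2, by
    simp [norm_smul, hn]⟩
  rw [mulVec_smul, smul_dotProduct, dotProduct_smul, smul_eq_mul, smul_eq_mul] at h2
  rw [QuadraticMap.restrict_apply, toQuadraticForm'_apply]
  have h3 : 0 < ‖(v : ι → ℝ)‖⁻¹ := inv_pos.2 (norm_pos_iff.2 hv0)
  exact pos_of_mul_pos_right (pos_of_mul_pos_right h2 h3.le) h3.le

lemma sigNeg_toQuadraticForm' (A : Matrix ι ι ℝ) :
    sigNeg A.toQuadraticForm' = sigPos (-A).toQuadraticForm' := by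
  have : -A.toQuadraticForm' = (-A).toQuadraticForm' := by
    ext v; simp [toQuadraticForm'_apply, neg_mulVec]
  rw [← sigPos_neg, this]

/-- The signature is locally constant on non-degenerate symmetric matrices. -/
lemma HasSignature.eventually (hA : HasSignature A p q) :
    ∀ᶠ B in 𝓝 A, B.IsSymm → HasSignature B p q := by
  obtain ⟨-, h1, h2, hc⟩ := hasSignature_iff.1 hA
  have hneg : ∀ᶠ B in 𝓝 A, sigNeg A.toQuadraticForm' ≤ sigNeg B.toQuadraticForm' := by
    simp only [sigNeg_toQuadraticForm']
    exact (continuous_neg.tendsto A).eventually (eventually_sigPos_le (-A))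
  filter_upwards [eventually_sigPos_le A, hneg] with B hB1 hB2 hBs
  have h := QuadraticForm.sigPos_add_sigNeg_add_radical (Q := B.toQuadraticForm')
  rw [Module.finrank_fintype_fun_eq_card] at h
  -- Neither index can drop nearby, and their sum cannot exceed the dimension, which they already
  -- exhaust at `A`.
  exact hasSignature_iff.2 ⟨hBs, by omega, by omega, hc⟩

/-! Sylvester's theorem -/

omit [DecidableEq ι] in
lemma equivalent_weightedSumSquares_of_ncard_eq {w w' : ι → ℝ} (hw : ∀ i, w i = -1 ∨ w i = 1)
    (hw' : ∀ i, w' i = -1 ∨ w' i = 1) (h : {i | 0 < w i}.ncard = {i | 0 < w' i}.ncard) :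
    Equivalent (weightedSumSquares ℝ w) (weightedSumSquares ℝ w') := by
  classical
  have hcard : Fintype.card {i // 0 < w i} = Fintype.card {i // 0 < w' i} := by
    rw [← Nat.card_eq_fintype_card, ← Nat.card_eq_fintype_card]; exact h
  let E := Fintype.equivOfCardEq hcard
  let σ : Equiv.Perm ι := E.extendSubtype
  have hσ : ∀ i, w' (σ i) = w i := by
    intro i
    by_cases hi : 0 < w i
    · have h1 : 0 < w' (σ i) := E.extendSubtype_mem i hi
      rcases hw i with h2 | h2 <;> rcases hw' (σ i) with h3 | h3 <;> linarith
    · have h1 : ¬ 0 < w' (σ i) := E.extendSubtype_not_mem i hi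
      rcases hw i with h2 | h2 <;> rcases hw' (σ i) with h3 | h3 <;> linarith
  refine ⟨⟨LinearEquiv.funCongrLeft ℝ ℝ σ.symm, fun v => ?_⟩⟩
  simp only [weightedSumSquares_apply]
  rw [← Equiv.sum_comp σ]
  exact Finset.sum_congr rfl fun i _ => by simp [LinearEquiv.funCongrLeft, hσ]

lemma exists_equivalent_weightedSumSquares (hA : HasSignature A p q) :
    ∃ w : Fin (Module.finrank ℝ (ι → ℝ)) → ℝ, (∀ i, w i = -1 ∨ w i = 1) ∧
      Equivalent A.toQuadraticForm' (weightedSumSquares ℝ w) ∧ {i | 0 < w i}.ncard = p := by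
  have hsep : (associated (R := ℝ) A.toQuadraticForm').SeparatingLeft := by
    rw [LinearMap.separatingLeft_iff_ker_eq_bot, ← radical_eq_ker_associated,
      radical_eq_bot_iff hA.1]
    exact hA.2.1
  obtain ⟨w, hw, he⟩ := QuadraticForm.equivalent_one_neg_one_weighted_sum_squared _ hsep
  exact ⟨w, hw, he, by rw [← QuadraticForm.sigPos_of_equiv_weightedSumSquares he]; exact hA.2.2.1⟩

lemma HasSignature.equivalent (hA : HasSignature A p q) (hB : HasSignature B p q) :
    Equivalent A.toQuadraticForm' B.toQuadraticForm' := by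
  obtain ⟨w, hw, he, hp⟩ := exists_equivalent_weightedSumSquares hA
  obtain ⟨w', hw', he', hp'⟩ := exists_equivalent_weightedSumSquares hB
  exact he.trans ((equivalent_weightedSumSquares_of_ncard_eq hw hw' (hp.trans hp'.symm)).trans
    he'.symm)

/-- Polarization: if the quadratic form is zero, every vector lies in its radical. -/
lemma eq_zero_of_dotProduct (hA : A.IsSymm) (h : ∀ v, v ⬝ᵥ A *ᵥ v = 0) : A = 0 := by
  have h1 : ∀ v, A *ᵥ v = 0 := fun v => (mem_radical_toQuadraticForm'_iff hA v).1 <| by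
    rw [mem_radical_iff']
    exact ⟨by rw [toQuadraticForm'_apply, h], fun w => by
      rw [toQuadraticForm'_apply, toQuadraticForm'_apply, h, h]⟩
  ext i j
  have := congrFun (h1 (Pi.single j 1)) i
  simpa using this

/-- Isometries of quadratic forms are congruences of matrices. -/
lemma eq_transpose_mul_mul (hA : A.IsSymm) (hB : B.IsSymm)
    (L : IsometryEquiv A.toQuadraticForm' B.toQuadraticForm') :
    IsUnit (LinearMap.toMatrix' (L.toLinearEquiv : (ι → ℝ) →ₗ[ℝ] (ι → ℝ))).det ∧
    A = (LinearMap.toMatrix' (L.toLinearEquiv : (ι → ℝ) →ₗ[ℝ] (ι → ℝ)))ᵀ * B *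
      LinearMap.toMatrix' (L.toLinearEquiv : (ι → ℝ) →ₗ[ℝ] (ι → ℝ)) := by
  constructor
  · rw [LinearMap.det_toMatrix']
    exact L.toLinearEquiv.isUnit_det'
  · set g := LinearMap.toMatrix' (L.toLinearEquiv : (ι → ℝ) →ₗ[ℝ] (ι → ℝ)) with hg
    rw [← sub_eq_zero]
    refine eq_zero_of_dotProduct ?_ fun v => ?_
    · rw [IsSymm, transpose_sub, transpose_mul, transpose_mul, transpose_transpose, hB.eq, hA.eq,
        Matrix.mul_assoc]
    · rw [sub_mulVec, dotProduct_sub, ← toQuadraticForm'_apply, ← toQuadraticForm'_apply,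
        toQuadraticForm'_mul, sub_eq_zero, hg, LinearMap.toMatrix'_mulVec]
      exact (L.map_app v).symm

/-! Orthogonal sums -/

variable {V V' : Type*} [AddCommGroup V] [Module ℝ V] [FiniteDimensional ℝ V] [AddCommGroup V']
  [Module ℝ V'] [FiniteDimensional ℝ V']

/-- Diagonalize both forms; the positive weights of the product are the disjoint union of those of
the factors. -/
lemma sigPos_prod (Q : QuadraticForm ℝ V) (Q' : QuadraticForm ℝ V') :
    sigPos (Q.prod Q') = sigPos Q + sigPos Q' := by
  obtain ⟨w, ⟨e⟩⟩ := Q.equivalent_weightedSumSquares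
  obtain ⟨w', ⟨e'⟩⟩ := Q'.equivalent_weightedSumSquares
  have h : Equivalent (Q.prod Q') (weightedSumSquares ℝ (Sum.elim w w')) := by
    refine ⟨(e.prod e').trans ⟨(LinearEquiv.sumArrowLequivProdArrow _ _ ℝ ℝ).symm, fun ⟨v, v'⟩ => ?_⟩⟩
    simp [weightedSumSquares_apply, Fintype.sum_sum_type]
  rw [QuadraticForm.sigPos_of_equiv_weightedSumSquares h,
    QuadraticForm.sigPos_of_equiv_weightedSumSquares ⟨e⟩,
    QuadraticForm.sigPos_of_equiv_weightedSumSquares ⟨e'⟩]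
  have hset : {i | 0 < Sum.elim w w' i} = Sum.inl '' {i | 0 < w i} ∪ Sum.inr '' {i | 0 < w' i} := by
    ext (i | i) <;> simp
  rw [hset, ncard_union_eq, ncard_image_of_injective _ Sum.inl_injective,
    ncard_image_of_injective _ Sum.inr_injective]
  rw [Set.disjoint_left]
  rintro _ ⟨i, -, rfl⟩ ⟨j, -, hj⟩
  cases hj

lemma sigNeg_prod (Q : QuadraticForm ℝ V) (Q' : QuadraticForm ℝ V') :
    sigNeg (Q.prod Q') = sigNeg Q + sigNeg Q' := by
  have : -(Q.prod Q') = (-Q).prod (-Q') := by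
    ext v; simp [add_comm]
  rw [← sigPos_neg, this, sigPos_prod, sigPos_neg, sigPos_neg]

/-- The signature of an orthogonal complement. -/
lemma HasSignature.of_prod {A' : Matrix κ κ ℝ} (hA : HasSignature A p q) (hA' : A'.IsSymm)
    {Q : QuadraticForm ℝ V} (hc : sigPos Q + sigNeg Q + Fintype.card κ = Fintype.card ι)
    (h : Equivalent A.toQuadraticForm' (Q.prod A'.toQuadraticForm')) :
    sigPos Q ≤ p ∧ sigNeg Q ≤ q ∧ HasSignature A' (p - sigPos Q) (q - sigNeg Q) := by
  obtain ⟨-, h1, h2, h3⟩ := hasSignature_iff.1 hA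
  rw [h.sigPos_eq, sigPos_prod] at h1
  rw [h.sigNeg_eq, sigNeg_prod] at h2
  exact ⟨by omega, by omega, hasSignature_iff.2 ⟨hA', by omega, by omega, by omega⟩⟩

omit [FiniteDimensional ℝ V] in
/-- A linear map which preserves a non-degenerate quadratic form is an isometry, if the dimensions
agree. -/
lemma exists_isometryEquiv {Q : QuadraticForm ℝ V} {Q' : QuadraticForm ℝ V'}
    (hQ : Q.radical = ⊥) (f : V →ₗ[ℝ] V')
    (hdim : Module.finrank ℝ V = Module.finrank ℝ V') (hf : ∀ v, Q' (f v) = Q v) :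
    ∃ e : IsometryEquiv Q Q', ∀ v, e v = f v := by
  have hinj : Function.Injective f := by
    rw [← LinearMap.ker_eq_bot, eq_bot_iff, ← hQ]
    intro v hv
    rw [LinearMap.mem_ker] at hv
    rw [mem_radical_iff']
    refine ⟨by rw [← hf, hv, QuadraticMap.map_zero], fun w => ?_⟩
    rw [← hf, map_add, hv, zero_add, hf]
  exact ⟨⟨LinearEquiv.ofInjectiveOfFinrankEq f hinj hdim, hf⟩, fun v => rfl⟩

end Signature

end ProjCompact

namespace ProjCompact
open Filter
open scoped Topology

/-! ### Orbits of the parabolic subgroup -/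

section ParabolicOrbit

open QuadraticMap Matrix

variable {n : ℕ} {A B : TMat n} {p q : ℕ}

/-- The first basis vector, which spans the canonical line. -/
def lineVec (n : ℕ) : TIdx n → ℝ := Pi.single (Sum.inl ()) 1

/-- The top slot is the value of the form on the canonical vector, which the group element only
rescales. Its vanishing and its sign are therefore orbit invariants. -/
lemma SameParabolicOrbit.apply_inl_inl (h : SameParabolicOrbit A B) :
    ∃ c : ℝ, 0 < c ∧ A (Sum.inl ()) (Sum.inl ()) = c * B (Sum.inl ()) (Sum.inl ()) := by
  obtain ⟨g, -, ⟨c, hc, hg⟩, rfl⟩ := h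
  refine ⟨c * c, mul_pos hc hc, ?_⟩
  have h1 : ∀ X : TMat n, X (Sum.inl ()) (Sum.inl ()) = X.toQuadraticForm' (lineVec n) := by
    intro X; rw [toQuadraticForm'_apply, lineVec]; simp
  rw [h1 (gᵀ * B * g), h1 B, toQuadraticForm'_mul, lineVec, hg, QuadraticMap.map_smul, smul_eq_mul]

/-- Two symmetric matrices lie in one orbit if they split off the same form, in a way compatible
with the canonical ray, and the complements have the same signature. -/
lemma sameParabolicOrbit_of_prod {κ : Type*} [Fintype κ] [DecidableEq κ] {V : Type*}
    [AddCommGroup V] [Module ℝ V] {Q : QuadraticForm ℝ V} {A' B' : Matrix κ κ ℝ} (hA : A.IsSymm)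
    (hB : B.IsSymm) (hA' : HasSignature A' p q) (hB' : HasSignature B' p q)
    (I : IsometryEquiv A.toQuadraticForm' (Q.prod A'.toQuadraticForm'))
    (K : IsometryEquiv B.toQuadraticForm' (Q.prod B'.toQuadraticForm')) {f : V} {a b : ℝ}
    (ha : 0 < a) (hb : 0 < b) (hI : I (lineVec n) = (a • f, 0)) (hK : K (lineVec n) = (b • f, 0)) :
    SameParabolicOrbit A B := by
  obtain ⟨E⟩ := hA'.equivalent hB'
  -- Compare the complements by Sylvester's theorem and leave the common factor untouched; the
  -- canonical vector is then multiplied by `a / b`, which is positive.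
  set L := (I.trans ((QuadraticMap.IsometryEquiv.refl Q).prod E)).trans K.symm with hL
  obtain ⟨h1, h2⟩ := eq_transpose_mul_mul hA hB L
  refine ⟨_, h1, ⟨a / b, div_pos ha hb, ?_⟩, h2⟩
  rw [LinearMap.toMatrix'_mulVec]
  change L (lineVec n) = (a / b) • lineVec n
  have h3 : K ((a / b) • lineVec n) = ((QuadraticMap.IsometryEquiv.refl Q).prod E) (I (lineVec n)) := by
    have : K ((a / b) • lineVec n) = (a / b) • K (lineVec n) :=
      K.toLinearEquiv.map_smul _ _
    rw [this, hK, hI]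
    have h4 : ((QuadraticMap.IsometryEquiv.refl Q).prod E) (a • f, 0) = (a • f, E 0) := rfl
    have h5 : E 0 = 0 := E.toLinearEquiv.map_zero
    rw [h4, h5, Prod.smul_mk, smul_smul, div_mul_cancel₀ _ hb.ne', smul_zero]
  have h6 : L (lineVec n) = K.symm (((QuadraticMap.IsometryEquiv.refl Q).prod E) (I (lineVec n))) := rfl
  rw [h6, ← h3]
  exact K.toLinearEquiv.symm_apply_apply _

/-- The Schur complement of the top slot. -/
noncomputable def schurMat (A : TMat n) : Matrix (Fin (n + 1)) (Fin (n + 1)) ℝ :=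
  Matrix.of fun a b => A (Sum.inr a) (Sum.inr b) -
    A (Sum.inl ()) (Sum.inr a) * A (Sum.inl ()) (Sum.inr b) / A (Sum.inl ()) (Sum.inl ())

lemma quadratic_of_blocks (hA : A.IsSymm) (v : TIdx n → ℝ) : A.toQuadraticForm' v =
    A (Sum.inl ()) (Sum.inl ()) * v (Sum.inl ()) ^ 2
      + 2 * v (Sum.inl ()) * ∑ a, A (Sum.inl ()) (Sum.inr a) * v (Sum.inr a)
      + ∑ a, ∑ b, A (Sum.inr a) (Sum.inr b) * v (Sum.inr a) * v (Sum.inr b) := by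
  have h : ∀ a, A (Sum.inr a) (Sum.inl ()) = A (Sum.inl ()) (Sum.inr a) := fun a => hA.apply _ _
  rw [toQuadraticForm'_apply]
  simp only [dotProduct, mulVec, Fintype.sum_sum_type, Finset.univ_unique, PUnit.default_eq_unit,
    Finset.sum_singleton, h, mul_add, Finset.sum_add_distrib, Finset.mul_sum]
  have e1 : ∀ a, v (Sum.inr a) * (A (Sum.inl ()) (Sum.inr a) * v (Sum.inl ())) =
      v (Sum.inl ()) * (A (Sum.inl ()) (Sum.inr a) * v (Sum.inr a)) := fun a => by ring
  have e2 : ∀ a, 2 * v (Sum.inl ()) * (A (Sum.inl ()) (Sum.inr a) * v (Sum.inr a)) =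
      v (Sum.inl ()) * (A (Sum.inl ()) (Sum.inr a) * v (Sum.inr a)) +
      v (Sum.inl ()) * (A (Sum.inl ()) (Sum.inr a) * v (Sum.inr a)) := fun a => by ring
  have e3 : ∀ a b, v (Sum.inr a) * (A (Sum.inr a) (Sum.inr b) * v (Sum.inr b)) =
      A (Sum.inr a) (Sum.inr b) * v (Sum.inr a) * v (Sum.inr b) := fun a b => by ring
  simp only [e1, e2, e3, Finset.sum_add_distrib]
  ring

/-- Completing the square in the canonical direction leaves the Schur complement. The factor `√(sα)`
normalizes the square of the canonical vector to the sign `s`, and that vector goes to a positive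
multiple of a fixed one. -/
lemma exists_isometry_schurMat (hA : HasSignature A p q) {s : ℝ}
    (hs : 0 < s * A (Sum.inl ()) (Sum.inl ())) (hs1 : s = 1 ∨ s = -1) :
    ∃ I : IsometryEquiv A.toQuadraticForm'
      ((weightedSumSquares ℝ fun _ : Unit => s).prod (schurMat A).toQuadraticForm'),
      ∃ a : ℝ, 0 < a ∧ I (lineVec n) = (a • fun _ => 1, 0) := by
  set α := A (Sum.inl ()) (Sum.inl ()) with hα
  have hss : s * s = 1 := by rcases hs1 with rfl | rfl <;> norm_num
  set r := Real.sqrt (s * α) with hr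
  have hr2 : r * r = s * α := Real.mul_self_sqrt hs.le
  have hr0 : 0 < r := Real.sqrt_pos.2 hs
  have hα0 : α ≠ 0 := fun h => by simp [h] at hs
  let f1 : (TIdx n → ℝ) →ₗ[ℝ] (Unit → ℝ) := LinearMap.pi fun _ =>
    r • (LinearMap.proj (Sum.inl ()) + ∑ a : Fin (n + 1), (A (Sum.inl ()) (Sum.inr a) / α) •
      LinearMap.proj (R := ℝ) (φ := fun _ : TIdx n => ℝ) (Sum.inr a))
  let f2 : (TIdx n → ℝ) →ₗ[ℝ] (Fin (n + 1) → ℝ) := LinearMap.pi fun a => LinearMap.proj (Sum.inr a)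
  have hf1 : ∀ v i, f1 v i = r * (v (Sum.inl ())
      + ∑ a, A (Sum.inl ()) (Sum.inr a) / α * v (Sum.inr a)) := by
    intro v i
    simp [f1, mul_add]
  obtain ⟨I, hI⟩ := exists_isometryEquiv
    (Q' := (weightedSumSquares ℝ fun _ : Unit => s).prod (schurMat A).toQuadraticForm')
    ((radical_eq_bot_iff hA.1).2 hA.2.1) (f1.prod f2)
    (by simp) (fun v => by
      have h1 : (schurMat A).toQuadraticForm' (f2 v) =
          ∑ a, ∑ b, A (Sum.inr a) (Sum.inr b) * v (Sum.inr a) * v (Sum.inr b)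
          - (∑ a, A (Sum.inl ()) (Sum.inr a) * v (Sum.inr a)) ^ 2 / α := by
        rw [toQuadraticForm'_apply, _root_.sq, Finset.sum_mul_sum, Finset.sum_div,
          ← Finset.sum_sub_distrib, dotProduct]
        refine Finset.sum_congr rfl fun a _ => ?_
        rw [mulVec, dotProduct, Finset.mul_sum, Finset.sum_div, ← Finset.sum_sub_distrib]
        refine Finset.sum_congr rfl fun b _ => ?_
        change v (Sum.inr a) * (schurMat A a b * v (Sum.inr b)) = _
        rw [schurMat, Matrix.of_apply]
        ring
      have h2 : ∑ a, A (Sum.inl ()) (Sum.inr a) / α * v (Sum.inr a) =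
          (∑ a, A (Sum.inl ()) (Sum.inr a) * v (Sum.inr a)) / α := by
        rw [Finset.sum_div]; exact Finset.sum_congr rfl fun a _ => by ring
      rw [quadratic_of_blocks hA.1]
      change (QuadraticMap.prod _ _) (f1 v, f2 v) = _
      simp only [QuadraticMap.prod_apply, h1,
        weightedSumSquares_apply, hf1, h2, Finset.univ_unique, Finset.sum_singleton, smul_eq_mul]
      set σ := ∑ a, A (Sum.inl ()) (Sum.inr a) * v (Sum.inr a)
      have h3 : s * (r * (v (Sum.inl ()) + σ / α) * (r * (v (Sum.inl ()) + σ / α))) =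
          (s * s) * α * (v (Sum.inl ()) + σ / α) ^ 2 := by
        linear_combination s * (v (Sum.inl ()) + σ / α) ^ 2 * hr2
      rw [h3, hss, ← hα]
      field_simp
      ring)
  refine ⟨I, r, hr0, ?_⟩
  rw [hI]
  refine Prod.ext ?_ ?_
  · ext i
    simp [hf1, lineVec]
  · ext a
    simp [f2, lineVec]

lemma schurMat_isSymm (hA : A.IsSymm) : (schurMat A).IsSymm := by
  ext a b
  simp only [schurMat, Matrix.transpose_apply, Matrix.of_apply]
  rw [hA.apply (Sum.inr a) (Sum.inr b)]
  ring

lemma sig_unit {s : ℝ} (hs1 : s = 1 ∨ s = -1) :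
    sigPos (weightedSumSquares ℝ fun _ : Unit => s) +
      sigNeg (weightedSumSquares ℝ fun _ : Unit => s) = 1 := by
  rw [QuadraticForm.sigPos_weightedSumSquares, QuadraticForm.sigNeg_weightedSumSquares]
  rcases hs1 with rfl | rfl <;> norm_num

/-- Away from the zero locus of the top slot, the signature and the sign of the top slot determine
the orbit. -/
lemma sameParabolicOrbit_of_ne_zero (hA : HasSignature A p q) (hB : HasSignature B p q) {s : ℝ}
    (hs1 : s = 1 ∨ s = -1) (hsA : 0 < s * A (Sum.inl ()) (Sum.inl ()))
    (hsB : 0 < s * B (Sum.inl ()) (Sum.inl ())) : SameParabolicOrbit A B := by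
  obtain ⟨I, a, ha, hI⟩ := exists_isometry_schurMat hA hsA hs1
  obtain ⟨K, b, hb, hK⟩ := exists_isometry_schurMat hB hsB hs1
  have hc : sigPos (weightedSumSquares ℝ fun _ : Unit => s) +
      sigNeg (weightedSumSquares ℝ fun _ : Unit => s) + Fintype.card (Fin (n + 1)) =
        Fintype.card (TIdx n) := by
    rw [sig_unit hs1]; simp
  exact sameParabolicOrbit_of_prod hA.1 hB.1 (hA.of_prod (schurMat_isSymm hA.1) hc ⟨I⟩).2.2
    (hB.of_prod (schurMat_isSymm hB.1) hc ⟨K⟩).2.2 I K ha hb hI hK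

/-- The bottom slot, restricted to the hyperplane on which the first coordinate vanishes. -/
def tangentMat (A : TMat n) : Matrix (Fin n) (Fin n) ℝ :=
  A.submatrix (fun i => Sum.inr i.succ) (fun i => Sum.inr i.succ)

lemma tangentMat_isSymm (hA : A.IsSymm) : (tangentMat A).IsSymm := hA.submatrix _

lemma quadratic_of_isotropic (hA : A.IsSymm) (h0 : A (Sum.inl ()) (Sum.inl ()) = 0)
    (hi : ∀ i : Fin n, A (Sum.inl ()) (Sum.inr i.succ) = 0) (v : TIdx n → ℝ) :
    A.toQuadraticForm' v = v (Sum.inr 0) *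
      (2 * A (Sum.inl ()) (Sum.inr 0) * v (Sum.inl ()) + A (Sum.inr 0) (Sum.inr 0) * v (Sum.inr 0)
        + 2 * ∑ i : Fin n, A (Sum.inr 0) (Sum.inr i.succ) * v (Sum.inr i.succ))
      + (tangentMat A).toQuadraticForm' (fun i => v (Sum.inr i.succ)) := by
  have h : ∀ i : Fin n, A (Sum.inr i.succ) (Sum.inr 0) = A (Sum.inr 0) (Sum.inr i.succ) :=
    fun i => hA.apply _ _
  rw [quadratic_of_blocks hA, h0]
  simp only [Fin.sum_univ_succ, hi, h, Finset.sum_add_distrib, zero_mul, Finset.sum_const_zero]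
  have e1 : ∑ i : Fin n, A (Sum.inr 0) (Sum.inr i.succ) * v (Sum.inr 0) * v (Sum.inr i.succ) =
      v (Sum.inr 0) * ∑ i : Fin n, A (Sum.inr 0) (Sum.inr i.succ) * v (Sum.inr i.succ) := by
    rw [Finset.mul_sum]; exact Finset.sum_congr rfl fun i _ => by ring
  have e2 : ∑ i : Fin n, A (Sum.inr 0) (Sum.inr i.succ) * v (Sum.inr i.succ) * v (Sum.inr 0) =
      v (Sum.inr 0) * ∑ i : Fin n, A (Sum.inr 0) (Sum.inr i.succ) * v (Sum.inr i.succ) := by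
    rw [Finset.mul_sum]; exact Finset.sum_congr rfl fun i _ => by ring
  have e3 : (tangentMat A).toQuadraticForm' (fun i => v (Sum.inr i.succ)) =
      ∑ i : Fin n, ∑ j : Fin n,
        A (Sum.inr i.succ) (Sum.inr j.succ) * v (Sum.inr i.succ) * v (Sum.inr j.succ) := by
    rw [toQuadraticForm'_apply, dotProduct]
    refine Finset.sum_congr rfl fun i _ => ?_
    rw [mulVec, dotProduct, Finset.mul_sum]
    refine Finset.sum_congr rfl fun j _ => ?_
    change v (Sum.inr i.succ) * (A (Sum.inr i.succ) (Sum.inr j.succ) * v (Sum.inr j.succ)) = _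
    ring
  rw [e1, e2, e3]
  ring

/-- The hyperbolic plane, diagonalized. -/
noncomputable def hyperbolicForm : QuadraticForm ℝ (Bool → ℝ) :=
  weightedSumSquares ℝ fun b : Bool => if b then (1 / 2 : ℝ) else -1 / 2

lemma hyperbolicForm_apply (v : Bool → ℝ) :
    hyperbolicForm v = (v true ^ 2 - v false ^ 2) / 2 := by
  simp [hyperbolicForm, weightedSumSquares_apply]; ring

lemma sigPos_hyperbolicForm : sigPos hyperbolicForm = 1 := by
  rw [hyperbolicForm, QuadraticForm.sigPos_weightedSumSquares]
  have : {i : Bool | (0 : ℝ) < if i then (1 / 2 : ℝ) else -1 / 2} = {true} := by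
    ext (_ | _) <;> norm_num
  rw [this, ncard_singleton]

lemma sigNeg_hyperbolicForm : sigNeg hyperbolicForm = 1 := by
  rw [hyperbolicForm, QuadraticForm.sigNeg_weightedSumSquares]
  have : {i : Bool | (if i then (1 / 2 : ℝ) else -1 / 2) < 0} = {false} := by
    ext (_ | _) <;> norm_num
  rw [this, ncard_singleton]

/-- Write `v₀` for the normal coordinate. The form is `v₀` times a linear form plus the form on
tangential coordinates, and `2 s v₀ u = ((u + s v₀)² - (u - s v₀)²)/2` diagonalizes the hyperbolic
part. -/
lemma exists_isometry_tangentMat (hA : HasSignature A p q)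
    (h0 : A (Sum.inl ()) (Sum.inl ()) = 0)
    (hi : ∀ i : Fin n, A (Sum.inl ()) (Sum.inr i.succ) = 0)
    (hν : A (Sum.inl ()) (Sum.inr 0) ≠ 0) :
    ∃ I : IsometryEquiv A.toQuadraticForm' (hyperbolicForm.prod (tangentMat A).toQuadraticForm'),
      ∃ a : ℝ, 0 < a ∧ I (lineVec n) = (a • fun _ => 1, 0) := by
  set ν := A (Sum.inl ()) (Sum.inr 0) with hνdef
  -- The sign of `ν` is absorbed so that the canonical vector maps to a positive multiple of `(1,
  -- 1)`; as a consequence the sign of `ν` does not distinguish orbits.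
  obtain ⟨s, hss, hsν⟩ : ∃ s : ℝ, s * s = 1 ∧ 0 < s * ν := by
    rcases lt_or_gt_of_ne hν with h | h
    · exact ⟨-1, by norm_num, by linarith⟩
    · exact ⟨1, by norm_num, by linarith⟩
  let P : TIdx n → (TIdx n → ℝ) →ₗ[ℝ] ℝ := fun i => LinearMap.proj i
  let u : (TIdx n → ℝ) →ₗ[ℝ] ℝ := (s * ν) • P (Sum.inl ())
    + (s * A (Sum.inr 0) (Sum.inr 0) / 2) • P (Sum.inr 0)
    + s • ∑ i : Fin n, A (Sum.inr 0) (Sum.inr i.succ) • P (Sum.inr i.succ)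
  let f1 : (TIdx n → ℝ) →ₗ[ℝ] (Bool → ℝ) := LinearMap.pi fun b =>
    if b then u + s • P (Sum.inr 0) else u - s • P (Sum.inr 0)
  let f2 : (TIdx n → ℝ) →ₗ[ℝ] (Fin n → ℝ) := LinearMap.pi fun i => P (Sum.inr i.succ)
  have hu : ∀ v, u v = s * ν * v (Sum.inl ()) + s * A (Sum.inr 0) (Sum.inr 0) / 2 * v (Sum.inr 0)
      + s * ∑ i : Fin n, A (Sum.inr 0) (Sum.inr i.succ) * v (Sum.inr i.succ) := by
    intro v; simp [u, P]
  have ht : ∀ v, f1 v true = u v + s * v (Sum.inr 0) := fun v => by simp [f1, P]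
  have hf : ∀ v, f1 v false = u v - s * v (Sum.inr 0) := fun v => by simp [f1, P]
  obtain ⟨I, hI⟩ := exists_isometryEquiv
    (Q' := hyperbolicForm.prod (tangentMat A).toQuadraticForm')
    ((radical_eq_bot_iff hA.1).2 hA.2.1) (f1.prod f2)
    (by simp; ring) (fun v => by
      rw [quadratic_of_isotropic hA.1 h0 hi]
      change (QuadraticMap.prod _ _) (f1 v, f2 v) = _
      simp only [QuadraticMap.prod_apply, hyperbolicForm_apply, ht, hf, hu]
      have h2 : f2 v = fun i => v (Sum.inr i.succ) := rfl
      rw [h2, add_left_inj, ← hνdef]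
      set σ := ∑ i : Fin n, A (Sum.inr 0) (Sum.inr i.succ) * v (Sum.inr i.succ)
      linear_combination v (Sum.inr 0) * (2 * ν * v (Sum.inl ())
        + A (Sum.inr 0) (Sum.inr 0) * v (Sum.inr 0) + 2 * σ) * hss)
  refine ⟨I, s * ν, hsν, ?_⟩
  rw [hI]
  refine Prod.ext ?_ ?_
  · ext (_ | _) <;> simp [ht, hf, hu, lineVec]
  · ext i
    simp [f2, P, lineVec]

/-- The signature of the form induced on the quotient of the orthocomplement of an isotropic
line. -/
lemma HasSignature.tangentMat (hA : HasSignature A p q)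
    (h0 : A (Sum.inl ()) (Sum.inl ()) = 0)
    (hi : ∀ i : Fin n, A (Sum.inl ()) (Sum.inr i.succ) = 0)
    (hν : A (Sum.inl ()) (Sum.inr 0) ≠ 0) :
    1 ≤ p ∧ 1 ≤ q ∧ HasSignature (tangentMat A) (p - 1) (q - 1) := by
  obtain ⟨I, -⟩ := exists_isometry_tangentMat hA h0 hi hν
  have := hA.of_prod (tangentMat_isSymm hA.1) (Q := hyperbolicForm)
    (by rw [sigPos_hyperbolicForm, sigNeg_hyperbolicForm]; simp; ring) ⟨I⟩
  rwa [sigPos_hyperbolicForm, sigNeg_hyperbolicForm] at this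

lemma sameParabolicOrbit_of_isotropic (hA : HasSignature A p q) (hB : HasSignature B p q)
    (hA0 : A (Sum.inl ()) (Sum.inl ()) = 0)
    (hAi : ∀ i : Fin n, A (Sum.inl ()) (Sum.inr i.succ) = 0)
    (hAν : A (Sum.inl ()) (Sum.inr 0) ≠ 0) (hB0 : B (Sum.inl ()) (Sum.inl ()) = 0)
    (hBi : ∀ i : Fin n, B (Sum.inl ()) (Sum.inr i.succ) = 0)
    (hBν : B (Sum.inl ()) (Sum.inr 0) ≠ 0) : SameParabolicOrbit A B := by
  obtain ⟨I, a, ha, hI⟩ := exists_isometry_tangentMat hA hA0 hAi hAν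
  obtain ⟨K, b, hb, hK⟩ := exists_isometry_tangentMat hB hB0 hBi hBν
  exact sameParabolicOrbit_of_prod hA.1 hB.1 (hA.tangentMat hA0 hAi hAν).2.2
    (hB.tangentMat hB0 hBi hBν).2.2 I K ha hb hI hK

end ParabolicOrbit

end ProjCompact

namespace ProjCompact
open Filter
open scoped Topology

/-! ### Determinants of parallel sections -/

section Determinant

open Matrix

variable {n : ℕ} {ι : Type*} [Fintype ι] [DecidableEq ι] {X : Coord n → Matrix ι ι ℝ}
  {y : Coord n} (a : Fin (n + 1))

omit [Fintype ι] in
lemma pd_prod (s : Finset ι) {f : ι → Coord n → ℝ}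
    (hf : ∀ i ∈ s, DifferentiableWithinAt ℝ (f i) (halfSpace n) y) (hy : y ∈ halfSpace n) :
    pd (fun z => ∏ i ∈ s, f i z) a y = ∑ i ∈ s, pd (f i) a y * ∏ j ∈ s.erase i, f j y := by
  have h := HasFDerivWithinAt.finsetProd fun i hi => (hf i hi).hasFDerivWithinAt
  rw [pd, h.fderivWithin (uniqueDiffOn_halfSpace y hy), _root_.sum_apply]
  refine Finset.sum_congr rfl fun i _ => ?_
  rw [_root_.smul_apply, smul_eq_mul, mul_comm]
  rfl

/-- Jacobi's formula. -/
lemma pd_det (hX : DiffMat X y) (hy : y ∈ halfSpace n) :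
    pd (fun z => (X z).det) a y = ((X y).adjugate * pdMat X a y).trace := by
  have h1 : ∀ σ : Equiv.Perm ι, DifferentiableWithinAt ℝ (fun z => ∏ i, X z (σ i) i)
      (halfSpace n) y := fun σ =>
    (HasFDerivWithinAt.finsetProd fun i _ => (hX (σ i) i).hasFDerivWithinAt).differentiableWithinAt
  have h2 : pd (fun z => (X z).det) a y = ∑ σ : Equiv.Perm ι, (Equiv.Perm.sign σ : ℝ) *
      ∑ i, pdMat X a y (σ i) i * ∏ j ∈ Finset.univ.erase i, X y (σ j) j := by
    simp only [det_apply']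
    rw [pd_sum a _ (fun σ _ => (h1 σ).const_mul _) hy]
    refine Finset.sum_congr rfl fun σ _ => ?_
    rw [pd_const_mul a _ (h1 σ) hy, pd_prod a _ (fun i _ => hX (σ i) i) hy]
    rfl
  -- By Cramer's rule the trace is the sum of the determinants in which one column has been
  -- differentiated.
  have h3 : ((X y).adjugate * pdMat X a y).trace =
      ∑ i, ((X y).updateCol i fun j => pdMat X a y j i).det := by
    rw [trace]
    refine Finset.sum_congr rfl fun i _ => ?_
    rw [← cramer_apply, cramer_eq_adjugate_mulVec]
    rfl
  rw [h2, h3]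
  simp only [det_apply', Finset.mul_sum]
  rw [Finset.sum_comm]
  refine Finset.sum_congr rfl fun i _ => Finset.sum_congr rfl fun σ _ => ?_
  rw [← Finset.mul_prod_erase _ _ (Finset.mem_univ i), updateCol_self]
  congr 2
  refine Finset.prod_congr rfl fun j hj => ?_
  rw [updateCol_ne (Finset.ne_of_mem_erase hj)]

/-- The determinant of a parallel bilinear form is constant, for a trace-free connection. -/
lemma pd_det_eq_zero {C : Matrix ι ι ℝ} (hX : DiffMat X y) (hy : y ∈ halfSpace n)
    (hC : C.trace = 0) (h : pdMat X a y + C * X y + X y * Cᵀ = 0) :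
    pd (fun z => (X z).det) a y = 0 := by
  have h1 : pdMat X a y = -(C * X y) - X y * Cᵀ := by
    rw [add_assoc] at h
    rw [eq_neg_of_add_eq_zero_left h, neg_add]; rfl
  -- By cyclicity of the trace both connection terms reduce to `det X` times the trace of `C`.
  rw [pd_det a hX hy, h1, Matrix.mul_sub, trace_sub, Matrix.mul_neg, trace_neg, ← Matrix.mul_assoc,
    trace_mul_comm, ← Matrix.mul_assoc, ← Matrix.mul_assoc, adjugate_mul, mul_adjugate]
  simp [hC]

end Determinant

/-! ### Vanishing derivatives up to the boundary and along it -/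

section LocallyConstant

variable {n : ℕ}

lemma IsRelOpen.exists_ball {S : Set (Coord n)} (hS : IsRelOpen S) {y : Coord n} (hy : y ∈ S) :
    ∃ ε > 0, Metric.ball y ε ∩ halfSpace n ⊆ S :=
  Metric.mem_nhdsWithin_iff.1 (hS.mem_nhdsWithin y hy)

/-- A function whose partial derivatives vanish, and which does not vanish in the interior, does
not vanish at the boundary. -/
lemma IsRelOpen.ne_zero_of_pd_eq_zero {S : Set (Coord n)} (hS : IsRelOpen S) {f : Coord n → ℝ}
    (hf : ContDiffOn ℝ ∞ f S) (hpd : ∀ z ∈ S, ∀ a, pd f a z = 0)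
    (h0 : ∀ z ∈ S, 0 < z 0 → f z ≠ 0) {y : Coord n} (hy : y ∈ S) : f y ≠ 0 := by
  obtain ⟨ε, hε, hsub⟩ := hS.exists_ball hy
  set T := Metric.ball y ε ∩ halfSpace n with hT
  have hTo : IsRelOpen T := by
    rw [hT, inter_comm]; exact isRelOpen_halfSpace.inter_isOpen Metric.isOpen_ball
  have hyT : y ∈ T := ⟨Metric.mem_ball_self hε, hS.subset hy⟩
  obtain ⟨z, hz⟩ : (T ∩ {z | 0 < z 0}).Nonempty :=
    closure_nonempty_iff.1 ⟨y, hTo.subset_closure_pos hyT⟩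
  have hder : ∀ w ∈ T, fderivWithin ℝ f T w = 0 := by
    intro w hw
    have h1 : fderivWithin ℝ f T w = fderivWithin ℝ f (halfSpace n) w := by
      have h2 := nhdsWithin_eq_iff_eventuallyEq.1 (hTo.nhdsWithin_eq hw)
      exact fderivWithin_congr_set (h2 : T =ᶠ[𝓝 w] halfSpace n)
    rw [h1, fderivWithin_eq_formOf]
    simp only [hpd w (hsub hw)]
    simp [formOf]
  have := ((convex_ball y ε).inter convex_halfSpace).is_const_of_fderivWithin_eq_zero
    ((hf.mono hsub).differentiableOn (by simp)) hder hyT hz.1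
  rw [this]
  exact h0 z (hsub hz.1) hz.2

/-- Functions which vanish on the boundary have vanishing tangential derivatives. -/
lemma IsRelOpen.pd_succ_eq_zero {S : Set (Coord n)} (hS : IsRelOpen S) {f : Coord n → ℝ}
    (hf : ContDiffOn ℝ ∞ f S) (h0 : ∀ z ∈ S, z 0 = 0 → f z = 0) {y : Coord n} (hy : y ∈ S)
    (hy0 : y 0 = 0) (i : Fin n) : pd f i.succ y = 0 := by
  have hline : HasDerivAt (fun s : ℝ => y + s • EuclideanSpace.single i.succ (1 : ℝ))
      (EuclideanSpace.single i.succ (1 : ℝ)) 0 := by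
    simpa using ((hasDerivAt_id (0 : ℝ)).smul_const
      (EuclideanSpace.single i.succ (1 : ℝ) : Coord n)).const_add y
  have hz : ∀ s : ℝ, (y + s • EuclideanSpace.single i.succ (1 : ℝ)) 0 = 0 := fun s => by
    simp [hy0]
  have hH : ∀ s : ℝ, y + s • EuclideanSpace.single i.succ (1 : ℝ) ∈ halfSpace n := fun s =>
    mem_halfSpace.2 (hz s).ge
  have h1 := (hS.differentiableWithinAt hf hy).hasFDerivWithinAt.comp_hasDerivAt_of_eq (0 : ℝ) hline
    (Eventually.of_forall hH) (by simp)
  have hev : ∀ᶠ s : ℝ in 𝓝 0, y + s • EuclideanSpace.single i.succ (1 : ℝ) ∈ S := by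
    have h2 : Tendsto (fun s : ℝ => y + s • EuclideanSpace.single i.succ (1 : ℝ)) (𝓝 0)
        (𝓝[halfSpace n] y) := by
      refine tendsto_nhdsWithin_iff.2 ⟨?_, Eventually.of_forall hH⟩
      simpa using hline.continuousAt.tendsto
    exact h2 (hS.mem_nhdsWithin y hy)
  have h3 : (f ∘ fun s : ℝ => y + s • EuclideanSpace.single i.succ (1 : ℝ)) =ᶠ[𝓝 0]
      fun _ => (0 : ℝ) := by
    filter_upwards [hev] with s hs using h0 _ hs (hz s)
  exact h1.unique ((hasDerivAt_const (0 : ℝ) (0 : ℝ)).congr_of_eventuallyEq h3)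

end LocallyConstant

/-! ### The signature and the sign of `L(τ)` -/

section Global

variable {n : ℕ} {M : Type*} [TopologicalSpace M] [ChartedSpace (EuclideanHalfSpace (n + 1)) M]

open SmoothChart

variable {e e' : SmoothChart n M} {U : Set M} {y : Coord n} {x : M}
  {𝔭 : ProjectiveStructure n M} {h : S2Cotractor n M} {τ : ProjDensity n M 2 univ} {p q : ℕ}

lemma trace_tractorConn (hy : y ∈ e.dom univ) (a : Fin (n + 1)) :
    (tractorConn 𝔭 e y a).trace = 0 := by
  simp [tractorConn, Matrix.trace, 𝔭.traceFree e y hy]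

/-- The determinant of a parallel form is locally constant in a chart, as the Thomas symbols, and
with them the tractor connection, are trace-free. A non-zero value in the interior persists at the
boundary. -/
lemma det_mat_ne_zero (hpar : h.IsParallel 𝔭)
    (hd : ∀ z ∈ e.dom univ, 0 < z 0 → (h.mat e z).det ≠ 0) (hy : y ∈ e.dom univ) :
    (h.mat e y).det ≠ 0 := by
  refine isRelOpen_dom_univ.ne_zero_of_pd_eq_zero (f := fun z => (h.mat e z).det) ?_
    (fun z hz a => pd_det_eq_zero a (fun i j => isRelOpen_dom_univ.differentiableWithinAt
      (h.smooth e i j) hz) (isRelOpen_dom_univ.subset hz) (trace_tractorConn hz a)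
      (hpar e z hz a)) hd hy
  simp only [Matrix.det_apply]
  exact ContDiffOn.sum fun σ _ => ContDiffOn.const_smul _ (contDiffOn_prod fun i _ => h.smooth e _ _)

lemma isUnit_det_cotractorChange (hy : y ∈ e.dom e'.1.source) :
    IsUnit (cotractorChange e e' y)ᵀ.det := by
  rw [Matrix.det_transpose, cotractorChange_eq, Matrix.det_smul, Matrix.det_fromBlocks_zero₁₂,
    Matrix.det_one, one_mul, Matrix.det_transpose, isUnit_iff_ne_zero]
  exact mul_ne_zero (pow_ne_zero _ (Real.rpow_pos_of_pos (abs_pos.2 (det_jac_ne_zero hy)) _).ne')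
    (det_jac_ne_zero hy)

lemma hasSignature_coordChange (hy : y ∈ e.dom e'.1.source)
    (hs : HasSignature (h.mat e' (coordChange e e' y)) p q) : HasSignature (h.mat e y) p q := by
  rw [h.transform e e' y hy]
  have := hs.congr (isUnit_det_cotractorChange hy)
  rwa [Matrix.transpose_transpose] at this

/-- The signature at a point does not depend on the chart. -/
lemma hasSignature_toCoord (hx : x ∈ e.1.source) (hx' : x ∈ e'.1.source)
    (hs : HasSignature (h.mat e' (e'.toCoord x)) p q) :
    HasSignature (h.mat e (e.toCoord x)) p q := by
  refine hasSignature_coordChange (e' := e') (toCoord_mem_dom hx hx') ?_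
  rwa [coordChange, point_toCoord hx]

lemma tendsto_toCoord (hx : x ∈ e.1.source) :
    Tendsto e.toCoord (𝓝 x) (𝓝[halfSpace n] (e.toCoord x)) := by
  refine tendsto_nhdsWithin_iff.2 ⟨e.1.continuousAt_extend hx, ?_⟩
  exact Eventually.of_forall fun z => mem_range_self _

lemma eventually_hasSignature (hx : x ∈ e.1.source)
    (hs : HasSignature (h.mat e (e.toCoord x)) p q) :
    ∀ᶠ z in 𝓝 x, z ∈ e.1.source ∧ HasSignature (h.mat e (e.toCoord z)) p q := by
  have hy : e.toCoord x ∈ e.dom univ := toCoord_mem_dom hx (mem_univ x)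
  have h1 : Tendsto (fun z => h.mat e (e.toCoord z)) (𝓝 x) (𝓝 (h.mat e (e.toCoord x))) := by
    refine Tendsto.comp (y := 𝓝[halfSpace n] (e.toCoord x)) ?_ (tendsto_toCoord hx)
    refine tendsto_pi_nhds.2 fun i => tendsto_pi_nhds.2 fun j => ?_
    exact (isRelOpen_dom_univ.contDiffWithinAt (h.smooth e i j) hy).continuousWithinAt
  filter_upwards [h1.eventually hs.eventually, e.1.open_source.mem_nhds hx] with z hz hzs
  exact ⟨hzs, hz (h.symm e _ (toCoord_mem_dom hzs (mem_univ z)))⟩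

variable [IsManifold (𝓡∂ (n + 1)) ∞ M]

/-- A non-degenerate section of `S²𝒯*` has constant signature on connected components. -/
lemma exists_signature_on_component
    (hd : ∀ e : SmoothChart n M, ∀ y ∈ e.dom univ, (h.mat e y).det ≠ 0) (x₀ : M) :
    ∃ p q, p + q = n + 2 ∧ ∀ x ∈ connectedComponent x₀, ∀ e : SmoothChart n M, x ∈ e.1.source →
      HasSignature (h.mat e (e.toCoord x)) p q := by
  have hex : ∀ x : M, ∃ pq : ℕ × ℕ, ∀ e : SmoothChart n M, x ∈ e.1.source →
      HasSignature (h.mat e (e.toCoord x)) pq.1 pq.2 := by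
    intro x
    have hx := mem_chartAtPoint_source (n := n) x
    have hy := toCoord_mem_dom (U := univ) hx (mem_univ x)
    obtain ⟨p, q, hpq⟩ := exists_hasSignature (h.symm _ _ hy) (hd _ _ hy)
    exact ⟨(p, q), fun e he => hasSignature_toCoord he hx hpq⟩
  choose sg hsg using hex
  -- The signature is chart independent and stable under small changes of the form, so as a function
  -- on the manifold it is locally constant.
  have hlc : IsLocallyConstant sg := by
    rw [IsLocallyConstant.iff_eventually_eq]
    intro x
    filter_upwards [eventually_hasSignature (mem_chartAtPoint_source (n := n) x)
      (hsg x _ (mem_chartAtPoint_source x))] with z hz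
    obtain ⟨h1, h2⟩ := (hsg z _ hz.1).unique hz.2
    exact Prod.ext h1 h2
  refine ⟨(sg x₀).1, (sg x₀).2, ?_, fun x hx e he => ?_⟩
  · rw [(hsg x₀ _ (mem_chartAtPoint_source x₀)).card_eq]
    simp; ring
  · rw [← hlc.apply_eq_of_isPreconnected isPreconnected_connectedComponent hx
      mem_connectedComponent]
    exact hsg x e he

omit [IsManifold (𝓡∂ (n + 1)) ∞ M] in
/-- A property of the sign of a density does not depend on the chart. -/
lemma density_sign_toCoord (hx : x ∈ e.1.source) (hx' : x ∈ e'.1.source) {s : ℝ}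
    (hs : 0 < s * τ.coef e' (e'.toCoord x)) : 0 < s * τ.coef e (e.toCoord x) := by
  have hy := toCoord_mem_dom hx hx'
  rw [τ.transform e e' _ (by rwa [univ_inter]), coordChange, point_toCoord hx]
  have := Real.rpow_pos_of_pos (abs_pos.2 (det_jac_ne_zero hy)) (-2 / ((n : ℝ) + 2))
  calc 0 < |(jac e e' (e.toCoord x)).det| ^ (-2 / ((n : ℝ) + 2)) *
        (s * τ.coef e' (e'.toCoord x)) := mul_pos this hs
    _ = _ := by ring

lemma exists_sign_of_ne_zero {f : Coord n → ℝ} (hf : ContinuousWithinAt f (halfSpace n) y)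
    (h0 : f y ≠ 0) : ∃ s : ℝ, (s = 1 ∨ s = -1) ∧ ∀ᶠ z in 𝓝[halfSpace n] y, 0 < s * f z := by
  rcases lt_or_gt_of_ne h0 with h | h
  · refine ⟨-1, Or.inr rfl, ?_⟩
    filter_upwards [hf.eventually_lt_const h] with z hz
    linarith
  · refine ⟨1, Or.inl rfl, ?_⟩
    filter_upwards [hf.eventually_const_lt h] with z hz
    linarith

/-- A defining density has a well defined sign in the interior, near every point. -/
lemma exists_sign_near (hτ : τ.IsDefining) (x : M) : ∃ U : Set M, IsOpen U ∧ x ∈ U ∧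
    ∃ s : ℝ, (s = 1 ∨ s = -1) ∧ ∀ z ∈ U ∩ inner n M, ∀ e : SmoothChart n M, z ∈ e.1.source →
      0 < s * τ.coef e (e.toCoord z) := by
  set c := chartAtPoint (n := n) x
  have hxc := mem_chartAtPoint_source (n := n) x
  set y := c.toCoord x with hy
  have hyd : y ∈ c.dom univ := toCoord_mem_dom hxc (mem_univ x)
  suffices hs : ∃ s : ℝ, (s = 1 ∨ s = -1) ∧
      ∀ᶠ w in 𝓝[halfSpace n] y, 0 < w 0 → 0 < s * τ.coef c w by
    obtain ⟨s, hs1, hs⟩ := hs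
    have h1 := (tendsto_toCoord hxc).eventually hs
    obtain ⟨U, hUsub, hU, hxU⟩ := mem_nhds_iff.1 (Filter.inter_mem h1 (c.1.open_source.mem_nhds hxc))
    refine ⟨U, hU, hxU, s, hs1, fun z hz e he => ?_⟩
    have hzc : z ∈ c.1.source := (hUsub hz.1).2
    refine density_sign_toCoord he hzc ((hUsub hz.1).1 ?_)
    have hzd : c.toCoord z ∈ c.dom univ := toCoord_mem_dom hzc (mem_univ z)
    rw [← point_mem_inner_iff hzd, point_toCoord hzc]
    exact hz.2
  rcases (𝓡∂ (n + 1)).isInteriorPoint_or_isBoundaryPoint x with hx | hx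
  · have h0 : τ.coef c y ≠ 0 := by
      rw [ne_eq, hτ.1 c y hyd, hy, point_toCoord hxc, bdry, ← ModelWithCorners.compl_interior]
      exact fun h => h hx
    obtain ⟨s, hs1, hs⟩ := exists_sign_of_ne_zero
      (isRelOpen_dom_univ.contDiffWithinAt (τ.smooth c) hyd).continuousWithinAt h0
    exact ⟨s, hs1, hs.mono fun w hw _ => hw⟩
  -- Near a boundary point the sign is that of the non-vanishing factor `σ`, because `ρ` is positive
  -- in the interior. In particular it is the same on all nearby interior points.
  · obtain ⟨U, hU, hxU, ρ, hρ, σ, hσ, hτσ⟩ := hτ.2 x hx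
    have hyU : y ∈ c.dom U := toCoord_mem_dom hxc hxU
    obtain ⟨s, hs1, hs⟩ := exists_sign_of_ne_zero
      ((isRelOpen_dom hU).contDiffWithinAt (σ.smooth c) hyU).continuousWithinAt (hσ c y hyU)
    refine ⟨s, hs1, ?_⟩
    filter_upwards [hs, (isRelOpen_dom hU).mem_nhdsWithin y hyU] with w hw hwU hw0
    have h1 : 0 < ρ (c.point w) := by
      refine lt_of_le_of_ne (hρ.nonneg _ hwU.2) fun h => ?_
      exact hw0.ne' ((point_mem_bdry_iff hwU).1 ((hρ.zero_iff _ hwU.2).1 h.symm))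
    rw [hτσ c w hwU]
    calc 0 < ρ (c.point w) * (s * σ.coef c w) := mul_pos h1 hw
      _ = _ := by ring

/-- A defining density has constant sign in the interior of a connected component. -/
lemma exists_sign_on_component (hτ : τ.IsDefining) (x₀ : M) : ∃ s : ℝ, (s = 1 ∨ s = -1) ∧
    ∀ z ∈ connectedComponent x₀ ∩ inner n M, ∀ e : SmoothChart n M, z ∈ e.1.source →
      0 < s * τ.coef e (e.toCoord z) := by
  choose U hU hxU s hs1 hs using exists_sign_near hτ
  have hlc : IsLocallyConstant s := by
    rw [IsLocallyConstant.iff_eventually_eq]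
    intro x
    filter_upwards [(hU x).mem_nhds (hxU x)] with z hz
    set c := chartAtPoint (n := n) z
    have hzc := mem_chartAtPoint_source (n := n) z
    have hzd : c.toCoord z ∈ c.dom (U z ∩ U x) := toCoord_mem_dom hzc ⟨hxU z, hz⟩
    -- The point `z` may lie on the boundary, where the sign cannot be read off. Both neighbourhoods
    -- contain a common interior point at which the two signs are compared.
    obtain ⟨w, hw, hw0⟩ : (c.dom (U z ∩ U x) ∩ {w | 0 < w 0}).Nonempty := closure_nonempty_iff.1
      ⟨_, (isRelOpen_dom ((hU z).inter (hU x))).subset_closure_pos hzd⟩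
    have hwi := (point_mem_inner_iff hw).2 hw0
    have h1 := hs z _ ⟨hw.2.1, hwi⟩ c (point_mem_source hw)
    have h2 := hs x _ ⟨hw.2.2, hwi⟩ c (point_mem_source hw)
    rcases hs1 z with h3 | h3 <;> rcases hs1 x with h4 | h4 <;> rw [h3] at h1 ⊢ <;>
      rw [h4] at h2 ⊢ <;> linarith
  refine ⟨s x₀, hs1 x₀, fun z hz e he => ?_⟩
  rw [← hlc.apply_eq_of_isPreconnected isPreconnected_connectedComponent hz.1
    mem_connectedComponent]
  exact hs z z ⟨hxU z, hz.2⟩ e he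

end Global

end ProjCompact

namespace ProjCompact
open Filter
open scoped Topology

/-! ### Curved orbits and the conformal structure on the boundary -/

/-- The half space is convex, hence locally connected, and this property passes to spaces modelled
on it. -/
lemma isOpen_connectedComponent_of_chartedSpace (n : ℕ) {M : Type*} [TopologicalSpace M]
    [ChartedSpace (EuclideanHalfSpace (n + 1)) M] (x : M) : IsOpen (connectedComponent x) := by
  have h1 : LocallyConnectedSpace (EuclideanHalfSpace (n + 1)) := by
    have := (EuclideanHalfSpace.convex (n := n + 1)).locallyPathConnectedSpace
    exact inferInstanceAs (LocallyConnectedSpace {x : EuclideanSpace ℝ (Fin (n + 1)) | 0 ≤ x 0})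
  have := ChartedSpace.locallyConnectedSpace (EuclideanHalfSpace (n + 1)) M
  exact isOpen_connectedComponent

section Orbits

variable {n : ℕ} {M : Type*} [TopologicalSpace M] [ChartedSpace (EuclideanHalfSpace (n + 1)) M]
  [IsManifold (𝓡∂ (n + 1)) ∞ M]

open SmoothChart

variable {e e' : SmoothChart n M} {y : Coord n} {x z : M} {cov : CovOp n M}
  {𝔭 : ProjectiveStructure n M} {h : S2Cotractor n M} {τ₀ : ProjDensity n M 2 (inner n M)}
  {τ : ProjDensity n M 2 univ} {p q : ℕ} {C : Set M}

lemma isClosed_bdry : IsClosed (bdry n M) := (𝓡∂ (n + 1)).isClosed_boundary (n := ∞) (by simp)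

/-- In the interior `splitMat_eq` gives `det L(τ) = τ^(n+2) n^(-(n+1)) det Ric`; parallelism extends
non-vanishing to the boundary. -/
lemma det_splitting_ne_zero (hn : (n : ℝ) ≠ 0) (hcov : IsAffineConnectionOn cov (inner n M))
    (hp : 𝔭.IsClassOf cov) (hτ₀ : τ₀.NowhereZero) (hτ₀' : τ₀.IsParallel cov) (hτ : τ.Extends τ₀)
    (hnd : IsNondegenerateOn (Ric cov) (inner n M)) (hs : IsSplitting 𝔭 τ h)
    (hpar : h.IsParallel 𝔭) (hy : y ∈ e.dom univ) : (h.mat e y).det ≠ 0 := by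
  refine det_mat_ne_zero hpar (fun z hz hz0 => ?_) hy
  have hzi : z ∈ e.dom (inner n M) := by rw [dom_inner]; exact ⟨hz, hz0⟩
  have hsc := isParallelScale hcov hp hτ₀ hτ₀' hτ e
  rw [isSplitting_iff.1 hs e z hz, hsc.splitMat_eq hzi hn, Matrix.det_smul, Matrix.det_mul,
    Matrix.det_mul, Matrix.det_transpose, shearMat, Matrix.det_fromBlocks_zero₁₂,
    Matrix.det_fromBlocks_zero₁₂, Matrix.det_smul]
  simp only [Matrix.det_one, one_mul, mul_one]
  exact mul_ne_zero (pow_ne_zero _ (hsc.ne_zero z hzi))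
    (mul_ne_zero (pow_ne_zero _ (one_div_ne_zero hn)) (hnd e z hzi))

omit [IsManifold (𝓡∂ (n + 1)) ∞ M] in
lemma mat_inl_inl_eq_zero_iff (hτ : τ.IsDefining) (hs : IsSplitting 𝔭 τ h) (hy : y ∈ e.dom univ) :
    h.mat e y (Sum.inl ()) (Sum.inl ()) = 0 ↔ e.point y ∈ bdry n M := by
  rw [(hs e y hy).1]; exact hτ.1 e y hy

/-- The middle slot is half the differential of `τ`, and `τ` vanishes along the boundary, so only
its normal component can be non-zero. -/
lemma mat_inl_succ (hτ : τ.IsDefining) (hs : IsSplitting 𝔭 τ h) (hy : y ∈ e.dom (bdry n M))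
    (i : Fin n) : h.mat e y (Sum.inl ()) (Sum.inr i.succ) = 0 := by
  have hyu := dom_subset_univ hy
  rw [isSplitting_iff.1 hs e y hyu]
  change 1 / 2 * pd (τ.coef e) i.succ y = 0
  rw [isRelOpen_dom_univ.pd_succ_eq_zero (τ.smooth e) (fun z hz hz0 =>
    (hτ.1 e z hz).2 ((point_mem_bdry_iff hz).2 hz0)) hyu ((point_mem_bdry_iff hy).1 hy.2), mul_zero]

/-- All other entries of the first row vanish at the boundary, so non-degeneracy leaves no choice.
-/
lemma mat_inl_zero_ne_zero (hτ : τ.IsDefining) (hs : IsSplitting 𝔭 τ h)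
    (hd : (h.mat e y).det ≠ 0) (hy : y ∈ e.dom (bdry n M)) :
    h.mat e y (Sum.inl ()) (Sum.inr 0) ≠ 0 := by
  intro h0
  refine hd (Matrix.det_eq_zero_of_row_eq_zero (Sum.inl ()) ?_)
  rintro (i | a)
  · exact (mat_inl_inl_eq_zero_iff hτ hs (dom_subset_univ hy)).2 hy.2
  · refine Fin.cases h0 (fun i => mat_inl_succ hτ hs hy i) a

lemma coordChange_zero (hy : y ∈ e.dom e'.1.source) (h0 : y 0 = 0) : coordChange e e' y 0 = 0 := by
  have h1 := (point_mem_bdry_iff hy).2 h0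
  rw [← point_coordChange hy] at h1
  exact (point_mem_bdry_iff (coordChange_mem hy)).1 h1

/-- At the boundary, the change of charts preserves the directions tangent to the boundary. -/
lemma jac_zero_succ (hy : y ∈ e.dom e'.1.source) (h0 : y 0 = 0) (i : Fin n) :
    jac e e' y 0 i.succ = 0 :=
  isRelOpen_dom_source.pd_succ_eq_zero (contDiffOn_coordChange_apply 0)
    (fun _ hz hz0 => coordChange_zero hz hz0) hy h0 i

/-- Over the interior and over the boundary, the section `L(τ)` has constant parabolic type. -/
lemma curvedOrbit_inner (hτ : τ.IsDefining) (hs : IsSplitting 𝔭 τ h) {x₀ : M}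
    (hC : ∀ x ∈ connectedComponent x₀, ∀ e : SmoothChart n M, x ∈ e.1.source →
      HasSignature (h.mat e (e.toCoord x)) p q)
    (hx : x ∈ connectedComponent x₀ ∩ inner n M) :
    curvedOrbit h x ∩ connectedComponent x₀ = connectedComponent x₀ ∩ inner n M := by
  have hb : inner n M = (bdry n M)ᶜ := (𝓡∂ (n + 1)).compl_boundary.symm
  ext z
  constructor
  · rintro ⟨⟨e, e', hxe, hze, hsame⟩, hzC⟩
    obtain ⟨c, -, hcc⟩ := hsame.apply_inl_inl
    refine ⟨hzC, ?_⟩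
    rw [hb, mem_compl_iff]
    intro hzb
    rw [(mat_inl_inl_eq_zero_iff hτ hs (toCoord_mem_dom hze (mem_univ z))).2
      (by rwa [point_toCoord hze]), mul_zero,
      mat_inl_inl_eq_zero_iff hτ hs (toCoord_mem_dom hxe (mem_univ x)), point_toCoord hxe] at hcc
    rw [hb] at hx
    exact hx.2 hcc
  · rintro hz
    refine ⟨⟨chartAtPoint x, chartAtPoint z, mem_chartAtPoint_source x, mem_chartAtPoint_source z,
      ?_⟩, hz.1⟩
    -- Equal signature alone does not suffice in the interior: forms whose top slots have opposite
    -- signs lie in different orbits of the parabolic subgroup.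
    obtain ⟨s, hs1, hsg⟩ := exists_sign_on_component hτ x₀
    have hx' := mem_chartAtPoint_source (n := n) x
    have hz' := mem_chartAtPoint_source (n := n) z
    refine sameParabolicOrbit_of_ne_zero (hC x hx.1 _ hx') (hC z hz.1 _ hz') hs1 ?_ ?_
    · rw [(hs _ _ (toCoord_mem_dom hx' (mem_univ x))).1]
      exact hsg x hx _ hx'
    · rw [(hs _ _ (toCoord_mem_dom hz' (mem_univ z))).1]
      exact hsg z hz _ hz'

lemma curvedOrbit_bdry (hτ : τ.IsDefining) (hs : IsSplitting 𝔭 τ h) {x₀ : M}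
    (hC : ∀ x ∈ connectedComponent x₀, ∀ e : SmoothChart n M, x ∈ e.1.source →
      HasSignature (h.mat e (e.toCoord x)) p q)
    (hx : x ∈ connectedComponent x₀ ∩ bdry n M) :
    curvedOrbit h x ∩ connectedComponent x₀ = connectedComponent x₀ ∩ bdry n M := by
  ext z
  constructor
  · rintro ⟨⟨e, e', hxe, hze, hsame⟩, hzC⟩
    obtain ⟨c, hc0, hcc⟩ := hsame.apply_inl_inl
    refine ⟨hzC, ?_⟩
    rw [(mat_inl_inl_eq_zero_iff hτ hs (toCoord_mem_dom hxe (mem_univ x))).2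
      (by rw [point_toCoord hxe]; exact hx.2), eq_comm, mul_eq_zero,
      mat_inl_inl_eq_zero_iff hτ hs (toCoord_mem_dom hze (mem_univ z)), point_toCoord hze] at hcc
    exact hcc.resolve_left hc0.ne'
  · rintro hz
    refine ⟨⟨chartAtPoint x, chartAtPoint z, mem_chartAtPoint_source x, mem_chartAtPoint_source z,
      ?_⟩, hz.1⟩
    have key : ∀ w ∈ connectedComponent x₀ ∩ bdry n M,
        (chartAtPoint (n := n) w).toCoord w ∈ (chartAtPoint (n := n) w).dom (bdry n M) :=
      fun w hw => toCoord_mem_dom (mem_chartAtPoint_source w) hw.2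
    have hx' := hC x hx.1 _ (mem_chartAtPoint_source (n := n) x)
    have hz' := hC z hz.1 _ (mem_chartAtPoint_source (n := n) z)
    have h0 : ∀ w ∈ connectedComponent x₀ ∩ bdry n M, h.mat (chartAtPoint w)
        ((chartAtPoint w).toCoord w) (Sum.inl ()) (Sum.inl ()) = 0 := fun w hw =>
      (mat_inl_inl_eq_zero_iff hτ hs (dom_subset_univ (key w hw))).2 (key w hw).2
    exact sameParabolicOrbit_of_isotropic hx' hz' (h0 x hx)
      (mat_inl_succ hτ hs (key x hx)) (mat_inl_zero_ne_zero hτ hs hx'.2.1 (key x hx)) (h0 z hz)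
      (mat_inl_succ hτ hs (key z hz)) (mat_inl_zero_ne_zero hτ hs hz'.2.1 (key z hz))

/-- A change of chart mixes the upper slots into the bottom one. Along the boundary the top slot,
the tangential middle slot and the Jacobian entries from tangential to normal directions vanish, so
the tangential block changes by a congruence and the positive factor `κ²`. -/
lemma boundaryForm_transform (hτ : τ.IsDefining) (hs : IsSplitting 𝔭 τ h)
    (hy : y ∈ e.dom (bdry n M ∩ e'.1.source)) : ∃ c : ℝ, 0 < c ∧ boundaryForm h e y =
      c • (((jac e e' y).submatrix Fin.succ Fin.succ)ᵀ * boundaryForm h e' (coordChange e e' y)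
        * (jac e e' y).submatrix Fin.succ Fin.succ) := by
  have hys : y ∈ e.dom e'.1.source := dom_mono inter_subset_right hy
  have hyb : coordChange e e' y ∈ e'.dom (bdry n M) := coordChange_mem_dom hys hy.2.1
  have hy0 : y 0 = 0 := (point_mem_bdry_iff hy).1 hy.2.1
  set κ := |(jac e e' y).det| ^ (-1 / ((n : ℝ) + 2)) with hκ
  have hκ0 : 0 < κ := Real.rpow_pos_of_pos (abs_pos.2 (det_jac_ne_zero hys)) _
  set B := h.mat e' (coordChange e e' y) with hB
  have hBs : B.IsSymm := h.symm e' _ (dom_subset_univ hyb)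
  have h00 : B (Sum.inl ()) (Sum.inl ()) = 0 :=
    (mat_inl_inl_eq_zero_iff hτ hs (dom_subset_univ hyb)).2 hyb.2
  have h0i : ∀ i : Fin n, B (Sum.inl ()) (Sum.inr i.succ) = 0 := mat_inl_succ hτ hs hyb
  have hi0 : ∀ i : Fin n, B (Sum.inr i.succ) (Sum.inl ()) = 0 := fun i => by
    rw [hBs.apply]; exact h0i i
  have hJ : ∀ i : Fin n, jac e e' y 0 i.succ = 0 := jac_zero_succ hys hy0
  refine ⟨κ * κ, mul_pos hκ0 hκ0, ?_⟩
  ext i j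
  change h.mat e y (Sum.inr i.succ) (Sum.inr j.succ) = _
  rw [h.transform e e' y hys, cotractorChange_eq, ← hκ, ← hB, Matrix.transpose_smul,
    Matrix.smul_mul, Matrix.smul_mul, Matrix.mul_smul, smul_smul, Matrix.smul_apply,
    Matrix.smul_apply]
  congr 1
  simp only [Matrix.mul_apply, Matrix.transpose_apply, Fintype.sum_sum_type, Finset.univ_unique,
    PUnit.default_eq_unit, Finset.sum_singleton, Matrix.fromBlocks_apply₂₁,
    Matrix.fromBlocks_apply₂₂, Matrix.of_apply, Fin.sum_univ_succ, h00, h0i, hi0, hJ,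
    Matrix.transpose_apply, mul_zero, zero_mul, zero_add, add_zero, Finset.sum_const_zero]
  rfl

/-- The conformal structure induced on the boundary. -/
lemma inducesBoundaryConformalStructure (hτ : τ.IsDefining) (hs : IsSplitting 𝔭 τ h)
    (hC : ∀ x ∈ C, ∀ e : SmoothChart n M, x ∈ e.1.source →
      HasSignature (h.mat e (e.toCoord x)) p q) :
    InducesBoundaryConformalStructure h C (p - 1) (q - 1) := by
  have hsig : ∀ e : SmoothChart n M, ∀ y ∈ e.dom (C ∩ bdry n M), HasSignature (h.mat e y) p q := by
    intro e y hy
    have := hC _ hy.2.1 e (point_mem_source hy)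
    rwa [toCoord_point hy] at this
  have hb : ∀ e : SmoothChart n M, ∀ y ∈ e.dom (C ∩ bdry n M), y ∈ e.dom (bdry n M) :=
    fun e y hy => dom_mono inter_subset_right hy
  have h00 : ∀ e : SmoothChart n M, ∀ y ∈ e.dom (C ∩ bdry n M),
      h.mat e y (Sum.inl ()) (Sum.inl ()) = 0 := fun e y hy =>
    (mat_inl_inl_eq_zero_iff hτ hs (dom_subset_univ hy)).2 hy.2.2
  refine ⟨fun e y hy v => ?_, ⟨fun e i j => ?_, fun e y hy => ?_, fun e e' y hy => ?_⟩⟩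
  · have h1 := mat_inl_zero_ne_zero hτ hs (hsig e y hy).2.1 (hb e y hy)
    rw [single_one_dotProduct]
    simp only [Matrix.mulVec, dotProduct, Fintype.sum_sum_type, Finset.univ_unique,
      PUnit.default_eq_unit, Fin.sum_univ_succ, h00 e y hy,
      mat_inl_succ hτ hs (hb e y hy), zero_mul, Finset.sum_const_zero, zero_add, add_zero,
      mul_eq_zero, h1, false_or]
  · exact (h.smooth e _ _).mono dom_subset_univ
  · exact ((hsig e y hy).tangentMat (h00 e y hy) (mat_inl_succ hτ hs (hb e y hy))
      (mat_inl_zero_ne_zero hτ hs (hsig e y hy).2.1 (hb e y hy))).2.2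
  · exact boundaryForm_transform hτ hs (dom_mono (inter_subset_inter_left _ inter_subset_right) hy)

/-- The holonomy reduction defined by a non-degenerate normal solution, and its curved orbits. -/
theorem exists_orthogonalReduction (hτ : τ.IsDefining) (hs : IsSplitting 𝔭 τ h)
    (hpar : h.IsParallel 𝔭) (hd : ∀ e : SmoothChart n M, ∀ y ∈ e.dom univ, (h.mat e y).det ≠ 0)
    (x₀ : M) :
    ∃ p q : ℕ, p + q = n + 2 ∧
      IsOrthogonalReductionOn 𝔭 h (connectedComponent x₀) p q ∧
      (∀ x ∈ connectedComponent x₀ ∩ inner n M,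
        curvedOrbit h x ∩ connectedComponent x₀ = connectedComponent x₀ ∩ inner n M) ∧
      (∀ x ∈ connectedComponent x₀ ∩ bdry n M,
        curvedOrbit h x ∩ connectedComponent x₀ = connectedComponent x₀ ∩ bdry n M) ∧
      IsOpen (connectedComponent x₀ ∩ inner n M) ∧
      IsClosed (connectedComponent x₀ ∩ bdry n M) ∧
      ((connectedComponent x₀ ∩ bdry n M).Nonempty →
        1 ≤ p ∧ 1 ≤ q ∧
        InducesBoundaryConformalStructure h (connectedComponent x₀) (p - 1) (q - 1)) := by
  obtain ⟨p, q, hpq, hC⟩ := exists_signature_on_component hd x₀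
  refine ⟨p, q, hpq, fun e y hy => ⟨hpar e y (dom_subset_univ hy), ?_⟩,
    fun x hx => curvedOrbit_inner hτ hs hC hx, fun x hx => curvedOrbit_bdry hτ hs hC hx,
    (isOpen_connectedComponent_of_chartedSpace n x₀).inter isOpen_inner,
    isClosed_connectedComponent.inter isClosed_bdry, fun ⟨x, hx⟩ => ?_⟩
  · have := hC _ hy.2 e (point_mem_source hy)
    rwa [toCoord_point hy] at this
  · have hxs := mem_chartAtPoint_source (n := n) x
    have hyb : (chartAtPoint (n := n) x).toCoord x ∈ (chartAtPoint (n := n) x).dom (bdry n M) :=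
      toCoord_mem_dom hxs hx.2
    have hsig := hC x hx.1 _ hxs
    obtain ⟨h1, h2, -⟩ := hsig.tangentMat
      ((mat_inl_inl_eq_zero_iff hτ hs (dom_subset_univ hyb)).2 hyb.2) (mat_inl_succ hτ hs hyb)
      (mat_inl_zero_ne_zero hτ hs hsig.2.1 hyb)
    exact ⟨h1, h2, inducesBoundaryConformalStructure hτ hs hC⟩

end Orbits

end ProjCompact

/-! ### Assembly of the theorem -/

open ProjCompact in
theorem theorem3 (n : ℕ) (hn : 1 ≤ n) (M : Type*) [TopologicalSpace M] [T2Space M]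
    [SecondCountableTopology M] [ChartedSpace (EuclideanHalfSpace (n + 1)) M]
    [IsManifold (𝓡∂ (n + 1)) ∞ M]
    (cov : CovOp n M) (hcov : IsAffineConnectionOn cov (inner n M))
    (hspecial : IsSpecial cov) (hcompact : IsProjectivelyCompact cov 2)
    (τ₀ : ProjDensity n M 2 (inner n M)) (hτ₀ : τ₀.NowhereZero) (hτ₀' : τ₀.IsParallel cov) :
    (∃ 𝔭 : ProjectiveStructure n M, 𝔭.IsClassOf cov) ∧
    (∃ τ : ProjDensity n M 2 univ, τ.Extends τ₀) ∧
    ∀ (𝔭 : ProjectiveStructure n M) (τ : ProjDensity n M 2 univ),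
      𝔭.IsClassOf cov → τ.Extends τ₀ →
      τ.IsDefining ∧
      (∃ h : S2Cotractor n M, IsSplitting 𝔭 τ h) ∧
      (IsBGGSolution 𝔭 τ ↔ IsSymParallelTensor cov (Ric cov) (inner n M)) ∧
      (IsNormalSolution 𝔭 τ ↔ IsParallelTensor cov (Ric cov) (inner n M)) ∧
      (IsNormalSolution 𝔭 τ → IsNondegenerateOn (Ric cov) (inner n M) →
        IsEinsteinOn cov (Ric cov) (inner n M) ∧
        ∀ h : S2Cotractor n M, IsSplitting 𝔭 τ h → ∀ x₀ : M,
          ∃ p q : ℕ, p + q = n + 2 ∧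
            IsOrthogonalReductionOn 𝔭 h (connectedComponent x₀) p q ∧
            (∀ x ∈ connectedComponent x₀ ∩ inner n M,
              curvedOrbit h x ∩ connectedComponent x₀ = connectedComponent x₀ ∩ inner n M) ∧
            (∀ x ∈ connectedComponent x₀ ∩ bdry n M,
              curvedOrbit h x ∩ connectedComponent x₀ = connectedComponent x₀ ∩ bdry n M) ∧
            IsOpen (connectedComponent x₀ ∩ inner n M) ∧
            IsClosed (connectedComponent x₀ ∩ bdry n M) ∧
            ((connectedComponent x₀ ∩ bdry n M).Nonempty →
              1 ≤ p ∧ 1 ≤ q ∧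
              InducesBoundaryConformalStructure h (connectedComponent x₀) (p - 1) (q - 1))) := by
  -- Needed because the Schouten tensor is the Ricci tensor divided by `n`.
  have hn' : (n : ℝ) ≠ 0 := Nat.cast_ne_zero.2 (by omega)
  refine ⟨exists_projectiveStructure hcov hcompact, exists_extends hcompact hτ₀ hτ₀',
    fun 𝔭 τ hp hτ => ?_⟩
  have hdef := isDefining_of_extends hcompact hτ₀ hτ₀' hτ
  have hnorm := isNormalSolution_iff hn' hcov hp hτ₀ hτ₀' hτ
  refine ⟨hdef, exists_isSplitting hn' hcov hp hτ₀ hτ₀' hτ,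
    isBGGSolution_iff hn' hcov hp hτ₀ hτ₀' hτ, hnorm, fun hsol hnd =>
    ⟨isEinsteinOn hcov hp hτ₀ hτ₀' hτ (hnorm.1 hsol) hnd, fun h hs x₀ => ?_⟩⟩
  have hpar := (isParallel_iff hn' hcov hp hτ₀ hτ₀' hτ hs).2 (hnorm.1 hsol)
  exact exists_orthogonalReduction hdef hs hpar (fun _ _ hy =>
    det_splitting_ne_zero hn' hcov hp hτ₀ hτ₀' hτ hnd hs hpar hy) x₀
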